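/- **Setting.** Consider an episodic tabular POMDP $f^*$ with horizon $H$, finite state, observation and (non-empty) action spaces $\mathcal S,\mathcal O,\mathcal A$, initial state distribution $\mu_1$, transition matrices $\mathbb T_{h}$, emission matrices $\mathbb O_h$ and known rewards $r_h(o_h,a_h)\in[0,1]$. Write $\tau_h=(o_1,a_1,\dots,o_h,a_h)$ for histories; policies are randomized and history-dependent; $\mathbb P^\pi_f(\tau_H)$ and $V^\pi_f$ are the trajectory probability and the expected cumulative reward of the policy $\pi$ in the model $f$; $V^\pi=V^\pi_{f^*}$, $V^*=\sup_\pi V^\pi$. For $0\le h\le H-1$ let $D_h$ be the matrix with entries $\mathbb P(t\mid\tau_h)$, the probability of seeing the observations of the test $t=(o_{h+1:h+W},a_{h+1:h+W-1})$ when its actions are executed after $\tau_h$ ($0$ if $\tau_h$ is unreachable); its rows are indexed by the tests with $1\le W\le H-h$ and its columns by the histories of length $h$. Put $d_{\mathrm{PSR},h}=\operatorname{rank}D_h$ and $d_{\mathrm{PSR}}=\max_h d_{\mathrm{PSR},h}$. A set $\mathcal U_{h+1}$ of tests is a core test set if the submatrix of $D_h$ of the rows in $\mathcal U_{h+1}$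 has rank $d_{\mathrm{PSR},h}$. Its columns are the predictive states $q_{\tau_h}$, and $K_h$ is a matrix formed by $d_{\mathrm{PSR},h}$ of the columns of which all the columns are linear combinations, chosen with the smallest $\|K_h^\dagger\|_{1\mapsto1}$. For $1\le m\le H$ the POMDP is $m$-step weakly-revealing if for every $h\in[H-m+1]$ the matrix with entries $\mathbb P(o_{h:h+m-1}\mid s_h=s,a_{h:h+m-2})$ (rows $(a_{h:h+m-2},o_{h:h+m-1})$, columns $s$) has rank $|\mathcal S|$. An $\epsilon$-bracket of size $n$ of a class $\mathcal F$ of models consists of functions $g_1^i,g_2^i$ ($i\in[n]$) of a policy and a trajectory such that $\|g_1^i(\pi,\cdot)-g_2^i(\pi,\cdot)\|_1\le\epsilon$ for all $i,\pi$ and such that for every $f\in\mathcal F$ there is an $i$ with $g_1^i(\pi,\tau_H)\le\mathbb P_f^\pi(\tau_H)\le g_2^i(\pi,\tau_H)$ for all $\pi,\tau_H$; $\mathcal N_{\mathcal F}(\epsilon)$ is the smallest such $n$. Let $\mathcal U_h=(\mathcal O\times\mathcal A)^{m-1}\times\mathcal O$ be the set of all $m$-step futures ($h\in[H-m+1]$),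 so that its set of action sequences is $\mathcal U_A=\mathcal A^{m-1}$. CRANE with model class $\mathcal F$ and parameter $\beta$, run up to step $H-m$, performs $K$ iterations. In iteration $k$ it selects $(f^k,\pi^k)\in\arg\max_{f\in\mathcal B^k,\pi}V_f^\pi$; then for every $h\in\{0,\dots,H-m\}$ and every $u\in\mathcal U_A$ it executes the policy that follows $\pi^k$ at the steps before $h$, acts uniformly at step $h$, then executes the actions $u$, then acts uniformly, and adds this policy and the observed trajectory to the data set $\mathcal D$. Here $\mathcal B^1=\mathcal F$ and $\mathcal B^{k+1}$ is the set of $f\in\mathcal F$ with $\sum_{(\pi,\tau_H)\in\mathcal D}\log\mathbb P_f^\pi(\tau_H)\ge\sup_{f'\in\mathcal F}\sum_{(\pi,\tau_H)\in\mathcal D}\log\mathbb P_{f'}^\pi(\tau_H)-\beta$. The output $\widehat\pi$ is the uniform mixture of $\pi^1,\dots,\pi^K$. **Statement.** 1. If $f^*$ is $m$-step weakly-revealing, then $\mathcal U_h$ is a core test set for every $h\in[H-m+1]$, and $d_{\mathrm{PSR}}\le|\mathcal S|$. 2. For every class $\mathcal F$ of tabular POMDPs with the given $\mathcal S,\mathcal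 O,\mathcal A,H$ and every $\epsilon\in(0,1]$, $\mathcal N_{\mathcal F}(\epsilon)$ is finite and $\log\mathcal N_{\mathcal F}(\epsilon)\le\mathrm{poly}(|\mathcal O|,|\mathcal A|,|\mathcal S|,H,\log(1/\epsilon))$, for one universal polynomial. 3. There are an absolute constant $c>0$ and a universal polynomial $\mathrm{poly}$ such that the following holds. Let $f^*$ be $m$-step weakly-revealing, let $\alpha>0$, and let $\mathcal F\ni f^*$ be a class of tabular POMDPs (with the given $\mathcal S,\mathcal O,\mathcal A,H$) such that for every $f\in\mathcal F$ and every $h\in\{0,\dots,H-m\}$ the set $\mathcal U_{h+1}$ is a core test set of $f$ and the core matrix of $f$ satisfies $\|K_{h;f}^\dagger\|_{1\mapsto1}\le1/\alpha$. Let $\delta\in(0,1]$, $\epsilon>0$. If $$K\ge\frac1{\epsilon^2}\,\mathrm{poly}\bigl(d_{\mathrm{PSR}},|\mathcal A|^m,1/\alpha,|\mathcal O|,|\mathcal S|,H,\log(1/\delta),\log(1+1/\epsilon)\bigr)$$ and CRANE is executed up to step $H-m$ for $K$ iterations with $\beta=c\log(\mathcal N_{\mathcal F}(\epsilon_{\mathrm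 b})KH|\mathcal U_A|/\delta)$, $\epsilon_{\mathrm b}=1/(KH|\mathcal U_A|)$, then with probability at least $1-\delta$ we have $V^{\widehat\pi}\ge V^*-\epsilon$. -/

import Mathlib

open scoped Matrix

noncomputable section

namespace CranePSR

/-! ### Tabular POMDPs, policies, trajectories

Steps are counted from `0`: what happens at step `h` (for `h < H`) is that the observation is
emitted, the action is taken and the latent state moves on.  A history of length `h` is the list of
the first `h` observation/action pairs.  Only the parameters at steps `h < H` are ever used. -/

/-- The dynamics of a tabular POMDP with state space `S`, observation space `O`, action space `A`:
the initial state distribution, the transition matrices `trans h a s s' = P_h(s' | s, a)` and the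
emission matrices `emit h s o = O_h(o | s)`. -/
structure POMDP (S O A : Type*) [Fintype S] [Fintype O] where
  init : S → ℝ
  trans : ℕ → A → S → S → ℝ
  emit : ℕ → S → O → ℝ
  init_nonneg : ∀ s, 0 ≤ init s
  init_sum : ∑ s, init s = 1
  trans_nonneg : ∀ h a s s', 0 ≤ trans h a s s'
  trans_sum : ∀ h a s, ∑ s', trans h a s s' = 1
  emit_nonneg : ∀ h s o, 0 ≤ emit h s o
  emit_sum : ∀ h s, ∑ o, emit h s o = 1

/-- A (randomized, history-dependent) policy: `prob τ o a` is the probability of the action `a`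
after the history `τ` and the current observation `o`. -/
structure Policy (O A : Type*) [Fintype A] where
  prob : List (O × A) → O → A → ℝ
  prob_nonneg : ∀ τ o a, 0 ≤ prob τ o a
  prob_sum : ∀ τ o, ∑ a, prob τ o a = 1

/-- Full trajectories of an episode of length `H`. -/
abbrev Traj (O A : Type*) (H : ℕ) := Fin H → O × A

variable {S O A : Type*} [Fintype S] [Fintype O] [Fintype A]

/-- One step of the unnormalized belief: if `b s` is the weight of `s_h = s`, then the value at `s'`
is the weight of `s_{h+1} = s'` together with the observation `x.1` at step `h`, under the
action `x.2`. -/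
def POMDP.beliefStep (f : POMDP S O A) (h : ℕ) (x : O × A) (b : S → ℝ) : S → ℝ :=
  fun s' => ∑ s, b s * f.emit h s x.1 * f.trans h x.2 s s'

/-- The unnormalized belief after a list of observation/action pairs that starts at step `h`. -/
def POMDP.evolve (f : POMDP S O A) : ℕ → List (O × A) → (S → ℝ) → (S → ℝ)
  | _, [], b => b
  | h, x :: l, b => f.evolve (h + 1) l (f.beliefStep h x b)

/-- The probability of the observations in `τ` when the actions in `τ` are executed. -/
def POMDP.weight (f : POMDP S O A) (τ : List (O × A)) : ℝ :=
  ∑ s, f.evolve 0 τ f.init s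

/-- The weight of the test `(p, o)` (observation/action pairs `p`, then a last observation `o`)
that starts at step `h` from the unnormalized state distribution `b`. -/
def POMDP.futureWeight (f : POMDP S O A) (h : ℕ) (b : S → ℝ) (p : List (O × A)) (o : O) : ℝ :=
  ∑ s, f.evolve h p b s * f.emit (h + p.length) s o

/-- The trajectory probability `P_f^π(τ_H)`. -/
def POMDP.trajProb (f : POMDP S O A) {H : ℕ} (π : Policy O A) (τ : Traj O A H) : ℝ :=
  f.weight (List.ofFn τ) * ∏ t : Fin H, π.prob ((List.ofFn τ).take t) (τ t).1 (τ t).2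

/-- The expected cumulative reward under a distribution `p` of trajectories. -/
def expectedReward {H : ℕ} (r : Fin H → O → A → ℝ) (p : Traj O A H → ℝ) : ℝ :=
  ∑ τ, p τ * ∑ t, r t (τ t).1 (τ t).2

/-- The value `V_f^π`. -/
def POMDP.value (f : POMDP S O A) {H : ℕ} (r : Fin H → O → A → ℝ) (π : Policy O A) : ℝ :=
  expectedReward r (f.trajProb π)

/-- The optimal value `V^* = sup_π V^π`. -/
def POMDP.optValue (f : POMDP S O A) {H : ℕ} (r : Fin H → O → A → ℝ) : ℝ :=
  ⨆ π : Policy O A, f.value r π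

/-- The value of the uniform mixture of the policies `π 0, …, π (K-1)` (an index is drawn uniformly
at the beginning of the episode and that policy is executed throughout). -/
def POMDP.mixtureValue (f : POMDP S O A) {H K : ℕ} (r : Fin H → O → A → ℝ)
    (π : Fin K → Policy O A) : ℝ :=
  expectedReward r (fun τ => (1 / (K : ℝ)) * ∑ k, f.trajProb (π k) τ)

/-! ### The system dynamics matrix, core test sets, core histories -/

/-- Tests after a history of length `h`: `W < H - h` observation/action pairs and a last
observation, that is `W + 1 ≤ H - h` observations and `W` actions. -/
abbrev Test (O A : Type*) (H h : ℕ) := Σ W : Fin (H - h), (Fin W → O × A) × O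

/-- The conditional probability `P(t | τ)` that the test `t = (p, o)` succeeds after the history
`τ`.  If `τ` is unreachable, then `f.weight τ = 0` and the value is `0`, which is the convention
for unreachable histories. -/
def POMDP.testProb (f : POMDP S O A) (τ : List (O × A)) (p : List (O × A)) (o : O) : ℝ :=
  f.futureWeight 0 f.init (τ ++ p) o / f.weight τ

/-- The one-step system dynamics matrix `D_h`; rows are tests, columns are histories of
length `h`. -/
def POMDP.dynMatrix (f : POMDP S O A) (H h : ℕ) : Matrix (Test O A H h) (Fin h → O × A) ℝ :=
  Matrix.of fun t τ => f.testProb (List.ofFn τ) (List.ofFn t.2.1) t.2.2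

/-- `d_{PSR,h} = rank D_h`. -/
def POMDP.psrRankAt (f : POMDP S O A) (H h : ℕ) : ℕ := (f.dynMatrix H h).rank

/-- `d_PSR = max_h rank D_h`. -/
def POMDP.psrRank (f : POMDP S O A) (H : ℕ) : ℕ :=
  (Finset.range H).sup fun h => f.psrRankAt H h

/-- The rows of `D_h` that belong to the tests in `U`; the column at `τ` is the predictive
state `q_τ`. -/
def POMDP.predMatrix (f : POMDP S O A) (H h : ℕ) (U : Finset (Test O A H h)) :
    Matrix U (Fin h → O × A) ℝ :=
  (f.dynMatrix H h).submatrix Subtype.val id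

/-- `U` is a core test set for the histories of length `h`. -/
def POMDP.IsCoreTestSet (f : POMDP S O A) (H h : ℕ) (U : Finset (Test O A H h)) : Prop :=
  (f.predMatrix H h U).rank = f.psrRankAt H h

/-- The set of all `m`-step futures `(O × A)^(m-1) × O`. -/
def mStepFutures (O A : Type*) [Fintype O] [Fintype A] (H h m : ℕ) : Finset (Test O A H h) :=
  Finset.univ.filter fun t => (t.1 : ℕ) + 1 = m

/-- The matrix whose columns are the predictive states of the `d_{PSR,h}` histories `c i`. -/
def POMDP.coreMatrix (f : POMDP S O A) (H h : ℕ) (U : Finset (Test O A H h))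
    (c : Fin (f.psrRankAt H h) → (Fin h → O × A)) : Matrix U (Fin (f.psrRankAt H h)) ℝ :=
  (f.predMatrix H h U).submatrix id c

/-- `c` lists minimum core histories: `d_{PSR,h}` histories such that every predictive state is a
linear combination of theirs. -/
def POMDP.IsMinCoreHistories (f : POMDP S O A) (H h : ℕ) (U : Finset (Test O A H h))
    (c : Fin (f.psrRankAt H h) → (Fin h → O × A)) : Prop :=
  ∀ τ : Fin h → O × A, ∃ v : Fin (f.psrRankAt H h) → ℝ,
    (fun u => f.predMatrix H h U u τ) = f.coreMatrix H h U c *ᵥ v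

/-- `X` is the Moore–Penrose pseudoinverse of `M`. -/
structure IsPseudoinverse {ι κ : Type*} [Fintype ι] [Fintype κ]
    (M : Matrix ι κ ℝ) (X : Matrix κ ι ℝ) : Prop where
  mul_mul_left : M * X * M = M
  mul_mul_right : X * M * X = X
  symm_left : (M * X)ᵀ = M * X
  symm_right : (X * M)ᵀ = X * M

/-- `‖X‖_{1 ↦ 1} ≤ C` for the operator norm with respect to the `ℓ¹` norms. -/
def OneNormLE {ι κ : Type*} [Fintype ι] [Fintype κ] (X : Matrix κ ι ℝ) (C : ℝ) : Prop :=
  ∀ v : ι → ℝ, ∑ i, |(X *ᵥ v) i| ≤ C * ∑ j, |v j|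

/-- `‖K_h†‖_{1 ↦ 1} ≤ 1/α`, where `K_h` is the core matrix with the smallest `‖K_h†‖_{1 ↦ 1}`
(there are finitely many choices of core histories, so the minimum satisfies the bound if and only
if some choice does). -/
def POMDP.IsRegularAt (f : POMDP S O A) (H h : ℕ) (U : Finset (Test O A H h)) (α : ℝ) : Prop :=
  ∃ c, f.IsMinCoreHistories H h U c ∧
    ∃ X, IsPseudoinverse (f.coreMatrix H h U c) X ∧ OneNormLE X (1 / α)

/-! ### The weakly-revealing condition -/

/-- The `m`-step emission matrix at step `h`: its entry at `(a, o), s` is the probability of the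
observations `o_{h:h+m-1}` given `s_h = s` and the actions `a_{h:h+m-2}`. The row index is written as
`m - 1` observation/action pairs and a last observation. -/
def POMDP.emissionMatrix (f : POMDP S O A) (h m : ℕ) :
    Matrix ((Fin (m - 1) → O × A) × O) S ℝ :=
  open Classical in
  Matrix.of fun t s => f.futureWeight h (Pi.single s 1) (List.ofFn t.1) t.2

/-- `m`-step weakly-revealing: all `m`-step emission matrices have rank `|S|`. -/
def POMDP.IsWeaklyRevealing (f : POMDP S O A) (H m : ℕ) : Prop :=
  ∀ h, h ≤ H - m → (f.emissionMatrix h m).rank = Fintype.card S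

/-! ### Bracket numbers -/

/-- `F` has an `ε`-bracket of size `n`. -/
def HasBracket (F : Set (POMDP S O A)) (H : ℕ) (ε : ℝ) (n : ℕ) : Prop :=
  ∃ g₁ g₂ : Fin n → Policy O A → Traj O A H → ℝ,
    (∀ i π, ∑ τ, |g₁ i π τ - g₂ i π τ| ≤ ε) ∧
    ∀ f ∈ F, ∃ i, ∀ π τ, g₁ i π τ ≤ f.trajProb π τ ∧ f.trajProb π τ ≤ g₂ i π τ

/-- The `ε`-bracket number `N_F(ε)`. -/
def bracketNumber (F : Set (POMDP S O A)) (H : ℕ) (ε : ℝ) : ℕ :=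
  sInf {n | HasBracket F H ε n}

/-! ### Assumptions on the model class -/

/-- Realizability, validity and `α`-regularity of the model class `F` for the core test sets of all
`m`-step futures (at the steps where these fit into the episode). -/
structure IsAdmissibleClass (F : Set (POMDP S O A)) (fstar : POMDP S O A) (H m : ℕ) (α : ℝ) :
    Prop where
  realizable : fstar ∈ F
  valid : ∀ f ∈ F, ∀ h, h ≤ H - m → f.IsCoreTestSet H h (mStepFutures O A H h m)
  regular : ∀ f ∈ F, ∀ h, h ≤ H - m → f.IsRegularAt H h (mStepFutures O A H h m) α

/-! ### The algorithm CRANE, up to step `H - m`, with the `m`-step futures as core tests -/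

open Classical in
/-- The policy `π_{1:h-1} ∘ Unif(A) ∘ u`, uniform afterwards: with steps counted from `1`, follow `π`
at the steps `1, …, h-1`, take a uniform action at step `h`, execute the action sequence `u` at the
steps `h+1, …, h+n`, and take uniform actions from then on.  (Here the current step, counted
from `1`, is `τ.length + 1`.) -/
def Policy.explore (π : Policy O A) (h : ℕ) {n : ℕ} (u : Fin n → A) : Policy O A where
  prob τ o a :=
    if τ.length + 1 < h then π.prob τ o a
    else if hu : h ≤ τ.length ∧ τ.length - h < n then
      (if a = u ⟨τ.length - h, hu.2⟩ then 1 else 0)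
    else 1 / (Fintype.card A : ℝ)
  prob_nonneg τ o a := by
    split_ifs
    · exact π.prob_nonneg τ o a
    · exact zero_le_one
    · exact le_rfl
    · positivity
  prob_sum τ o := by
    have hA : Nonempty A := by
      by_contra hne
      rw [not_nonempty_iff] at hne
      have := π.prob_sum τ o
      simp at this
    split_ifs
    · exact π.prob_sum τ o
    · simp
    · simp

/-- In every iteration one trajectory is collected for every `h = 0, …, H - m` and every action
sequence of the core tests, that is every `u ∈ A^(m-1)`. -/
abbrev ExploreIndex (A : Type*) (H m : ℕ) := Fin (H - m + 1) × (Fin (m - 1) → A)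

/-- The trajectories collected in one iteration. -/
abbrev Batch (O A : Type*) (H m : ℕ) := ExploreIndex A H m → Traj O A H

/-- The trajectories collected in `K` iterations. -/
abbrev Outcome (O A : Type*) (H m K : ℕ) := Fin K → Batch O A H m

/-- The planning step of the algorithm: from the batches of trajectories collected so far it selects
a model and a policy. -/
abbrev Planner (S O A : Type*) [Fintype S] [Fintype O] [Fintype A] (H m : ℕ) :=
  List (Batch O A H m) → POMDP S O A × Policy O A

/-- The pair `(f^k, π^k)` selected in iteration `k`, from the batches of the iterations before
`k`. -/
def Planner.select {H m K : ℕ} (plan : Planner S O A H m) (ω : Outcome O A H m K) (k : Fin K) :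
    POMDP S O A × Policy O A :=
  plan ((List.ofFn ω).take k)

/-- The policy `π^{k,u,h}` executed in iteration `k` for the index `j = (h, u)`. -/
def Planner.executed {H m K : ℕ} (plan : Planner S O A H m) (ω : Outcome O A H m K) (k : Fin K)
    (j : ExploreIndex A H m) : Policy O A :=
  (plan.select ω k).2.explore j.1 j.2

/-- The likelihood under the model `f` of the data collected before iteration `k`. -/
def likelihood {H m K : ℕ} (plan : Planner S O A H m) (f : POMDP S O A)
    (ω : Outcome O A H m K) (k : Fin K) : ℝ :=
  ∏ i ∈ Finset.Iio k, ∏ j, f.trajProb (plan.executed ω i j) (ω i j)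

/-- The confidence set `B^k`: the `f ∈ F` whose log-likelihood is at least
`sup_{f' ∈ F} log-likelihood - β`.  The inequality is written for the likelihoods themselves, which
amounts to `log 0 = -∞`. -/
def confidenceSet {H m K : ℕ} (plan : Planner S O A H m) (F : Set (POMDP S O A)) (β : ℝ)
    (ω : Outcome O A H m K) (k : Fin K) : Set (POMDP S O A) :=
  {f | f ∈ F ∧ ∀ f' ∈ F, Real.exp (-β) * likelihood plan f' ω k ≤ likelihood plan f ω k}

/-- `plan` performs the optimistic planning of the algorithm with model class `F`, reward `r` and
parameter `β` for `K` iterations: `(f^k, π^k) ∈ argmax_{f ∈ B^k, π} V_f^π`. -/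
def IsCrane {H m : ℕ} (K : ℕ) (plan : Planner S O A H m) (F : Set (POMDP S O A))
    (r : Fin H → O → A → ℝ) (β : ℝ) : Prop :=
  ∀ (ω : Outcome O A H m K) (k : Fin K),
    (plan.select ω k).1 ∈ confidenceSet plan F β ω k ∧
    ∀ f ∈ confidenceSet plan F β ω k, ∀ π : Policy O A,
      f.value r π ≤ (plan.select ω k).1.value r (plan.select ω k).2

/-- The probability of the outcome `ω` when the environment is `f`: given the past, the trajectories
of iteration `k` are independent, and the one with index `j` has the law of the executed policy. -/
def runProb {H m K : ℕ} (plan : Planner S O A H m) (f : POMDP S O A)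
    (ω : Outcome O A H m K) : ℝ :=
  ∏ k, ∏ j, f.trajProb (plan.executed ω k j) (ω k j)

open Classical in
/-- The probability of an event of `K` iterations of the algorithm in the environment `f`. -/
def runEventProb {H m K : ℕ} (plan : Planner S O A H m) (f : POMDP S O A)
    (E : Outcome O A H m K → Prop) : ℝ :=
  ∑ ω with E ω, runProb plan f ω

/-- `|U_A|`, the number of action sequences of the `m`-step futures. -/
def numActionSeqs (A : Type*) [Fintype A] (m : ℕ) : ℕ := Fintype.card (Fin (m - 1) → A)

/-- `β = c log (N_F(ε_b) K H |U_A| / δ)` with `ε_b = 1 / (K H |U_A|)`. -/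
def craneBeta (F : Set (POMDP S O A)) (H m K : ℕ) (c δ : ℝ) : ℝ :=
  c * Real.log ((bracketNumber F H (1 / (K * H * numActionSeqs A m)) : ℝ) *
    K * H * numActionSeqs A m / δ)

end CranePSR

end

/-!
Why the sample complexity bound holds. The state of a tabular POMDP after a history `τ` is its
unnormalized belief `b(τ) ∈ ℝ^S`, which evolves linearly; every probability below is a linear
function of such a vector.

*Core tests.* The system dynamics matrix factors as (probabilities of tests from states) times
(beliefs of histories), so its rank is at most `|S|`. The rows of the first factor that belong to
the `m`-step futures form the `m`-step emission matrix; if this has rank `|S|`, the restriction to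
these rows loses no rank (`POMDP.IsWeaklyRevealing.isCoreTestSet`).

*Virtual beliefs.* For a model `f` of the class, `POMDP.exists_virtualBelief` turns the
pseudoinverse of the core matrix into a linear map `Φ` from predictions of the `m`-step futures to
combinations of beliefs of `f`. It is bounded by `1 / α` in the `ℓ¹` norms, and `Φ` of the
prediction of a belief cannot be told apart from that belief by any test. The difference between
the trajectory laws of `f` and of `f*` therefore telescopes over the steps
(`trajDist_le_sum_stepError`): it is at most `1 + 1 / α` times the initial prediction error plus the
mean of the errors `stepError` of one update. Such an error is a sum of absolute values of linear
functions of the true belief.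

*Confidence sets.* By a union bound over an `ε`-bracket (`one_sub_le_runEventProb_confidence`), with
high probability the confidence sets contain `f*`, and every model in one of them has a small sum
of squared `ℓ¹` distances to `f*` under the policies executed so far. That bound comes from the
Hellinger affinity: `∏ e^{1 - A} √(g / P)`, with `A` the affinity of a bracket `g` and the true law
`P`, has mean at most one. The executed policies play a uniform action and then every action
sequence of the `m`-step futures, so these distances dominate the update errors of the model at
the past beliefs (`listSum_stepError_le`).

*From the past to the future.* The update errors of the `k`-th model are small in mean over the
beliefs visited by the earlier policies, and have to be bounded over those visited by the `k`-th
policy. As they are `ℓ¹` sums of linear functions on `ℝ^S`, this is an elliptical potential argument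
in dimension `|S|` (`sum_error_le_of_past_error_le`); there the potential is the determinant of a
matrix whose `k`-th increment weights each belief by the inverse of its own dual norm, so that the
quadratic form is controlled by `ℓ¹` sums. Together with optimism this gives
`K (V* - V) ≤ √K · polynomial · (1 + log K)²` (`mul_optValue_sub_mixtureValue_le`). The bracket
number, which enters through `β`, is bounded by rounding the parameters of the models to a grid
(`exists_hasBracket`).
-/

set_option linter.unusedSectionVars false

noncomputable section

namespace CranePSR

variable {S O A : Type*} [Fintype S] [Fintype O] [Fintype A]

/-! ### Sums over lists of a given length -/

/-- The sum of `g` over all lists of length `n`. -/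
def listSum {X : Type*} [Fintype X] (n : ℕ) (g : List X → ℝ) : ℝ :=
  ∑ y : Fin n → X, g (List.ofFn y)

section ListSum

variable {X : Type*} [Fintype X]

@[simp] theorem listSum_zero (g : List X → ℝ) : listSum 0 g = g [] := by
  simp [listSum]

theorem listSum_succ (n : ℕ) (g : List X → ℝ) :
    listSum (n + 1) g = ∑ x, listSum n (fun l => g (x :: l)) := by
  unfold listSum
  rw [← (Fin.consEquiv (fun _ => X)).sum_comp, Fintype.sum_prod_type]
  simp [Fin.consEquiv, List.ofFn_succ]

theorem listSum_add_len (n k : ℕ) (g : List X → ℝ) :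
    listSum (n + k) g = listSum n (fun l => listSum k (fun l' => g (l ++ l'))) := by
  induction n generalizing g with
  | zero => simp
  | succ n ih =>
    rw [Nat.succ_add, listSum_succ, listSum_succ]
    simp [ih]

theorem listSum_one (g : List X → ℝ) : listSum 1 g = ∑ x, g [x] := by
  rw [listSum_succ]; simp

theorem listSum_snoc (n : ℕ) (g : List X → ℝ) :
    listSum (n + 1) g = listSum n (fun l => ∑ x, g (l ++ [x])) := by
  rw [listSum_add_len]; simp [listSum_one]

theorem listSum_le_listSum {n : ℕ} {g g' : List X → ℝ}
    (h : ∀ l : List X, l.length = n → g l ≤ g' l) : listSum n g ≤ listSum n g' :=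
  Finset.sum_le_sum fun _ _ => h _ (List.length_ofFn)

theorem listSum_congr {n : ℕ} {g g' : List X → ℝ}
    (h : ∀ l : List X, l.length = n → g l = g' l) : listSum n g = listSum n g' :=
  Finset.sum_congr rfl fun _ _ => h _ (List.length_ofFn)

theorem listSum_add {n : ℕ} (g g' : List X → ℝ) :
    listSum n (fun l => g l + g' l) = listSum n g + listSum n g' :=
  Finset.sum_add_distrib

theorem listSum_mul_left {n : ℕ} (c : ℝ) (g : List X → ℝ) :
    listSum n (fun l => c * g l) = c * listSum n g :=
  (Finset.mul_sum _ _ _).symm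

theorem listSum_sum {ι : Type*} [Fintype ι] {n : ℕ} (g : ι → List X → ℝ) :
    listSum n (fun l => ∑ i, g i l) = ∑ i, listSum n (g i) :=
  Finset.sum_comm

end ListSum

/-! ### Policies along a list -/

/-- The probability that `π` takes the actions in the list, given the observations in it, when the
list follows the history `τ`. -/
def Policy.seqProb (π : Policy O A) : List (O × A) → List (O × A) → ℝ
  | _, [] => 1
  | τ, x :: l => π.prob τ x.1 x.2 * π.seqProb (τ ++ [x]) l

theorem Policy.seqProb_nonneg (π : Policy O A) (τ l : List (O × A)) : 0 ≤ π.seqProb τ l := by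
  induction l generalizing τ with
  | nil => simp [Policy.seqProb]
  | cons x l ih => exact mul_nonneg (π.prob_nonneg _ _ _) (ih _)

theorem Policy.seqProb_append (π : Policy O A) (τ l l' : List (O × A)) :
    π.seqProb τ (l ++ l') = π.seqProb τ l * π.seqProb (τ ++ l) l' := by
  induction l generalizing τ with
  | nil => simp [Policy.seqProb]
  | cons x l ih => simp [Policy.seqProb, ih, mul_assoc]

theorem Policy.seqProb_singleton (π : Policy O A) (τ : List (O × A)) (x : O × A) :
    π.seqProb τ [x] = π.prob τ x.1 x.2 := by
  simp [Policy.seqProb]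

theorem Policy.prob_le_one (π : Policy O A) (τ : List (O × A)) (o : O) (a : A) :
    π.prob τ o a ≤ 1 := by
  rw [← π.prob_sum τ o]
  exact Finset.single_le_sum (fun a _ => π.prob_nonneg τ o a) (Finset.mem_univ a)

theorem Policy.prod_prob_eq_seqProb (π : Policy O A) (n : ℕ) (τ : List (O × A))
    (y : Fin n → O × A) :
    ∏ t : Fin n, π.prob (τ ++ (List.ofFn y).take t) (y t).1 (y t).2 =
      π.seqProb τ (List.ofFn y) := by
  induction n generalizing τ with
  | zero => simp [Policy.seqProb]
  | succ n ih =>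
    rw [Fin.prod_univ_succ, List.ofFn_succ, Policy.seqProb]
    have := ih (τ ++ [y 0]) (fun i => y i.succ)
    rw [← this]
    simp

/-! ### Linear evolution of beliefs -/

/-- `POMDP.evolve` as a linear map of the belief. -/
def POMDP.evolveLin (f : POMDP S O A) (h : ℕ) (l : List (O × A)) : (S → ℝ) →ₗ[ℝ] (S → ℝ) where
  toFun := f.evolve h l
  map_add' b b' := by
    induction l generalizing h b b' with
    | nil => rfl
    | cons x l ih =>
      rw [POMDP.evolve, POMDP.evolve, POMDP.evolve, ← ih]
      congr 1
      ext s
      simp [POMDP.beliefStep, add_mul, Finset.sum_add_distrib]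
  map_smul' c b := by
    induction l generalizing h b with
    | nil => rfl
    | cons x l ih =>
      simp only [RingHom.id_apply] at ih ⊢
      rw [POMDP.evolve, POMDP.evolve, ← ih]
      congr 1
      ext s
      simp [POMDP.beliefStep, Finset.mul_sum, mul_assoc]

@[simp] theorem POMDP.evolveLin_apply (f : POMDP S O A) (h : ℕ) (l : List (O × A)) (b : S → ℝ) :
    f.evolveLin h l b = f.evolve h l b := rfl

theorem POMDP.evolve_append (f : POMDP S O A) (h : ℕ) (l l' : List (O × A)) (b : S → ℝ) :
    f.evolve h (l ++ l') b = f.evolve (h + l.length) l' (f.evolve h l b) := by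
  induction l generalizing h b with
  | nil => rfl
  | cons x l ih =>
    simp only [List.cons_append, POMDP.evolve, ih, List.length_cons]
    congr 1
    omega

theorem POMDP.evolve_singleton (f : POMDP S O A) (h : ℕ) (x : O × A) (b : S → ℝ) :
    f.evolve h [x] b = f.beliefStep h x b := rfl

theorem POMDP.evolve_nonneg (f : POMDP S O A) (h : ℕ) (l : List (O × A)) {b : S → ℝ}
    (hb : ∀ s, 0 ≤ b s) (s : S) : 0 ≤ f.evolve h l b s := by
  induction l generalizing h b with
  | nil => exact hb s
  | cons x l ih =>
    refine ih (h + 1) fun s' => Finset.sum_nonneg fun t _ => ?_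
    exact mul_nonneg (mul_nonneg (hb t) (f.emit_nonneg _ _ _)) (f.trans_nonneg _ _ _ _)

/-- The unnormalized belief after the history `τ`. -/
def POMDP.belief (f : POMDP S O A) (τ : List (O × A)) : S → ℝ := f.evolve 0 τ f.init

theorem POMDP.belief_nonneg (f : POMDP S O A) (τ : List (O × A)) (s : S) : 0 ≤ f.belief τ s :=
  f.evolve_nonneg _ _ f.init_nonneg s

theorem POMDP.belief_snoc (f : POMDP S O A) (τ : List (O × A)) (x : O × A) :
    f.belief (τ ++ [x]) = f.beliefStep τ.length x (f.belief τ) := by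
  simp [POMDP.belief, POMDP.evolve_append, POMDP.evolve]

/-- The weight of the observations in `l`, when its actions are executed from the unnormalized
belief `b` at step `h`. -/
def POMDP.listWeight (f : POMDP S O A) (h : ℕ) (l : List (O × A)) (b : S → ℝ) : ℝ :=
  ∑ s, f.evolve h l b s

theorem POMDP.weight_eq_sum_belief (f : POMDP S O A) (τ : List (O × A)) :
    f.weight τ = ∑ s, f.belief τ s := rfl

theorem POMDP.weight_append (f : POMDP S O A) (τ l : List (O × A)) :
    f.weight (τ ++ l) = f.listWeight τ.length l (f.belief τ) := by
  simp [POMDP.weight, POMDP.listWeight, POMDP.belief, POMDP.evolve_append]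

theorem POMDP.weight_nonneg (f : POMDP S O A) (τ : List (O × A)) : 0 ≤ f.weight τ :=
  Finset.sum_nonneg fun s _ => f.belief_nonneg τ s

theorem POMDP.listWeight_cons (f : POMDP S O A) (h : ℕ) (x : O × A) (l : List (O × A))
    (b : S → ℝ) : f.listWeight h (x :: l) b = f.listWeight (h + 1) l (f.beliefStep h x b) := rfl

theorem POMDP.listWeight_sub (f : POMDP S O A) (h : ℕ) (l : List (O × A)) (b b' : S → ℝ) :
    f.listWeight h l (b - b') = f.listWeight h l b - f.listWeight h l b' := by
  unfold POMDP.listWeight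
  rw [← Finset.sum_sub_distrib]
  refine Finset.sum_congr rfl fun s _ => ?_
  exact congrFun ((f.evolveLin h l).map_sub b b') s

theorem POMDP.sum_beliefStep (f : POMDP S O A) (h : ℕ) (x : O × A) (b : S → ℝ) :
    ∑ s', f.beliefStep h x b s' = ∑ s, b s * f.emit h s x.1 := by
  unfold POMDP.beliefStep
  rw [Finset.sum_comm]
  simp [← Finset.mul_sum, f.trans_sum]

/-- The last action of a history does not influence the probability of its observations. -/
theorem POMDP.listWeight_snoc (f : POMDP S O A) (h : ℕ) (p : List (O × A)) (o : O) (a : A)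
    (b : S → ℝ) : f.listWeight h (p ++ [(o, a)]) b = f.futureWeight h b p o := by
  simp only [POMDP.listWeight, POMDP.evolve_append, POMDP.evolve_singleton]
  exact f.sum_beliefStep _ _ _

theorem POMDP.futureWeight_append (f : POMDP S O A) (h : ℕ) (b : S → ℝ) (l p : List (O × A))
    (o : O) : f.futureWeight h b (l ++ p) o =
      f.futureWeight (h + l.length) (f.evolve h l b) p o := by
  simp [POMDP.futureWeight, POMDP.evolve_append, add_assoc]

theorem POMDP.sum_abs_beliefStep_le (f : POMDP S O A) (h : ℕ) (x : O × A) (b : S → ℝ) :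
    ∑ s', |f.beliefStep h x b s'| ≤ ∑ s, |b s| * f.emit h s x.1 := by
  calc ∑ s', |f.beliefStep h x b s'|
      ≤ ∑ s', f.beliefStep h x (fun s => |b s|) s' := by
        refine Finset.sum_le_sum fun s' _ => ?_
        refine (Finset.abs_sum_le_sum_abs _ _).trans (le_of_eq ?_)
        refine Finset.sum_congr rfl fun s _ => ?_
        rw [abs_mul, abs_mul, abs_of_nonneg (f.emit_nonneg _ _ _),
          abs_of_nonneg (f.trans_nonneg _ _ _ _)]
    _ = _ := f.sum_beliefStep h x _

theorem POMDP.sum_mul_emit (f : POMDP S O A) (h : ℕ) (b : S → ℝ) :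
    ∑ o, ∑ s, b s * f.emit h s o = ∑ s, b s := by
  rw [Finset.sum_comm]
  simp [← Finset.mul_sum, f.emit_sum]

theorem POMDP.sum_prob_mul_abs_beliefStep_le (f : POMDP S O A) (h : ℕ) (b : S → ℝ)
    {p : O → A → ℝ} (hp : ∀ o a, 0 ≤ p o a) (hp1 : ∀ o, ∑ a, p o a = 1) :
    ∑ x : O × A, p x.1 x.2 * ∑ s', |f.beliefStep h x b s'| ≤ ∑ s, |b s| := by
  calc ∑ x : O × A, p x.1 x.2 * ∑ s', |f.beliefStep h x b s'|
      ≤ ∑ x : O × A, p x.1 x.2 * ∑ s, |b s| * f.emit h s x.1 :=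
        Finset.sum_le_sum fun x _ =>
          mul_le_mul_of_nonneg_left (f.sum_abs_beliefStep_le h x b) (hp _ _)
    _ = ∑ s, |b s| := by
        rw [Fintype.sum_prod_type]
        simp [← Finset.sum_mul, hp1, f.sum_mul_emit]

theorem POMDP.sum_abs_beliefStep_le_card (f : POMDP S O A) (h : ℕ) (b : S → ℝ) :
    ∑ x : O × A, ∑ s', |f.beliefStep h x b s'| ≤ Fintype.card A * ∑ s, |b s| := by
  calc ∑ x : O × A, ∑ s', |f.beliefStep h x b s'|
      ≤ ∑ x : O × A, ∑ s, |b s| * f.emit h s x.1 :=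
        Finset.sum_le_sum fun x _ => f.sum_abs_beliefStep_le h x b
    _ = Fintype.card A * ∑ s, |b s| := by
        rw [Fintype.sum_prod_type]
        simp [← Finset.mul_sum, f.sum_mul_emit]

/-- Under any policy, the total (signed) weight of the trajectories is at most the `ℓ¹` norm of the
initial belief. -/
theorem POMDP.listSum_seqProb_mul_abs_listWeight_le (f : POMDP S O A) (π : Policy O A) (n h : ℕ)
    (τ : List (O × A)) (b : S → ℝ) :
    listSum n (fun l => π.seqProb τ l * |f.listWeight h l b|) ≤ ∑ s, |b s| := by
  induction n generalizing h τ b with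
  | zero =>
    simpa [Policy.seqProb, POMDP.listWeight, POMDP.evolve] using Finset.abs_sum_le_sum_abs b _
  | succ n ih =>
    rw [listSum_succ]
    refine le_trans (Finset.sum_le_sum fun x _ => ?_)
      (f.sum_prob_mul_abs_beliefStep_le h b (π.prob_nonneg τ) (π.prob_sum τ))
    simp only [Policy.seqProb, POMDP.listWeight_cons, mul_assoc, listSum_mul_left]
    exact mul_le_mul_of_nonneg_left (ih _ _ _) (π.prob_nonneg _ _ _)

/-! ### Predicting the `n`-step futures -/

/-- The futures that consist of `n` observation/action pairs and a last observation. -/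
abbrev Future (O A : Type*) (n : ℕ) := (Fin n → O × A) × O

/-- The weights of the futures that start at step `h`, as a linear function of the belief. -/
def POMDP.predict (f : POMDP S O A) (h n : ℕ) : (S → ℝ) →ₗ[ℝ] (Future O A n → ℝ) where
  toFun b t := f.futureWeight h b (List.ofFn t.1) t.2
  map_add' b b' := by
    ext t
    have := (f.evolveLin h (List.ofFn t.1)).map_add b b'
    simp only [POMDP.evolveLin_apply] at this
    simp [POMDP.futureWeight, this, add_mul, Finset.sum_add_distrib]
  map_smul' c b := by
    ext t
    have := (f.evolveLin h (List.ofFn t.1)).map_smul c b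
    simp only [POMDP.evolveLin_apply] at this
    simp [POMDP.futureWeight, this, Finset.mul_sum, mul_assoc]

theorem POMDP.predict_apply (f : POMDP S O A) (h n : ℕ) (b : S → ℝ) (t : Future O A n) :
    f.predict h n b t = f.futureWeight h b (List.ofFn t.1) t.2 := rfl

theorem sum_future_eq {n : ℕ} (g : List (O × A) → O → ℝ) :
    ∑ t : Future O A n, g (List.ofFn t.1) t.2 = listSum n (fun p => ∑ o, g p o) := by
  rw [Fintype.sum_prod_type]; rfl

theorem POMDP.listSum_sum_abs_futureWeight_le (f : POMDP S O A) (h n : ℕ) (b : S → ℝ) :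
    listSum n (fun p => ∑ o, |f.futureWeight h b p o|) ≤
      (Fintype.card A : ℝ) ^ n * ∑ s, |b s| := by
  induction n generalizing h b with
  | zero =>
    simp only [listSum_zero, pow_zero, one_mul, POMDP.futureWeight, POMDP.evolve]
    rw [← f.sum_mul_emit h]
    refine Finset.sum_le_sum fun o _ => (Finset.abs_sum_le_sum_abs _ _).trans (le_of_eq ?_)
    simp [abs_mul, abs_of_nonneg (f.emit_nonneg _ _ _)]
  | succ n ih =>
    rw [listSum_succ]
    have hf : ∀ x : O × A, ∀ l o, f.futureWeight h b (x :: l) o =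
        f.futureWeight (h + 1) (f.beliefStep h x b) l o := by
      intro x l o
      exact f.futureWeight_append h b [x] l o
    simp only [hf]
    calc _ ≤ ∑ x : O × A, (Fintype.card A : ℝ) ^ n * ∑ s, |f.beliefStep h x b s| :=
          Finset.sum_le_sum fun x _ => ih _ _
      _ ≤ (Fintype.card A : ℝ) ^ n * (Fintype.card A * ∑ s, |b s|) := by
          rw [← Finset.mul_sum]
          exact mul_le_mul_of_nonneg_left (f.sum_abs_beliefStep_le_card h b) (by positivity)
      _ = _ := by ring

theorem POMDP.sum_abs_predict_le (f : POMDP S O A) (h n : ℕ) (b : S → ℝ) :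
    ∑ t, |f.predict h n b t| ≤ (Fintype.card A : ℝ) ^ n * ∑ s, |b s| := by
  simp only [POMDP.predict_apply]
  rw [sum_future_eq (fun p o => |f.futureWeight h b p o|)]
  exact f.listSum_sum_abs_futureWeight_le h n b

theorem POMDP.sum_sum_abs_predict_beliefStep_le (f : POMDP S O A) (h n : ℕ) (b : S → ℝ) :
    ∑ x, ∑ t, |f.predict (h + 1) n (f.beliefStep h x b) t| ≤
      (Fintype.card A : ℝ) ^ (n + 1) * ∑ s, |b s| := by
  calc _ ≤ ∑ x : O × A, (Fintype.card A : ℝ) ^ n * ∑ s, |f.beliefStep h x b s| :=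
        Finset.sum_le_sum fun x _ => f.sum_abs_predict_le _ _ _
    _ ≤ (Fintype.card A : ℝ) ^ n * (Fintype.card A * ∑ s, |b s|) := by
        rw [← Finset.mul_sum]
        exact mul_le_mul_of_nonneg_left (f.sum_abs_beliefStep_le_card h b) (by positivity)
    _ = _ := by ring

/-! ### Trajectory laws and marginalization -/

theorem POMDP.trajProb_eq (f : POMDP S O A) {H : ℕ} (π : Policy O A) (τ : Traj O A H) :
    f.trajProb π τ = π.seqProb [] (List.ofFn τ) * f.weight (List.ofFn τ) := by
  rw [POMDP.trajProb, ← π.prod_prob_eq_seqProb, mul_comm]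
  simp

theorem POMDP.trajProb_nonneg (f : POMDP S O A) {H : ℕ} (π : Policy O A) (τ : Traj O A H) :
    0 ≤ f.trajProb π τ := by
  rw [f.trajProb_eq]
  exact mul_nonneg (π.seqProb_nonneg _ _) (f.weight_nonneg _)

/-- A function of histories whose average over the next observation/action pair does not depend on
the distribution of the action and equals its value before that pair. -/
def IsConsistent (D : List (O × A) → ℝ) : Prop :=
  ∀ (l : List (O × A)) (p : O → A → ℝ), (∀ o, ∑ a, p o a = 1) →
    ∑ x : O × A, p x.1 x.2 * D (l ++ [x]) = D l

theorem POMDP.isConsistent_weight (f : POMDP S O A) : IsConsistent f.weight := by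
  intro l p hp
  have : ∀ x : O × A, f.weight (l ++ [x]) = ∑ s, f.belief l s * f.emit l.length s x.1 := by
    intro x
    rw [f.weight_eq_sum_belief, f.belief_snoc, f.sum_beliefStep]
  simp only [this]
  rw [Fintype.sum_prod_type]
  simp only [← Finset.sum_mul, hp, one_mul]
  exact f.sum_mul_emit _ _

theorem IsConsistent.sub {D D' : List (O × A) → ℝ} (h : IsConsistent D) (h' : IsConsistent D') :
    IsConsistent (fun l => D l - D' l) := by
  intro l p hp
  simp only [mul_sub, Finset.sum_sub_distrib, h l p hp, h' l p hp]

theorem IsConsistent.listSum_eq {D : List (O × A) → ℝ} (h : IsConsistent D) (π : Policy O A)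
    (n : ℕ) : listSum n (fun l => π.seqProb [] l * D l) = D [] := by
  induction n with
  | zero => simp [Policy.seqProb]
  | succ n ih =>
    rw [listSum_snoc, ← ih]
    refine listSum_congr fun l _ => ?_
    simp only [π.seqProb_append, π.seqProb_singleton, List.nil_append, mul_assoc,
      ← Finset.mul_sum]
    rw [h l _ (π.prob_sum l)]

theorem IsConsistent.listSum_abs_mono {D : List (O × A) → ℝ} (h : IsConsistent D)
    (π : Policy O A) {n N : ℕ} (hn : n ≤ N) :
    listSum n (fun l => π.seqProb [] l * |D l|) ≤ listSum N (fun l => π.seqProb [] l * |D l|) := by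
  induction N, hn using Nat.le_induction with
  | base => exact le_rfl
  | succ N _ ih =>
    refine ih.trans ?_
    rw [listSum_snoc]
    refine listSum_le_listSum fun l _ => ?_
    simp only [π.seqProb_append, π.seqProb_singleton, List.nil_append, mul_assoc,
      ← Finset.mul_sum]
    refine mul_le_mul_of_nonneg_left ?_ (π.seqProb_nonneg _ _)
    rw [← h l _ (π.prob_sum l)]
    refine (Finset.abs_sum_le_sum_abs _ _).trans (le_of_eq ?_)
    simp [abs_mul, abs_of_nonneg (π.prob_nonneg _ _ _)]

theorem POMDP.weight_nil (f : POMDP S O A) : f.weight [] = 1 := f.init_sum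

theorem POMDP.sum_trajProb (f : POMDP S O A) {H : ℕ} (π : Policy O A) :
    ∑ τ : Traj O A H, f.trajProb π τ = 1 := by
  simp only [f.trajProb_eq]
  rw [← f.weight_nil, ← f.isConsistent_weight.listSum_eq π H]
  rfl

/-! ### The law of a run of the algorithm -/

section Run

variable {H m K : ℕ}

theorem sum_prod_prefix_le_one {X : Type*} [Fintype X] (W : List X → X → ℝ)
    (hW0 : ∀ l x, 0 ≤ W l x) (hW : ∀ l, ∑ x, W l x ≤ 1) :
    ∑ ω : Fin K → X, ∏ k : Fin K, W ((List.ofFn ω).take k) (ω k) ≤ 1 := by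
  induction K generalizing W with
  | zero => simp
  | succ K ih =>
    rw [← (Fin.consEquiv (fun _ => X)).sum_comp, Fintype.sum_prod_type]
    calc _ = ∑ x, W [] x * ∑ ω : Fin K → X, ∏ k : Fin K, W (x :: (List.ofFn ω).take k) (ω k) := by
          refine Finset.sum_congr rfl fun x _ => ?_
          rw [Finset.mul_sum]
          refine Finset.sum_congr rfl fun ω _ => ?_
          simp [Fin.consEquiv, Fin.prod_univ_succ, List.ofFn_succ]
      _ ≤ ∑ x, W [] x * 1 := Finset.sum_le_sum fun x _ =>
          mul_le_mul_of_nonneg_left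
            (ih (fun l => W (x :: l)) (fun l => hW0 _) (fun l => hW _)) (hW0 _ _)
      _ ≤ 1 := by simpa using hW []

theorem sum_prod_prefix_eq_one {X : Type*} [Fintype X] (W : List X → X → ℝ)
    (hW : ∀ l, ∑ x, W l x = 1) :
    ∑ ω : Fin K → X, ∏ k : Fin K, W ((List.ofFn ω).take k) (ω k) = 1 := by
  induction K generalizing W with
  | zero => simp
  | succ K ih =>
    rw [← (Fin.consEquiv (fun _ => X)).sum_comp, Fintype.sum_prod_type]
    calc _ = ∑ x, W [] x * ∑ ω : Fin K → X, ∏ k : Fin K, W (x :: (List.ofFn ω).take k) (ω k) := by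
          refine Finset.sum_congr rfl fun x _ => ?_
          rw [Finset.mul_sum]
          refine Finset.sum_congr rfl fun ω _ => ?_
          simp [Fin.consEquiv, Fin.prod_univ_succ, List.ofFn_succ]
      _ = ∑ x, W [] x * 1 := Finset.sum_congr rfl fun x _ => by
          rw [ih (fun l => W (x :: l)) (fun l => hW _)]
      _ = 1 := by simpa using hW []

open Classical in
/-- For functions `G k π` on trajectories that are subprobabilities, the product of their values
along a run is a subprobability on the outcomes, although the executed policies depend on the
past. -/
theorem sum_prod_executed_le_one (plan : Planner S O A H m)
    (G : ℕ → Policy O A → Traj O A H → ℝ) (hG0 : ∀ k π τ, 0 ≤ G k π τ)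
    (hG : ∀ k π, ∑ τ, G k π τ ≤ 1) :
    ∑ ω : Outcome O A H m K, ∏ k : Fin K, ∏ j, G k (plan.executed ω k j) (ω k j) ≤ 1 := by
  have := sum_prod_prefix_le_one (K := K)
    (fun (l : List (Batch O A H m)) (x : Batch O A H m) =>
      ∏ j, G l.length ((plan l).2.explore j.1 j.2) (x j))
    (fun l x => Finset.prod_nonneg fun j _ => hG0 _ _ _)
    (fun l => by
      rw [← Fintype.prod_sum]
      exact Finset.prod_le_one (fun j _ => Finset.sum_nonneg fun τ _ => hG0 _ _ _)
        fun j _ => hG _ _)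
  refine le_trans (le_of_eq ?_) this
  refine Finset.sum_congr rfl fun ω _ => Finset.prod_congr rfl fun k _ => ?_
  have hk : ((List.ofFn ω).take k).length = k := by simp [k.2.le]
  simp only [hk]
  rfl

theorem runProb_nonneg (plan : Planner S O A H m) (f : POMDP S O A) (ω : Outcome O A H m K) :
    0 ≤ runProb plan f ω :=
  Finset.prod_nonneg fun _ _ => Finset.prod_nonneg fun _ _ => f.trajProb_nonneg _ _

open Classical in
theorem sum_runProb (plan : Planner S O A H m) (f : POMDP S O A) :
    ∑ ω : Outcome O A H m K, runProb plan f ω = 1 := by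
  refine Eq.trans ?_ (sum_prod_prefix_eq_one (K := K)
    (fun (l : List (Batch O A H m)) (x : Batch O A H m) =>
      ∏ j, f.trajProb ((plan l).2.explore j.1 j.2) (x j))
    (fun l => by
      rw [← Fintype.prod_sum]
      exact Finset.prod_eq_one fun j _ => f.sum_trajProb _))
  rfl

theorem runEventProb_mono (plan : Planner S O A H m) (f : POMDP S O A)
    {E E' : Outcome O A H m K → Prop} (h : ∀ ω, E ω → E' ω) :
    runEventProb plan f E ≤ runEventProb plan f E' := by
  classical
  refine Finset.sum_le_sum_of_subset_of_nonneg (fun ω => ?_) fun _ _ _ => runProb_nonneg _ _ _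
  simpa using h ω

theorem runEventProb_eq_zero (plan : Planner S O A H m) (f : POMDP S O A)
    {E : Outcome O A H m K → Prop} (h : ∀ ω, ¬ E ω) : runEventProb plan f E = 0 := by
  simp [runEventProb, h]

theorem one_sub_le_runEventProb (plan : Planner S O A H m) (f : POMDP S O A)
    {E : Outcome O A H m K → Prop} {δ : ℝ} (h : runEventProb plan f (fun ω => ¬ E ω) ≤ δ) :
    1 - δ ≤ runEventProb plan f E := by
  classical
  have h1 : runEventProb plan f E + runEventProb plan f (fun ω => ¬ E ω) = 1 := by
    rw [← sum_runProb (K := K) plan f]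
    unfold runEventProb
    rw [Finset.sum_filter_add_sum_filter_not]
  linarith

theorem runEventProb_exists_le (plan : Planner S O A H m) (f : POMDP S O A) {ι : Type*}
    [Fintype ι] (E : ι → Outcome O A H m K → Prop) :
    runEventProb plan f (fun ω => ∃ i, E i ω) ≤ ∑ i, runEventProb plan f (E i) := by
  classical
  unfold runEventProb
  simp only [Finset.sum_filter]
  rw [Finset.sum_comm]
  refine Finset.sum_le_sum fun ω _ => ?_
  have h0 : ∀ i, 0 ≤ if E i ω then runProb plan f ω else 0 := fun i => by
    split_ifs
    · exact runProb_nonneg _ _ _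
    · exact le_rfl
  split_ifs with h
  · obtain ⟨i, hi⟩ := h
    refine le_trans ?_ (Finset.single_le_sum (fun i _ => h0 i) (Finset.mem_univ i))
    rw [if_pos hi]
  · exact Finset.sum_nonneg fun i _ => h0 i

theorem runEventProb_or_le (plan : Planner S O A H m) (f : POMDP S O A)
    (E E' : Outcome O A H m K → Prop) :
    runEventProb plan f (fun ω => E ω ∨ E' ω) ≤
      runEventProb plan f E + runEventProb plan f E' := by
  have h := runEventProb_exists_le plan f (fun b : Bool => if b then E else E')
  simp only [Fintype.sum_bool, if_true, Bool.false_eq_true, if_false] at h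
  refine le_trans (runEventProb_mono _ _ fun ω hω => ?_) h
  rcases hω with h | h
  · exact ⟨true, by simpa using h⟩
  · exact ⟨false, by simpa using h⟩

/-- A change-of-measure bound: an event on which the likelihood of the true model is at most `C`
times a product of subprobabilities has probability at most `C`. -/
theorem runEventProb_le_of_likelihood_le (plan : Planner S O A H m) (f : POMDP S O A) (k : Fin K)
    (g : Policy O A → Traj O A H → ℝ) (hg0 : ∀ π τ, 0 ≤ g π τ) (hg : ∀ π, ∑ τ, g π τ ≤ 1)
    {C : ℝ} (hC : 0 ≤ C) (E : Outcome O A H m K → Prop)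
    (hE : ∀ ω, E ω → likelihood plan f ω k ≤
      C * ∏ i ∈ Finset.Iio k, ∏ j, g (plan.executed ω i j) (ω i j)) :
    runEventProb plan f E ≤ C := by
  classical
  set G : ℕ → Policy O A → Traj O A H → ℝ := fun i => if i < k then g else f.trajProb with hG
  have hG0 : ∀ i π τ, 0 ≤ G i π τ := fun i π τ => by
    simp only [hG]; split_ifs
    · exact hg0 _ _
    · exact f.trajProb_nonneg _ _
  have hG1 : ∀ i π, ∑ τ, G i π τ ≤ 1 := fun i π => by
    simp only [hG]; split_ifs
    · exact hg _
    · exact (f.sum_trajProb _).le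
  have hIio : Finset.Iio k = Finset.univ.filter (fun i : Fin K => i < k) := by
    ext i; simp
  calc runEventProb plan f E
      ≤ ∑ ω with E ω, C * ∏ i : Fin K, ∏ j, G i (plan.executed ω i j) (ω i j) := by
        refine Finset.sum_le_sum fun ω hω => ?_
        have h1 := hE ω (Finset.mem_filter.mp hω).2
        have h2 : runProb plan f ω = likelihood plan f ω k *
            ∏ i ∈ Finset.univ.filter (fun i : Fin K => ¬ i < k),
              ∏ j, f.trajProb (plan.executed ω i j) (ω i j) := by
          rw [likelihood, hIio, Finset.prod_filter_mul_prod_filter_not]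
          rfl
        have h3 : ∏ i : Fin K, ∏ j, G i (plan.executed ω i j) (ω i j) =
            (∏ i ∈ Finset.Iio k, ∏ j, g (plan.executed ω i j) (ω i j)) *
            ∏ i ∈ Finset.univ.filter (fun i : Fin K => ¬ i < k),
              ∏ j, f.trajProb (plan.executed ω i j) (ω i j) := by
          rw [hIio, ← Finset.prod_filter_mul_prod_filter_not Finset.univ (fun i : Fin K => i < k)]
          congr 1
          · refine Finset.prod_congr rfl fun i hi => ?_
            have : (i : ℕ) < k := (Finset.mem_filter.mp hi).2
            simp only [hG, if_pos this]
          · refine Finset.prod_congr rfl fun i hi => ?_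
            have : ¬ (i : ℕ) < k := (Finset.mem_filter.mp hi).2
            simp only [hG, if_neg this]
        rw [h2, h3, ← mul_assoc]
        exact mul_le_mul_of_nonneg_right h1 (Finset.prod_nonneg fun _ _ =>
          Finset.prod_nonneg fun _ _ => f.trajProb_nonneg _ _)
    _ ≤ ∑ ω, C * ∏ i : Fin K, ∏ j, G i (plan.executed ω i j) (ω i j) :=
        Finset.sum_le_sum_of_subset_of_nonneg (Finset.filter_subset _ _) fun ω _ _ =>
          mul_nonneg hC (Finset.prod_nonneg fun _ _ => Finset.prod_nonneg fun _ _ => hG0 _ _ _)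
    _ ≤ C * 1 := by
        rw [← Finset.mul_sum]
        exact mul_le_mul_of_nonneg_left (sum_prod_executed_le_one plan G hG0 hG1) hC
    _ = C := mul_one C

/-! ### Maximum likelihood confidence sets -/

/-- The `ℓ¹` distance of the trajectory laws of two models under a policy. -/
def POMDP.trajDist (f f' : POMDP S O A) (H : ℕ) (π : Policy O A) : ℝ :=
  ∑ τ : Traj O A H, |f.trajProb π τ - f'.trajProb π τ|

/-- The Bhattacharyya coefficient of two nonnegative functions on a finite type. -/
def bhattacharyya {X : Type*} [Fintype X] (p q : X → ℝ) : ℝ := ∑ x, √(p x * q x)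

/-- The squared `ℓ¹` distance is bounded by the Hellinger distance, also if `q` is not quite
normalized. -/
theorem sq_sum_abs_sub_le {X : Type*} [Fintype X] {p q : X → ℝ} (hp : ∀ x, 0 ≤ p x)
    (hq : ∀ x, 0 ≤ q x) (hp1 : ∑ x, p x = 1) {ε : ℝ} (hε : ε ≤ 1) (hq1 : ∑ x, q x ≤ 1 + ε) :
    (∑ x, |p x - q x|) ^ 2 ≤ 12 * (1 - bhattacharyya p q) + 6 * ε := by
  have hpq : ∀ x, √(p x * q x) = √(p x) * √(q x) := fun x => Real.sqrt_mul (hp x) _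
  have h1 : ∑ x, |p x - q x| = ∑ x, |√(p x) - √(q x)| * (√(p x) + √(q x)) := by
    refine Finset.sum_congr rfl fun x _ => ?_
    have h := Real.sqrt_nonneg (p x)
    have h' := Real.sqrt_nonneg (q x)
    rw [← abs_of_nonneg (add_nonneg h h'), ← abs_mul]
    congr 1
    nlinarith [Real.sq_sqrt (hp x), Real.sq_sqrt (hq x)]
  have h2 := Finset.sum_mul_sq_le_sq_mul_sq Finset.univ (fun x => |√(p x) - √(q x)|)
    (fun x => √(p x) + √(q x))
  have hA0 : 0 ≤ bhattacharyya p q := Finset.sum_nonneg fun x _ => Real.sqrt_nonneg _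
  have h3 : ∑ x, |√(p x) - √(q x)| ^ 2 = 1 + ∑ x, q x - 2 * bhattacharyya p q := by
    rw [← hp1, bhattacharyya, Finset.mul_sum, ← Finset.sum_add_distrib, ← Finset.sum_sub_distrib]
    refine Finset.sum_congr rfl fun x _ => ?_
    rw [sq_abs, hpq]
    nlinarith [Real.sq_sqrt (hp x), Real.sq_sqrt (hq x)]
  have h4 : ∑ x, (√(p x) + √(q x)) ^ 2 ≤ 6 := by
    calc _ ≤ ∑ x, (2 * p x + 2 * q x) := by
          refine Finset.sum_le_sum fun x _ => ?_
          nlinarith [Real.sq_sqrt (hp x), Real.sq_sqrt (hq x), sq_nonneg (√(p x) - √(q x))]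
      _ ≤ 6 := by
          rw [Finset.sum_add_distrib, ← Finset.mul_sum, ← Finset.mul_sum, hp1]
          linarith
  rw [h1]
  refine h2.trans ?_
  have h5 : 0 ≤ ∑ x, |√(p x) - √(q x)| ^ 2 := Finset.sum_nonneg fun x _ => sq_nonneg _
  calc _ ≤ (∑ x, |√(p x) - √(q x)| ^ 2) * 6 := mul_le_mul_of_nonneg_left h4 h5
    _ ≤ _ := by rw [h3]; linarith

variable {F : Set (POMDP S O A)} {fstar : POMDP S O A}

/-- The properties of an upper bracket that contains a model. -/
structure IsUpperBracket (f : POMDP S O A) (H : ℕ) (ε : ℝ)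
    (g : Policy O A → Traj O A H → ℝ) : Prop where
  le : ∀ π τ, f.trajProb π τ ≤ g π τ
  dist_le : ∀ π, ∑ τ, |g π τ - f.trajProb π τ| ≤ ε

theorem IsUpperBracket.nonneg {f : POMDP S O A} {ε : ℝ} {g : Policy O A → Traj O A H → ℝ}
    (hg : IsUpperBracket f H ε g) (π : Policy O A) (τ : Traj O A H) : 0 ≤ g π τ :=
  (f.trajProb_nonneg π τ).trans (hg.le π τ)

theorem IsUpperBracket.sum_le {f : POMDP S O A} {ε : ℝ} {g : Policy O A → Traj O A H → ℝ}
    (hg : IsUpperBracket f H ε g) (π : Policy O A) : ∑ τ, g π τ ≤ 1 + ε := by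
  have h1 := hg.dist_le π
  have h2 : ∑ τ, (g π τ - f.trajProb π τ) ≤ ∑ τ, |g π τ - f.trajProb π τ| :=
    Finset.sum_le_sum fun τ _ => le_abs_self _
  rw [Finset.sum_sub_distrib, f.sum_trajProb] at h2
  linarith

/-- With high probability, no model in a bracket has a likelihood that exceeds the likelihood of
the true model by much. -/
theorem runEventProb_likelihood_gt_le (plan : Planner S O A H m) (k : Fin K) {f₀ : POMDP S O A}
    {ε : ℝ} (hε0 : 0 ≤ ε) (hεK : ε * (K * Fintype.card (ExploreIndex A H m)) ≤ 1)
    {g : Policy O A → Traj O A H → ℝ} (hg : IsUpperBracket f₀ H ε g) (β : ℝ) :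
    runEventProb plan fstar (fun ω => ∃ f : POMDP S O A, (∀ π τ, f.trajProb π τ ≤ g π τ) ∧
      likelihood plan fstar ω k < Real.exp (-β) * likelihood plan f ω k) ≤ Real.exp (1 - β) := by
  refine runEventProb_le_of_likelihood_le plan fstar k (fun π τ => (1 + ε)⁻¹ * g π τ)
    (fun π τ => mul_nonneg (inv_nonneg.mpr (by linarith)) (hg.nonneg _ _)) (fun π => ?_)
    (Real.exp_pos _).le _ ?_
  · rw [← Finset.mul_sum, inv_mul_le_iff₀ (by linarith), mul_one]
    exact hg.sum_le π
  · rintro ω ⟨f, hf, hlik⟩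
    refine hlik.le.trans ?_
    have h1 : likelihood plan f ω k ≤ ∏ i ∈ Finset.Iio k, ∏ j, g (plan.executed ω i j) (ω i j) :=
      Finset.prod_le_prod (fun i _ => Finset.prod_nonneg fun j _ => f.trajProb_nonneg _ _)
        fun i _ => Finset.prod_le_prod (fun j _ => f.trajProb_nonneg _ _) fun j _ => hf _ _
    have hP : 0 ≤ ∏ i ∈ Finset.Iio k, ∏ j, g (plan.executed ω i j) (ω i j) :=
      Finset.prod_nonneg fun i _ => Finset.prod_nonneg fun j _ => hg.nonneg _ _
    simp only [Finset.prod_mul_distrib, Finset.prod_const, Finset.card_univ, Fin.card_Iio]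
    set P := ∏ i ∈ Finset.Iio k, ∏ j, g (plan.executed ω i j) (ω i j)
    set N := Fintype.card (ExploreIndex A H m)
    -- normalizing the bracket to a subprobability costs at most a factor `e` in total
    have h2 : (1 + ε) ^ (N * k) ≤ Real.exp 1 := by
      calc (1 + ε) ^ (N * k) ≤ Real.exp ε ^ (N * k) :=
            pow_le_pow_left₀ (by linarith) (by linarith [Real.add_one_le_exp ε]) _
        _ = Real.exp (ε * (k * N)) := by rw [← Real.exp_nat_mul]; push_cast; ring_nf
        _ ≤ Real.exp 1 := by
            rw [Real.exp_le_exp]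
            refine le_trans (mul_le_mul_of_nonneg_left ?_ hε0) hεK
            refine mul_le_mul_of_nonneg_right ?_ (Nat.cast_nonneg _)
            exact_mod_cast k.2.le
    have hpow : 0 < (1 + ε) ^ (N * k) := pow_pos (by linarith) _
    have h3 : (1 : ℝ) ≤ Real.exp 1 * ((1 + ε)⁻¹ ^ N) ^ (k : ℕ) := by
      rw [← pow_mul, inv_pow, ← div_eq_mul_inv, le_div_iff₀ hpow, one_mul]
      exact h2
    have hee : Real.exp (1 - β) = Real.exp (-β) * Real.exp 1 := by
      rw [← Real.exp_add]; ring_nf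
    calc Real.exp (-β) * likelihood plan f ω k ≤ Real.exp (-β) * P * 1 := by
          rw [mul_one]; exact mul_le_mul_of_nonneg_left h1 (Real.exp_pos _).le
      _ ≤ Real.exp (-β) * P * (Real.exp 1 * ((1 + ε)⁻¹ ^ N) ^ (k : ℕ)) :=
          mul_le_mul_of_nonneg_left h3 (mul_nonneg (Real.exp_pos _).le hP)
      _ = _ := by rw [hee]; ring

/-- With high probability, a model in a bracket that has a large likelihood also has a small total
Hellinger distance from the true model under the executed policies. -/
theorem runEventProb_hellinger_gt_le (plan : Planner S O A H m) (k : Fin K) {f₀ : POMDP S O A}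
    {ε : ℝ} {g : Policy O A → Traj O A H → ℝ} (hg : IsUpperBracket f₀ H ε g) (β : ℝ) :
    runEventProb plan fstar (fun ω => ∃ f : POMDP S O A, (∀ π τ, f.trajProb π τ ≤ g π τ) ∧
      Real.exp (-β) * likelihood plan fstar ω k ≤ likelihood plan f ω k ∧
      2 * β < ∑ i ∈ Finset.Iio k, ∑ j, (1 - bhattacharyya
        (fstar.trajProb (H := H) (plan.executed ω i j)) (g (plan.executed ω i j)))) ≤
      Real.exp (-(3 * β / 2)) := by
  -- `x e^{1 - x} ≤ 1` makes the following functions subprobabilities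
  refine runEventProb_le_of_likelihood_le plan fstar k
    (fun π τ => Real.exp (1 - bhattacharyya (fstar.trajProb (H := H) π) (g π)) *
      √(fstar.trajProb π τ * g π τ))
    (fun π τ => mul_nonneg (Real.exp_pos _).le (Real.sqrt_nonneg _)) (fun π => ?_)
    (Real.exp_pos _).le _ ?_
  · rw [← Finset.mul_sum]
    change _ * bhattacharyya (fstar.trajProb (H := H) π) (g π) ≤ 1
    set x := bhattacharyya (fstar.trajProb (H := H) π) (g π)
    have h := Real.add_one_le_exp (x - 1)
    have h1 : Real.exp (1 - x) * Real.exp (x - 1) = 1 := by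
      rw [← Real.exp_add]; simp
    nlinarith [Real.exp_pos (1 - x)]
  · rintro ω ⟨f, hf, hlik, hsum⟩
    simp only [Finset.prod_mul_distrib, ← Real.exp_sum]
    set σ := ∑ i ∈ Finset.Iio k, ∑ j, (1 - bhattacharyya
        (fstar.trajProb (H := H) (plan.executed ω i j)) (g (plan.executed ω i j)))
    set L := likelihood plan fstar ω k with hL
    have hL0 : 0 ≤ L := Finset.prod_nonneg fun i _ =>
      Finset.prod_nonneg fun j _ => fstar.trajProb_nonneg _ _
    set P := ∏ i ∈ Finset.Iio k, ∏ j, g (plan.executed ω i j) (ω i j) with hP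
    have h1 : likelihood plan f ω k ≤ P :=
      Finset.prod_le_prod (fun i _ => Finset.prod_nonneg fun j _ => f.trajProb_nonneg _ _)
        fun i _ => Finset.prod_le_prod (fun j _ => f.trajProb_nonneg _ _) fun j _ => hf _ _
    have hsq : ∏ i ∈ Finset.Iio k, ∏ j,
        √(fstar.trajProb (plan.executed ω i j) (ω i j) * g (plan.executed ω i j) (ω i j)) =
        √(L * P) := by
      rw [hL, hP, likelihood, ← Finset.prod_mul_distrib,
        Real.sqrt_prod _ (fun i _ => mul_nonneg
          (Finset.prod_nonneg fun j _ => fstar.trajProb_nonneg _ _)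
          (Finset.prod_nonneg fun j _ => hg.nonneg _ _))]
      refine Finset.prod_congr rfl fun i _ => ?_
      rw [← Finset.prod_mul_distrib,
        Real.sqrt_prod _ (fun j _ => mul_nonneg (fstar.trajProb_nonneg _ _) (hg.nonneg _ _))]
    rw [hsq]
    have h2 : L ≤ Real.exp (β / 2) * √(L * P) := by
      have h3 : L ^ 2 ≤ Real.exp β * (L * P) := by
        have h4 : L ≤ Real.exp β * P := by
          have := mul_le_mul_of_nonneg_left (hlik.trans h1) (Real.exp_pos β).le
          rwa [← mul_assoc, ← Real.exp_add, add_neg_cancel, Real.exp_zero, one_mul] at this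
        nlinarith
      have h5 : Real.exp (β / 2) = √(Real.exp β) := by
        rw [Real.sqrt_eq_rpow, ← Real.exp_mul]; ring_nf
      rw [h5, ← Real.sqrt_mul (Real.exp_pos _).le]
      exact Real.le_sqrt_of_sq_le h3
    have h6 : Real.exp (β / 2) ≤ Real.exp (-(3 * β / 2)) * Real.exp σ := by
      rw [← Real.exp_add, Real.exp_le_exp]; linarith
    calc L ≤ Real.exp (β / 2) * √(L * P) := h2
      _ ≤ Real.exp (-(3 * β / 2)) * Real.exp σ * √(L * P) :=
          mul_le_mul_of_nonneg_right h6 (Real.sqrt_nonneg _)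
      _ = _ := by rw [mul_assoc]

/-- The maximum likelihood guarantee: with high probability the true model stays in the confidence
sets, and all the models in the confidence sets have a bounded total squared distance from the true
model on the past data. -/
theorem one_sub_le_runEventProb_confidence (plan : Planner S O A H m) (hF : fstar ∈ F) {ε : ℝ}
    (hε0 : 0 ≤ ε) (hε1 : ε ≤ 1) (hεK : ε * (K * Fintype.card (ExploreIndex A H m)) ≤ 1)
    {N : ℕ} (hN : HasBracket F H ε N) {β δ : ℝ}
    (hβ : K * N * (Real.exp (1 - β) + Real.exp (-(3 * β / 2))) ≤ δ) :
    1 - δ ≤ runEventProb plan fstar (fun ω : Outcome O A H m K => ∀ k,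
      fstar ∈ confidenceSet plan F β ω k ∧
      ∀ f ∈ confidenceSet plan F β ω k, ∑ i ∈ Finset.Iio k, ∑ j,
        (f.trajDist fstar H (plan.executed ω i j)) ^ 2 ≤ 48 * β + 14) := by
  classical
  obtain ⟨g₁, g₂, hg, hbr⟩ := hN
  have hup : ∀ (f : POMDP S O A) i, (∀ π τ, g₁ i π τ ≤ f.trajProb π τ ∧ f.trajProb π τ ≤ g₂ i π τ) →
      IsUpperBracket f H ε (g₂ i) := by
    intro f i hf
    refine ⟨fun π τ => (hf π τ).2, fun π => le_trans (Finset.sum_le_sum fun τ _ => ?_) (hg i π)⟩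
    have := hf π τ
    rw [abs_of_nonneg (by linarith), abs_sub_comm, abs_of_nonneg (by linarith)]
    linarith
  set E₁ : Fin K × Fin N → Outcome O A H m K → Prop := fun x ω =>
    (∃ f₀ : POMDP S O A, IsUpperBracket f₀ H ε (g₂ x.2)) ∧
    ∃ f : POMDP S O A, (∀ π τ, f.trajProb π τ ≤ g₂ x.2 π τ) ∧
      likelihood plan fstar ω x.1 < Real.exp (-β) * likelihood plan f ω x.1 with hE₁
  set E₂ : Fin K × Fin N → Outcome O A H m K → Prop := fun x ω =>
    (∃ f₀ : POMDP S O A, IsUpperBracket f₀ H ε (g₂ x.2)) ∧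
    ∃ f : POMDP S O A, (∀ π τ, f.trajProb π τ ≤ g₂ x.2 π τ) ∧
      Real.exp (-β) * likelihood plan fstar ω x.1 ≤ likelihood plan f ω x.1 ∧
      2 * β < ∑ i ∈ Finset.Iio x.1, ∑ j, (1 - bhattacharyya
        (fstar.trajProb (H := H) (plan.executed ω i j)) (g₂ x.2 (plan.executed ω i j))) with hE₂
  have hb₁ : ∀ x, runEventProb plan fstar (E₁ x) ≤ Real.exp (1 - β) := by
    intro x
    by_cases h : ∃ f₀ : POMDP S O A, IsUpperBracket f₀ H ε (g₂ x.2)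
    · obtain ⟨f₀, hf₀⟩ := h
      exact (runEventProb_mono _ _ fun ω hω => hω.2).trans
        (runEventProb_likelihood_gt_le plan x.1 hε0 hεK hf₀ β)
    · rw [runEventProb_eq_zero _ _ fun ω hω => h hω.1]
      exact (Real.exp_pos _).le
  have hb₂ : ∀ x, runEventProb plan fstar (E₂ x) ≤ Real.exp (-(3 * β / 2)) := by
    intro x
    by_cases h : ∃ f₀ : POMDP S O A, IsUpperBracket f₀ H ε (g₂ x.2)
    · obtain ⟨f₀, hf₀⟩ := h
      exact (runEventProb_mono _ _ fun ω hω => hω.2).trans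
        (runEventProb_hellinger_gt_le plan x.1 hf₀ β)
    · rw [runEventProb_eq_zero _ _ fun ω hω => h hω.1]
      exact (Real.exp_pos _).le
  apply one_sub_le_runEventProb
  refine le_trans (runEventProb_mono (E' := fun ω => (∃ x, E₁ x ω) ∨ ∃ x, E₂ x ω) _ _ ?_) ?_
  · intro ω hω
    by_contra hno
    push Not at hno
    refine hω fun k => ⟨⟨hF, fun f' hf' => ?_⟩, fun f hf => ?_⟩
    · obtain ⟨i, hi⟩ := hbr f' hf'
      by_contra hlt
      push Not at hlt
      exact hno.1 (k, i) ⟨⟨f', hup f' i hi⟩, f', fun π τ => (hi π τ).2, hlt⟩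
    · obtain ⟨i, hi⟩ := hbr f hf.1
      have hU := hup f i hi
      have hsum : ∑ i' ∈ Finset.Iio k, ∑ j, (1 - bhattacharyya
          (fstar.trajProb (H := H) (plan.executed ω i' j)) (g₂ i (plan.executed ω i' j))) ≤
            2 * β := by
        by_contra hlt
        push Not at hlt
        exact hno.2 (k, i) ⟨⟨f, hU⟩, f, fun π τ => (hi π τ).2, hf.2 fstar hF, hlt⟩
      have hterm : ∀ π, (f.trajDist fstar H π) ^ 2 ≤
          24 * (1 - bhattacharyya (fstar.trajProb (H := H) π) (g₂ i π)) + 14 * ε := by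
        intro π
        have h1 : f.trajDist fstar H π ≤ ∑ τ, |fstar.trajProb π τ - g₂ i π τ| + ε := by
          calc f.trajDist fstar H π
              ≤ ∑ τ, (|fstar.trajProb π τ - g₂ i π τ| + |g₂ i π τ - f.trajProb π τ|) := by
                refine Finset.sum_le_sum fun τ _ => ?_
                rw [abs_sub_comm]
                exact abs_sub_le _ _ _
            _ ≤ _ := by
                rw [Finset.sum_add_distrib]
                linarith [hU.dist_le π]
        have h2 := sq_sum_abs_sub_le (fun τ => fstar.trajProb_nonneg π τ)
          (fun τ => hU.nonneg π τ) (fstar.sum_trajProb π) hε1 (hU.sum_le π)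
        have h0 : 0 ≤ f.trajDist fstar H π := Finset.sum_nonneg fun τ _ => abs_nonneg _
        set T := ∑ τ, |fstar.trajProb π τ - g₂ i π τ|
        have h3 : (f.trajDist fstar H π) ^ 2 ≤ (T + ε) ^ 2 := pow_le_pow_left₀ h0 h1 2
        change T ^ 2 ≤ 12 * (1 - bhattacharyya (fstar.trajProb (H := H) π) (g₂ i π)) + 6 * ε at h2
        nlinarith [sq_nonneg (T - ε)]
      calc ∑ i' ∈ Finset.Iio k, ∑ j, (f.trajDist fstar H (plan.executed ω i' j)) ^ 2
          ≤ ∑ i' ∈ Finset.Iio k, ∑ j, (24 * (1 - bhattacharyya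
              (fstar.trajProb (H := H) (plan.executed ω i' j)) (g₂ i (plan.executed ω i' j))) +
                14 * ε) :=
            Finset.sum_le_sum fun i' _ => Finset.sum_le_sum fun j _ => hterm _
        _ = 24 * ∑ i' ∈ Finset.Iio k, ∑ j, (1 - bhattacharyya
              (fstar.trajProb (H := H) (plan.executed ω i' j)) (g₂ i (plan.executed ω i' j))) +
              14 * (ε * (k * Fintype.card (ExploreIndex A H m))) := by
            simp only [Finset.sum_add_distrib, ← Finset.mul_sum, Finset.sum_const,
              Finset.card_univ, Fin.card_Iio, nsmul_eq_mul]
            ring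
        _ ≤ 24 * (2 * β) + 14 * 1 := by
            have : ε * (k * Fintype.card (ExploreIndex A H m)) ≤ 1 := by
              refine le_trans (mul_le_mul_of_nonneg_left ?_ hε0) hεK
              refine mul_le_mul_of_nonneg_right ?_ (Nat.cast_nonneg _)
              exact_mod_cast k.2.le
            linarith
        _ = 48 * β + 14 := by ring
  · refine (runEventProb_or_le _ _ _ _).trans (le_trans (add_le_add
      ((runEventProb_exists_le _ _ _).trans (Finset.sum_le_sum fun x _ => hb₁ x))
      ((runEventProb_exists_le _ _ _).trans (Finset.sum_le_sum fun x _ => hb₂ x))) ?_)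
    simp only [Finset.sum_const, Finset.card_univ, Fintype.card_prod, Fintype.card_fin,
      nsmul_eq_mul]
    push_cast
    linarith

end Run

/-! ### An elliptical potential argument for `ℓ¹` errors -/

section Potential

variable {ι : Type*} [Fintype ι] [DecidableEq ι]

theorem one_add_trace_le_det_one_add {X : Matrix ι ι ℝ} (hX : X.PosSemidef) :
    1 + X.trace ≤ (1 + X).det := by
  have hH : (1 + X).IsHermitian := (Matrix.PosSemidef.one.add hX).isHermitian
  have h1 : ∀ i, 1 ≤ hH.eigenvalues i := by
    intro i
    set v := (hH.eigenvectorBasis i : ι → ℝ) with hv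
    have hmul := hH.mulVec_eigenvectorBasis i
    have hq := hX.dotProduct_mulVec_nonneg v
    have hXv : X *ᵥ v = (hH.eigenvalues i - 1) • v := by
      have : (1 + X) *ᵥ v = v + X *ᵥ v := by rw [Matrix.add_mulVec, Matrix.one_mulVec]
      rw [sub_smul, one_smul, ← hmul, this]
      simp
    rw [hXv, dotProduct_smul, smul_eq_mul] at hq
    have hvv : star v ⬝ᵥ v = 1 := by
      have := hH.eigenvectorBasis.orthonormal.1 i
      have h2 : inner ℝ (hH.eigenvectorBasis i) (hH.eigenvectorBasis i) = (1 : ℝ) := by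
        rw [real_inner_self_eq_norm_sq, this]; norm_num
      rw [← h2, PiLp.inner_apply]
      simp only [dotProduct, hv, Pi.star_apply, star_trivial, RCLike.inner_apply, conj_trivial]
    rw [hvv, mul_one] at hq
    linarith
  have htr : (Fintype.card ι : ℝ) + X.trace = ∑ i, hH.eigenvalues i := by
    have := hH.trace_eq_sum_eigenvalues
    rw [Matrix.trace_add, Matrix.trace_one] at this
    simpa using this
  have hdet : (1 + X).det = ∏ i, hH.eigenvalues i := by
    simpa using hH.det_eq_prod_eigenvalues
  rw [hdet]
  have key : ∀ s : Finset ι, 1 + ∑ i ∈ s, (hH.eigenvalues i - 1) ≤ ∏ i ∈ s, hH.eigenvalues i := by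
    intro s
    induction s using Finset.induction_on with
    | empty => simp
    | insert a s ha ih =>
      rw [Finset.sum_insert ha, Finset.prod_insert ha]
      have hs : 0 ≤ ∑ i ∈ s, (hH.eigenvalues i - 1) :=
        Finset.sum_nonneg fun i _ => by linarith [h1 i]
      nlinarith [h1 a, mul_nonneg (sub_nonneg.mpr (h1 a)) hs]
  have := key Finset.univ
  rw [Finset.sum_sub_distrib] at this
  simp only [Finset.sum_const, Finset.card_univ, nsmul_eq_mul, mul_one] at this
  linarith

theorem det_mul_one_add_trace_le {M X : Matrix ι ι ℝ} (hM : M.PosDef) (hX : X.PosSemidef) :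
    M.det * (1 + (M⁻¹ * X).trace) ≤ (M + X).det := by
  obtain ⟨B, hB⟩ : ∃ B : Matrix ι ι ℝ, M⁻¹ = Bᴴ * B := by
    have := hM.inv.posSemidef
    open scoped MatrixOrder in
    exact CStarAlgebra.nonneg_iff_eq_star_mul_self.mp this.nonneg
  have hMu : IsUnit M.det := hM.det_pos.ne'.isUnit
  have hBdet : B.det * B.det = M.det⁻¹ := by
    have := congrArg Matrix.det hB
    rw [Matrix.det_mul, Matrix.det_conjTranspose, Matrix.det_nonsing_inv] at this
    simpa [Ring.inverse_eq_inv'] using this.symm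
  have hB0 : IsUnit B.det := by
    rw [isUnit_iff_ne_zero]
    rintro h0
    rw [h0, zero_mul] at hBdet
    exact (inv_pos.mpr hM.det_pos).ne hBdet
  have hBMB : B * M * Bᴴ = 1 := by
    have h1 : Bᴴ * (B * M) = 1 := by
      rw [← Matrix.mul_assoc, ← hB, Matrix.nonsing_inv_mul _ hMu]
    exact mul_eq_one_comm.mp h1
  have hdet : (1 + B * X * Bᴴ).det = M.det⁻¹ * (M + X).det := by
    rw [← hBMB, ← Matrix.add_mul, ← Matrix.mul_add, Matrix.det_mul, Matrix.det_mul,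
      Matrix.det_conjTranspose, ← hBdet]
    simp only [star_trivial]
    ring
  have htr : (B * X * Bᴴ).trace = (M⁻¹ * X).trace := by
    rw [Matrix.trace_mul_comm, ← Matrix.mul_assoc, hB]
  have := one_add_trace_le_det_one_add (hX.mul_mul_conjTranspose_same B)
  rw [htr, hdet] at this
  calc M.det * (1 + (M⁻¹ * X).trace) ≤ M.det * (M.det⁻¹ * (M + X).det) :=
        mul_le_mul_of_nonneg_left this hM.det_pos.le
    _ = (M + X).det := by rw [← mul_assoc, mul_inv_cancel₀ hM.det_pos.ne', one_mul]

theorem det_le_trace_pow {M : Matrix ι ι ℝ} (hM : M.PosSemidef) :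
    M.det ≤ M.trace ^ Fintype.card ι := by
  have hdet : M.det = ∏ i, hM.1.eigenvalues i := by simpa using hM.1.det_eq_prod_eigenvalues
  have htr : M.trace = ∑ i, hM.1.eigenvalues i := by simpa using hM.1.trace_eq_sum_eigenvalues
  rw [hdet, htr]
  calc ∏ i, hM.1.eigenvalues i ≤ ∏ _i : ι, ∑ i, hM.1.eigenvalues i :=
        Finset.prod_le_prod (fun i _ => hM.eigenvalues_nonneg i) fun i _ =>
          Finset.single_le_sum (fun j _ => hM.eigenvalues_nonneg j) (Finset.mem_univ i)
    _ = _ := by simp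

/-- The Cauchy–Schwarz inequality for the norm of a positive definite matrix and its dual. -/
theorem abs_dotProduct_le_sqrt_mul_sqrt {M : Matrix ι ι ℝ} (hM : M.PosDef) (w v : ι → ℝ) :
    |w ⬝ᵥ v| ≤ √(w ⬝ᵥ M *ᵥ w) * √(v ⬝ᵥ M⁻¹ *ᵥ v) := by
  have hMu : IsUnit M.det := hM.det_pos.ne'.isUnit
  set u := M⁻¹ *ᵥ v with hu
  have hMv : M *ᵥ u = v := by
    rw [hu, Matrix.mulVec_mulVec, Matrix.mul_nonsing_inv _ hMu, Matrix.one_mulVec]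
  have hsymm : u ⬝ᵥ M *ᵥ w = w ⬝ᵥ v := by
    have hT : Mᵀ = M := by simpa using hM.isHermitian.eq
    rw [Matrix.dotProduct_mulVec, ← Matrix.mulVec_transpose, hT, hMv, dotProduct_comm]
  have hq : ∀ t : ℝ, 0 ≤ (v ⬝ᵥ u) * (t * t) + (-2 * (w ⬝ᵥ v)) * t + w ⬝ᵥ M *ᵥ w := by
    intro t
    have := hM.posSemidef.dotProduct_mulVec_nonneg (w - t • u)
    simp only [star_trivial, Matrix.mulVec_sub, Matrix.mulVec_smul, sub_dotProduct,
      dotProduct_sub, smul_dotProduct, dotProduct_smul, smul_eq_mul, hMv, hsymm] at this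
    have h2 : u ⬝ᵥ v = v ⬝ᵥ u := dotProduct_comm _ _
    rw [h2] at this
    linarith
  have hd := discrim_le_zero hq
  unfold discrim at hd
  have hw : 0 ≤ w ⬝ᵥ M *ᵥ w := by simpa using hM.posSemidef.dotProduct_mulVec_nonneg w
  rw [← Real.sqrt_mul hw]
  apply Real.abs_le_sqrt
  nlinarith

/-- The norm on vectors that is dual to the norm `w ↦ √(wᵀ M w)`. -/
def dualNorm (M : Matrix ι ι ℝ) (v : ι → ℝ) : ℝ := √(v ⬝ᵥ M⁻¹ *ᵥ v)

theorem sq_dualNorm {M : Matrix ι ι ℝ} (hM : M.PosDef) (v : ι → ℝ) :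
    dualNorm M v ^ 2 = v ⬝ᵥ M⁻¹ *ᵥ v :=
  Real.sq_sqrt (by simpa using hM.inv.posSemidef.dotProduct_mulVec_nonneg v)

theorem dualNorm_nonneg (M : Matrix ι ι ℝ) (v : ι → ℝ) : 0 ≤ dualNorm M v := Real.sqrt_nonneg _

variable {I : Type*} [Fintype I]

/-- The weighted covariance matrix of the vectors `v i`, each of them divided by the square root of
its dual norm. The quadratic form of this matrix at `w` is controlled by the *absolute values* of
the `⟨w, v i⟩`. -/
def covIncrement (M : Matrix ι ι ℝ) (p : I → ℝ) (v : I → ι → ℝ) : Matrix ι ι ℝ :=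
  ∑ i, (p i * (dualNorm M (v i))⁻¹) • Matrix.vecMulVec (v i) (v i)

/-- The regularized covariance matrices: `Λ₀ = 1`, and in each step the increment is normalized by
the current dual norm. -/
def covMatrix (p : ℕ → I → ℝ) (v : I → ι → ℝ) : ℕ → Matrix ι ι ℝ
  | 0 => 1
  | k + 1 => covMatrix p v k + covIncrement (covMatrix p v k) (p k) v

theorem posSemidef_covIncrement (M : Matrix ι ι ℝ) {p : I → ℝ} (hp : ∀ i, 0 ≤ p i)
    (v : I → ι → ℝ) : (covIncrement M p v).PosSemidef := by
  refine Matrix.posSemidef_sum _ fun i _ => ?_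
  refine Matrix.PosSemidef.smul ?_ (mul_nonneg (hp i) (inv_nonneg.mpr (dualNorm_nonneg _ _)))
  simpa using Matrix.posSemidef_vecMulVec_self_star (v i)

theorem posDef_covMatrix {p : ℕ → I → ℝ} (hp : ∀ k i, 0 ≤ p k i) (v : I → ι → ℝ) (k : ℕ) :
    (covMatrix p v k).PosDef := by
  induction k with
  | zero => exact Matrix.PosDef.one
  | succ k ih => exact ih.add_posSemidef (posSemidef_covIncrement _ (hp k) v)

theorem quad_covIncrement (M : Matrix ι ι ℝ) (p : I → ℝ) (v : I → ι → ℝ) (w : ι → ℝ) :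
    w ⬝ᵥ covIncrement M p v *ᵥ w = ∑ i, p i * (dualNorm M (v i))⁻¹ * (w ⬝ᵥ v i) ^ 2 := by
  unfold covIncrement
  rw [Matrix.sum_mulVec, dotProduct_sum]
  refine Finset.sum_congr rfl fun i _ => ?_
  rw [Matrix.smul_mulVec, Matrix.vecMulVec_mulVec, dotProduct_smul]
  rw [dotProduct_smul, dotProduct_comm (v i) w, pow_two]
  rfl

theorem trace_mul_covIncrement (N M : Matrix ι ι ℝ) (p : I → ℝ) (v : I → ι → ℝ) :
    (N * covIncrement M p v).trace =
      ∑ i, p i * (dualNorm M (v i))⁻¹ * (v i ⬝ᵥ N *ᵥ v i) := by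
  unfold covIncrement
  rw [Matrix.mul_sum, Matrix.trace_sum]
  refine Finset.sum_congr rfl fun i _ => ?_
  rw [Matrix.mul_smul, Matrix.trace_smul, Matrix.mul_vecMulVec, Matrix.trace_vecMulVec,
    dotProduct_comm]
  simp

/-- The expected dual norm is the trace that controls the growth of the determinant. -/
theorem trace_inv_mul_covIncrement {M : Matrix ι ι ℝ} (hM : M.PosDef) (p : I → ℝ)
    (v : I → ι → ℝ) : (M⁻¹ * covIncrement M p v).trace = ∑ i, p i * dualNorm M (v i) := by
  rw [trace_mul_covIncrement]
  refine Finset.sum_congr rfl fun i _ => ?_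
  rw [← sq_dualNorm hM]
  rcases eq_or_ne (dualNorm M (v i)) 0 with h | h
  · simp [h]
  · field_simp

section Sequence

variable {p : ℕ → I → ℝ} (hp : ∀ k i, 0 ≤ p k i) (v : I → ι → ℝ)
include hp

theorem quad_covMatrix_mono (w : ι → ℝ) :
    Monotone fun k => w ⬝ᵥ covMatrix p v k *ᵥ w := by
  refine monotone_nat_of_le_succ fun k => ?_
  have := (posSemidef_covIncrement (covMatrix p v k) (hp k) v).dotProduct_mulVec_nonneg w
  simp only [covMatrix, Matrix.add_mulVec, dotProduct_add]
  simpa using this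

/-- The norm of `w` after `k` steps is controlled by the absolute errors of the past steps. -/
theorem sqrt_quad_covMatrix_le (w : ι → ℝ) (k : ℕ) :
    √(w ⬝ᵥ covMatrix p v k *ᵥ w) ≤
      ∑ s, |w s| + ∑ l ∈ Finset.range k, ∑ i, p l i * |w ⬝ᵥ v i| := by
  set x := √(w ⬝ᵥ covMatrix p v k *ᵥ w) with hx
  set T := ∑ l ∈ Finset.range k, ∑ i, p l i * |w ⬝ᵥ v i| with hT
  set a := ∑ s, |w s| with ha
  have hx0 : 0 ≤ x := Real.sqrt_nonneg _
  have ha0 : 0 ≤ a := Finset.sum_nonneg fun s _ => abs_nonneg _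
  have hT0 : 0 ≤ T := Finset.sum_nonneg fun l _ => Finset.sum_nonneg fun i _ =>
    mul_nonneg (hp l i) (abs_nonneg _)
  have hww : w ⬝ᵥ w ≤ a ^ 2 := by
    have := Finset.sum_sq_le_sq_sum_of_nonneg (s := Finset.univ) (f := fun s => |w s|)
      (fun s _ => abs_nonneg _)
    simpa [dotProduct, sq_abs, ← pow_two] using this
  -- a term `⟨w, v⟩² / ‖v‖` of an increment is at most `‖w‖ |⟨w, v⟩|` by duality, so that the norm
  -- `x` satisfies `x² ≤ a² + x T`
  have hbound : ∀ j ≤ k, w ⬝ᵥ covMatrix p v j *ᵥ w ≤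
      a ^ 2 + x * ∑ l ∈ Finset.range j, ∑ i, p l i * |w ⬝ᵥ v i| := by
    intro j hj
    induction j with
    | zero => simpa [covMatrix] using hww
    | succ j ih =>
      have hM := posDef_covMatrix hp v j
      have hxj : √(w ⬝ᵥ covMatrix p v j *ᵥ w) ≤ x :=
        Real.sqrt_le_sqrt (quad_covMatrix_mono hp v w (by omega))
      have hinc : w ⬝ᵥ covIncrement (covMatrix p v j) (p j) v *ᵥ w ≤
          x * ∑ i, p j i * |w ⬝ᵥ v i| := by
        rw [quad_covIncrement, Finset.mul_sum]
        refine Finset.sum_le_sum fun i _ => ?_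
        have hcs := abs_dotProduct_le_sqrt_mul_sqrt hM w (v i)
        change _ ≤ _ * dualNorm _ _ at hcs
        have hd := dualNorm_nonneg (covMatrix p v j) (v i)
        have h1 : (dualNorm (covMatrix p v j) (v i))⁻¹ * |w ⬝ᵥ v i| ≤ x := by
          rcases hd.eq_or_lt with h | h
          · rw [← h]; simpa using hx0
          · rw [inv_mul_le_iff₀ h, mul_comm]
            exact hcs.trans (mul_le_mul_of_nonneg_right hxj hd)
        rw [← sq_abs]
        have h2 := mul_le_mul_of_nonneg_right h1
          (mul_nonneg (hp j i) (abs_nonneg (w ⬝ᵥ v i)))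
        calc _ = (dualNorm (covMatrix p v j) (v i))⁻¹ * |w ⬝ᵥ v i| * (p j i * |w ⬝ᵥ v i|) := by
              ring
          _ ≤ _ := h2
      rw [Finset.sum_range_succ, mul_add, covMatrix, Matrix.add_mulVec, dotProduct_add]
      linarith [ih (by omega)]
  have hsq : x ^ 2 ≤ a ^ 2 + x * T := by
    rw [hx, Real.sq_sqrt]
    · exact hbound k le_rfl
    · simpa using (posDef_covMatrix hp v k).posSemidef.dotProduct_mulVec_nonneg w
  by_contra hlt
  push Not at hlt
  nlinarith

/-- The trace of the covariance matrices grows at most quadratically. -/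
theorem quad_le_trace_covMatrix [Nonempty ι] (k : ℕ) (w : ι → ℝ) :
    w ⬝ᵥ covMatrix p v k *ᵥ w ≤ (covMatrix p v k).trace * (w ⬝ᵥ w) := by
  have hww : 0 ≤ w ⬝ᵥ w := by simpa using dotProduct_star_self_nonneg w
  induction k with
  | zero =>
    simp only [covMatrix, Matrix.one_mulVec, Matrix.trace_one]
    have : (1 : ℝ) ≤ Fintype.card ι := by exact_mod_cast Fintype.card_pos
    nlinarith
  | succ k ih =>
    rw [covMatrix, Matrix.add_mulVec, dotProduct_add, Matrix.trace_add, add_mul]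
    refine add_le_add ih ?_
    have htr := trace_mul_covIncrement 1 (covMatrix p v k) (p k) v
    rw [one_mul] at htr
    rw [quad_covIncrement, htr, Finset.sum_mul]
    refine Finset.sum_le_sum fun i _ => ?_
    rw [Matrix.one_mulVec, mul_assoc _ (v i ⬝ᵥ v i)]
    have hc : 0 ≤ p k i * (dualNorm (covMatrix p v k) (v i))⁻¹ :=
      mul_nonneg (hp k i) (inv_nonneg.mpr (dualNorm_nonneg _ _))
    refine mul_le_mul_of_nonneg_left ?_ hc
    have := Finset.sum_mul_sq_le_sq_mul_sq Finset.univ w (v i)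
    simp only [dotProduct, ← pow_two]
    linarith

theorem trace_covMatrix_le [Nonempty ι] (hv : ∀ k, ∑ i, p k i * ∑ s, |v i s| ≤ 1) (k : ℕ) :
    (covMatrix p v k).trace ≤ ((Fintype.card ι : ℝ) + k) ^ 2 := by
  have hcard : (1 : ℝ) ≤ Fintype.card ι := by exact_mod_cast Fintype.card_pos
  induction k with
  | zero =>
    simp only [covMatrix, Matrix.trace_one]
    push_cast
    nlinarith
  | succ k ih =>
    have hM := posDef_covMatrix hp v k
    set t := (covMatrix p v k).trace with ht
    have htr := trace_mul_covIncrement 1 (covMatrix p v k) (p k) v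
    rw [one_mul] at htr
    have hst : √t ≤ (Fintype.card ι : ℝ) + k := by
      rw [Real.sqrt_le_left (by positivity)]; exact ih
    have hinc : (covIncrement (covMatrix p v k) (p k) v).trace ≤ √t := by
      calc _ ≤ ∑ i, p k i * (√t * ∑ s, |v i s|) := by
            rw [htr]
            refine Finset.sum_le_sum fun i _ => ?_
            rw [Matrix.one_mulVec, mul_assoc]
            refine mul_le_mul_of_nonneg_left ?_ (hp k i)
            set q := dualNorm (covMatrix p v k) (v i) with hq
            have hq0 : 0 ≤ q := dualNorm_nonneg _ _
            set n := v i ⬝ᵥ v i with hn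
            have hn0 : 0 ≤ n := by simpa using dotProduct_star_self_nonneg (v i)
            have h1 : √n ≤ ∑ s, |v i s| := by
              rw [Real.sqrt_le_left (Finset.sum_nonneg fun s _ => abs_nonneg _)]
              have := Finset.sum_sq_le_sq_sum_of_nonneg (s := Finset.univ)
                (f := fun s => |v i s|) (fun s _ => abs_nonneg _)
              simpa [hn, dotProduct, sq_abs, ← pow_two] using this
            have hcs := abs_dotProduct_le_sqrt_mul_sqrt hM (v i) (v i)
            change _ ≤ _ * q at hcs
            have h2 := Real.sqrt_le_sqrt (quad_le_trace_covMatrix hp v k (v i))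
            rw [Real.sqrt_mul' _ hn0] at h2
            rw [abs_of_nonneg hn0] at hcs
            have h3 : q⁻¹ * n ≤ √t * √n := by
              rcases hq0.eq_or_lt with h | h
              · rw [← h, inv_zero, zero_mul]; positivity
              · rw [inv_mul_le_iff₀ h, mul_comm]
                exact hcs.trans (mul_le_mul_of_nonneg_right h2 hq0)
            exact h3.trans (mul_le_mul_of_nonneg_left h1 (Real.sqrt_nonneg _))
        _ = √t * ∑ i, p k i * ∑ s, |v i s| := by
            rw [Finset.mul_sum]
            exact Finset.sum_congr rfl fun i _ => by ring
        _ ≤ √t * 1 := mul_le_mul_of_nonneg_left (hv k) (Real.sqrt_nonneg _)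
        _ = √t := mul_one _
    rw [covMatrix, Matrix.trace_add]
    push_cast
    nlinarith

theorem det_covMatrix_pos (k : ℕ) : 0 < (covMatrix p v k).det := (posDef_covMatrix hp v k).det_pos

/-- The potential argument: step `k` multiplies the determinant by at least `1 + ∑ i, p k i ‖v i‖`,
while its final value is polynomial in the number of steps. -/
theorem sum_log_one_add_le [Nonempty ι] (hv : ∀ k, ∑ i, p k i * ∑ s, |v i s| ≤ 1) (K : ℕ) :
    ∑ k ∈ Finset.range K, Real.log (1 + ∑ i, p k i * dualNorm (covMatrix p v k) (v i)) ≤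
      2 * Fintype.card ι * Real.log (Fintype.card ι + K) := by
  have h1 : ∑ k ∈ Finset.range K,
      Real.log (1 + ∑ i, p k i * dualNorm (covMatrix p v k) (v i)) ≤
        Real.log (covMatrix p v K).det := by
    induction K with
    | zero => simp [covMatrix]
    | succ K ih =>
      rw [Finset.sum_range_succ]
      have hM := posDef_covMatrix hp v K
      have hs : 0 ≤ ∑ i, p K i * dualNorm (covMatrix p v K) (v i) :=
        Finset.sum_nonneg fun i _ => mul_nonneg (hp K i) (dualNorm_nonneg _ _)
      have := det_mul_one_add_trace_le hM
        (posSemidef_covIncrement (covMatrix p v K) (hp K) v)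
      rw [trace_inv_mul_covIncrement hM] at this
      have h2 := Real.log_le_log (mul_pos hM.det_pos (by linarith)) this
      rw [Real.log_mul hM.det_pos.ne' (by linarith)] at h2
      rw [covMatrix]
      linarith
  refine h1.trans ?_
  have h2 : (covMatrix p v K).det ≤ (((Fintype.card ι : ℝ) + K) ^ 2) ^ Fintype.card ι :=
    (det_le_trace_pow (posDef_covMatrix hp v K).posSemidef).trans
      (pow_le_pow_left₀ (posDef_covMatrix hp v K).posSemidef.trace_nonneg
        (trace_covMatrix_le hp v hv K) _)
  refine (Real.log_le_log (det_covMatrix_pos hp v K) h2).trans (le_of_eq ?_)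
  rw [Real.log_pow, Real.log_pow]
  push_cast
  ring

/-- If at every step the current error functionals have a small total error on the past
distributions, then the total of the current errors on the current distributions is larger only by
a factor that is logarithmic in the number of steps. -/
theorem sum_error_le_of_past_error_le [Nonempty ι] {J : Type*} [Fintype J]
    (hv : ∀ k, ∑ i, p k i * ∑ s, |v i s| ≤ 1) (w : ℕ → J → ι → ℝ) {K : ℕ} (hK : 0 < K) {W ζ : ℝ}
    (hW : ∀ k < K, ∑ j, ∑ s, |w k j s| ≤ W)
    (hζ : ∀ k < K, ∑ l ∈ Finset.range k, ∑ i, p l i * ∑ j, |w k j ⬝ᵥ v i| ≤ ζ) :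
    ∑ k ∈ Finset.range K, ∑ i, p k i * ∑ j, |w k j ⬝ᵥ v i| ≤
      4 * Fintype.card ι * Real.log (Fintype.card ι + K) * (2 * W + ζ) := by
  set φ : ℕ → ℝ := fun k => ∑ i, p k i * dualNorm (covMatrix p v k) (v i) with hφ
  have hφ0 : ∀ k, 0 ≤ φ k := fun k =>
    Finset.sum_nonneg fun i _ => mul_nonneg (hp k i) (dualNorm_nonneg _ _)
  have main : ∀ k < K, ∑ i, p k i * ∑ j, |w k j ⬝ᵥ v i| ≤
      2 * (2 * W + ζ) * Real.log (1 + φ k) := by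
    intro k hk
    have hW0 : 0 ≤ W := le_trans (Finset.sum_nonneg fun j _ => Finset.sum_nonneg fun s _ =>
      abs_nonneg _) (hW k hk)
    have hζ0 : 0 ≤ ζ := le_trans (Finset.sum_nonneg fun l _ => Finset.sum_nonneg fun i _ =>
      mul_nonneg (hp l i) (Finset.sum_nonneg fun j _ => abs_nonneg _)) (hζ k hk)
    have hM := posDef_covMatrix hp v k
    have hlog0 : 0 ≤ Real.log (1 + φ k) := Real.log_nonneg (by linarith [hφ0 k])
    rcases le_total (φ k) 1 with h1 | h1
    · have e1 : ∑ i, p k i * ∑ j, |w k j ⬝ᵥ v i| ≤ (W + ζ) * φ k := by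
        calc _ ≤ ∑ i, p k i * ∑ j, √(w k j ⬝ᵥ covMatrix p v k *ᵥ w k j) *
              dualNorm (covMatrix p v k) (v i) :=
              Finset.sum_le_sum fun i _ => mul_le_mul_of_nonneg_left
                (Finset.sum_le_sum fun j _ => abs_dotProduct_le_sqrt_mul_sqrt hM _ _) (hp k i)
          _ = (∑ j, √(w k j ⬝ᵥ covMatrix p v k *ᵥ w k j)) * φ k := by
              rw [hφ, Finset.mul_sum]
              refine Finset.sum_congr rfl fun i _ => ?_
              rw [← Finset.sum_mul]; ring
          _ ≤ (W + ζ) * φ k := by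
              refine mul_le_mul_of_nonneg_right ?_ (hφ0 k)
              refine (Finset.sum_le_sum fun j _ =>
                sqrt_quad_covMatrix_le hp v (w k j) k).trans ?_
              rw [Finset.sum_add_distrib]
              refine add_le_add (hW k hk) (le_trans (le_of_eq ?_) (hζ k hk))
              rw [Finset.sum_comm]
              refine Finset.sum_congr rfl fun l _ => ?_
              rw [Finset.sum_comm]
              exact Finset.sum_congr rfl fun i _ => (Finset.mul_sum _ _ _).symm
      -- `x ≤ 2 log (1 + x)` for `0 ≤ x ≤ 1`
      have e2 : φ k ≤ 2 * Real.log (1 + φ k) := by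
        have := Real.one_sub_inv_le_log_of_pos (show 0 < 1 + φ k by linarith [hφ0 k])
        have h3 : φ k / 2 ≤ 1 - (1 + φ k)⁻¹ := by
          have hpos : 0 < 1 + φ k := by linarith [hφ0 k]
          rw [div_le_iff₀ two_pos, ← sub_nonneg]
          have : (1 - (1 + φ k)⁻¹) * 2 - φ k = φ k * (1 - φ k) / (1 + φ k) := by
            field_simp; ring
          rw [this]
          exact div_nonneg (mul_nonneg (hφ0 k) (by linarith)) hpos.le
        linarith
      nlinarith
    -- if `φ k ≥ 1`, the trivial bound `W` suffices, as `1 ≤ 2 log (1 + φ k)`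
    · have e1 : ∑ i, p k i * ∑ j, |w k j ⬝ᵥ v i| ≤ W := by
        calc _ ≤ ∑ i, p k i * (W * ∑ s, |v i s|) := by
              refine Finset.sum_le_sum fun i _ => mul_le_mul_of_nonneg_left ?_ (hp k i)
              refine le_trans (Finset.sum_le_sum fun j _ => ?_)
                (le_trans (le_of_eq (Finset.sum_mul Finset.univ
                  (fun j => ∑ s, |w k j s|) (∑ s, |v i s|)).symm)
                  (mul_le_mul_of_nonneg_right (hW k hk)
                    (Finset.sum_nonneg fun s _ => abs_nonneg _)))
              refine (Finset.abs_sum_le_sum_abs _ _).trans ?_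
              rw [Finset.sum_mul]
              refine Finset.sum_le_sum fun s _ => ?_
              rw [abs_mul]
              exact mul_le_mul_of_nonneg_left (Finset.single_le_sum
                (f := fun s => |v i s|) (fun s _ => abs_nonneg _) (Finset.mem_univ s))
                (abs_nonneg _)
          _ = W * ∑ i, p k i * ∑ s, |v i s| := by
              rw [Finset.mul_sum]; exact Finset.sum_congr rfl fun i _ => by ring
          _ ≤ W * 1 := mul_le_mul_of_nonneg_left (hv k) hW0
          _ = W := mul_one W
      have e2 : (1 : ℝ) / 2 ≤ Real.log (1 + φ k) := by
        have := Real.log_two_gt_d9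
        have h2 := Real.log_le_log two_pos (show (2 : ℝ) ≤ 1 + φ k by linarith)
        linarith
      nlinarith
  have hW0 : 0 ≤ W := le_trans (Finset.sum_nonneg fun j _ => Finset.sum_nonneg fun s _ =>
    abs_nonneg _) (hW 0 hK)
  have hζ0 : 0 ≤ ζ := le_trans (Finset.sum_nonneg fun l _ => Finset.sum_nonneg fun i _ =>
    mul_nonneg (hp l i) (Finset.sum_nonneg fun j _ => abs_nonneg _)) (hζ 0 hK)
  calc _ ≤ ∑ k ∈ Finset.range K, 2 * (2 * W + ζ) * Real.log (1 + φ k) :=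
        Finset.sum_le_sum fun k hk => main k (Finset.mem_range.mp hk)
    _ = 2 * (2 * W + ζ) * ∑ k ∈ Finset.range K, Real.log (1 + φ k) := by rw [Finset.mul_sum]
    _ ≤ 2 * (2 * W + ζ) * (2 * Fintype.card ι * Real.log (Fintype.card ι + K)) :=
        mul_le_mul_of_nonneg_left (sum_log_one_add_le hp v hv K) (by linarith)
    _ = _ := by ring

end Sequence

end Potential

/-! ### Weakly-revealing models -/

theorem POMDP.weight_eq_zero_iff (f : POMDP S O A) (τ : List (O × A)) :
    f.weight τ = 0 ↔ f.belief τ = 0 := by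
  rw [f.weight_eq_sum_belief, Finset.sum_eq_zero_iff_of_nonneg fun s _ => f.belief_nonneg τ s]
  simp [funext_iff]

/-- The normalized belief after `τ`; it is `0` if `τ` is unreachable. -/
def POMDP.normBelief (f : POMDP S O A) (τ : List (O × A)) : S → ℝ := (f.weight τ)⁻¹ • f.belief τ

theorem POMDP.weight_smul_normBelief (f : POMDP S O A) (τ : List (O × A)) :
    f.weight τ • f.normBelief τ = f.belief τ := by
  rcases eq_or_ne (f.weight τ) 0 with h | h
  · rw [h, zero_smul, (f.weight_eq_zero_iff τ).mp h]
  · rw [POMDP.normBelief, smul_inv_smul₀ h]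

theorem POMDP.sum_abs_normBelief_le (f : POMDP S O A) (τ : List (O × A)) :
    ∑ s, |f.normBelief τ s| ≤ 1 := by
  have h0 := f.weight_nonneg τ
  have : ∑ s, |f.normBelief τ s| = (f.weight τ)⁻¹ * f.weight τ := by
    rw [f.weight_eq_sum_belief, Finset.mul_sum, ← f.weight_eq_sum_belief]
    refine Finset.sum_congr rfl fun s _ => ?_
    exact abs_of_nonneg (mul_nonneg (inv_nonneg.mpr h0) (f.belief_nonneg τ s))
  rw [this]
  exact inv_mul_le_one

theorem POMDP.testProb_eq_predict (f : POMDP S O A) {n : ℕ} (τ : List (O × A))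
    (p : Fin n → O × A) (o : O) :
    f.testProb τ (List.ofFn p) o = f.predict τ.length n (f.normBelief τ) (p, o) := by
  rw [POMDP.testProb, f.futureWeight_append, zero_add, POMDP.normBelief, map_smul, div_eq_inv_mul]
  rfl

theorem POMDP.predict_eq_sum (f : POMDP S O A) (h n : ℕ) (b : S → ℝ) (t : Future O A n) :
    f.predict h n b t =
      ∑ s, (open Classical in f.futureWeight h (Pi.single s 1) (List.ofFn t.1) t.2) * b s := by
  classical
  rw [(f.predict h n).pi_apply_eq_sum_univ b]
  simp only [Finset.sum_apply, Pi.smul_apply, smul_eq_mul]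
  refine Finset.sum_congr rfl fun s _ => ?_
  rw [mul_comm, POMDP.predict_apply]
  congr 2
  ext s'
  simp [Pi.single_apply, eq_comm]

/-- The test weights from the individual latent states. -/
def POMDP.stateTests (f : POMDP S O A) (H h : ℕ) : Matrix (Test O A H h) S ℝ :=
  open Classical in
  Matrix.of fun t s => f.futureWeight h (Pi.single s 1) (List.ofFn t.2.1) t.2.2

/-- The matrix whose columns are the normalized beliefs. -/
def POMDP.beliefMatrix (f : POMDP S O A) (h : ℕ) : Matrix S (Fin h → O × A) ℝ :=
  Matrix.of fun s τ => f.normBelief (List.ofFn τ) s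

theorem POMDP.dynMatrix_eq_mul (f : POMDP S O A) (H h : ℕ) :
    f.dynMatrix H h = f.stateTests H h * f.beliefMatrix h := by
  ext t τ
  rw [Matrix.mul_apply, POMDP.dynMatrix, Matrix.of_apply, f.testProb_eq_predict, f.predict_eq_sum]
  simp [POMDP.stateTests, POMDP.beliefMatrix]

theorem POMDP.psrRankAt_le_card (f : POMDP S O A) (H h : ℕ) :
    f.psrRankAt H h ≤ Fintype.card S := by
  rw [POMDP.psrRankAt, f.dynMatrix_eq_mul]
  exact (Matrix.rank_mul_le_left _ _).trans (Matrix.rank_le_card_width _)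

theorem POMDP.psrRank_le_card (f : POMDP S O A) (H : ℕ) : f.psrRank H ≤ Fintype.card S :=
  Finset.sup_le fun h _ => f.psrRankAt_le_card H h

/-- Multiplication from the left by a matrix of full column rank does not change the rank. -/
theorem rank_le_rank_mul_of_rank_eq_card {ι κ ν : Type*} [Fintype ι] [Fintype κ] [Fintype ν]
    (E : Matrix ι κ ℝ) (hE : E.rank = Fintype.card κ) (B : Matrix κ ν ℝ) :
    B.rank ≤ (E * B).rank := by
  classical
  have hU : IsUnit (Eᵀ * E) := by
    have hr : (Eᵀ * E).rank = Fintype.card κ := by rw [Matrix.rank_transpose_mul_self, hE]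
    rw [← Matrix.mulVec_surjective_iff_isUnit]
    have htop : LinearMap.range (Eᵀ * E).mulVecLin = ⊤ := by
      apply Submodule.eq_top_of_finrank_eq
      rw [Module.finrank_fintype_fun_eq_card]
      exact hr
    exact LinearMap.range_eq_top.mp htop
  have := Matrix.rank_mul_le_right Eᵀ (E * B)
  rwa [← Matrix.mul_assoc, Matrix.rank_mul_eq_right_of_isUnit_det _ _
    ((Matrix.isUnit_iff_isUnit_det _).mp hU)] at this

section FutureEquiv

variable {H h m : ℕ}

/-- The `m`-step futures, as tests after histories of length `h`. -/
def futureToTest (O A : Type*) [Fintype O] [Fintype A] (hm : 1 ≤ m) (hh : m ≤ H - h)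
    (t : Future O A (m - 1)) : mStepFutures O A H h m :=
  ⟨⟨⟨m - 1, by omega⟩, t⟩, by simp [mStepFutures]; omega⟩

theorem futureToTest_bijective (hm : 1 ≤ m) (hh : m ≤ H - h) :
    Function.Bijective (futureToTest (H := H) (h := h) O A hm hh) := by
  constructor
  · intro t t' htt
    simpa [futureToTest] using htt
  · rintro ⟨⟨⟨W, hW⟩, t⟩, ht⟩
    have hWm : W + 1 = m := by simpa [mStepFutures] using ht
    subst hWm
    exact ⟨t, rfl⟩

/-- The `m`-step futures are the tests in `mStepFutures`. -/
def futureEquivTest (O A : Type*) [Fintype O] [Fintype A] (hm : 1 ≤ m) (hh : m ≤ H - h) :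
    Future O A (m - 1) ≃ mStepFutures O A H h m :=
  Equiv.ofBijective _ (futureToTest_bijective hm hh)

end FutureEquiv

theorem POMDP.IsWeaklyRevealing.isCoreTestSet {f : POMDP S O A} {H m : ℕ} (hm : 1 ≤ m)
    (hmH : m ≤ H) (hf : f.IsWeaklyRevealing H m) {h : ℕ} (hh : h ≤ H - m) :
    f.IsCoreTestSet H h (mStepFutures O A H h m) := by
  have hh' : m ≤ H - h := by omega
  apply le_antisymm
  · exact Matrix.rank_submatrix_le _ _ _
  · have h1 : (f.predMatrix H h (mStepFutures O A H h m)).submatrix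
        (futureEquivTest O A hm hh') id = f.emissionMatrix h m * f.beliefMatrix h := by
      rw [POMDP.predMatrix, f.dynMatrix_eq_mul]
      rfl
    calc f.psrRankAt H h ≤ (f.beliefMatrix h).rank := by
          rw [POMDP.psrRankAt, f.dynMatrix_eq_mul]
          exact Matrix.rank_mul_le_right _ _
      _ ≤ (f.emissionMatrix h m * f.beliefMatrix h).rank :=
          rank_le_rank_mul_of_rank_eq_card _ (hf h hh) _
      _ ≤ (f.predMatrix H h (mStepFutures O A H h m)).rank := by
          rw [← h1]
          exact Matrix.rank_submatrix_le _ _ _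

/-! ### Virtual beliefs of a regular model -/

/-- The span of the beliefs after the histories of length `h`. -/
def POMDP.beliefSpan (f : POMDP S O A) (h : ℕ) : Submodule ℝ (S → ℝ) :=
  Submodule.span ℝ {b | ∃ τ : List (O × A), τ.length = h ∧ f.belief τ = b}

theorem POMDP.belief_mem_beliefSpan (f : POMDP S O A) (τ : List (O × A)) :
    f.belief τ ∈ f.beliefSpan τ.length :=
  Submodule.subset_span ⟨τ, rfl, rfl⟩

theorem POMDP.beliefStep_mem_beliefSpan (f : POMDP S O A) {h : ℕ} (x : O × A) {b : S → ℝ}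
    (hb : b ∈ f.beliefSpan h) : f.beliefStep h x b ∈ f.beliefSpan (h + 1) := by
  have : f.beliefSpan h ≤ (f.beliefSpan (h + 1)).comap (f.evolveLin h [x]) := by
    rw [POMDP.beliefSpan, Submodule.span_le]
    rintro _ ⟨τ, rfl, rfl⟩
    have := f.belief_mem_beliefSpan (τ ++ [x])
    rw [f.belief_snoc, List.length_append] at this
    exact this
  exact this hb

/-- The rows of a set of tests whose rank is the full rank span all the rows. -/
theorem POMDP.IsCoreTestSet.exists_row_eq {f : POMDP S O A} {H h : ℕ}
    {U : Finset (Test O A H h)} (hU : f.IsCoreTestSet H h U) (t : Test O A H h) :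
    ∃ c : U → ℝ, ∀ τ, f.dynMatrix H h t τ = ∑ u, c u * f.predMatrix H h U u τ := by
  have hle : Submodule.span ℝ (Set.range (f.predMatrix H h U).row) ≤
      Submodule.span ℝ (Set.range (f.dynMatrix H h).row) := by
    refine Submodule.span_mono ?_
    rintro _ ⟨u, rfl⟩
    exact ⟨u, rfl⟩
  have heq := Submodule.eq_of_le_of_finrank_eq hle (by
    rw [← Matrix.rank_eq_finrank_span_row, ← Matrix.rank_eq_finrank_span_row]; exact hU)
  have hmem : (f.dynMatrix H h).row t ∈
      Submodule.span ℝ (Set.range (f.predMatrix H h U).row) := by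
    rw [heq]; exact Submodule.subset_span ⟨t, rfl⟩
  obtain ⟨c, hc⟩ := (Submodule.mem_span_range_iff_exists_fun ℝ).mp hmem
  refine ⟨c, fun τ => ?_⟩
  have := congrFun hc τ
  simpa [Matrix.row] using this.symm

/-- `Φ` turns predictions for the `m`-step futures at step `h` into (signed) beliefs of the model `f`,
with `ℓ¹` operator norm at most `C`, such that beliefs are replaced by beliefs with the same
predictions for all tests that fit into the episode. -/
structure IsVirtualBelief (f : POMDP S O A) (H m h : ℕ) (C : ℝ)
    (Φ : (Future O A (m - 1) → ℝ) →ₗ[ℝ] (S → ℝ)) : Prop where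
  norm_le : ∀ v, ∑ s, |Φ v s| ≤ C * ∑ t, |v t|
  mem : ∀ v, Φ v ∈ f.beliefSpan h
  predict_eq : ∀ n < H - h, ∀ b ∈ f.beliefSpan h,
    f.predict h n (Φ (f.predict h (m - 1) b)) = f.predict h n b

/-- In a regular model, the predictions for the `m`-step futures can be turned into a (signed)
belief that has the same predictions for all tests. The belief is a combination of the beliefs at
the core histories with the coefficients `K† q`, so its `ℓ¹` norm is controlled by `‖K†‖`. -/
theorem POMDP.exists_virtualBelief (f : POMDP S O A) {H m h : ℕ} (hm : 1 ≤ m) (hmH : m ≤ H)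
    (hh : h ≤ H - m) (hU : f.IsCoreTestSet H h (mStepFutures O A H h m)) {α : ℝ}
    (hreg : f.IsRegularAt H h (mStepFutures O A H h m) α) :
    ∃ Φ, IsVirtualBelief f H m h (1 / α) Φ := by
  have hh' : m ≤ H - h := by omega
  obtain ⟨c, hc, X, hX, hXα⟩ := hreg
  set e := futureEquivTest O A hm hh' with he
  set β : Fin (f.psrRankAt H h) → S → ℝ := fun i => f.normBelief (List.ofFn (c i)) with hβ
  let Φ : (Future O A (m - 1) → ℝ) →ₗ[ℝ] (S → ℝ) :=
    { toFun := fun v => ∑ i, (X *ᵥ fun u => v (e.symm u)) i • β i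
      map_add' := fun v w => by
        rw [← Finset.sum_add_distrib]
        refine Finset.sum_congr rfl fun i _ => ?_
        rw [← add_smul, ← Pi.add_apply, ← Matrix.mulVec_add]
        rfl
      map_smul' := fun r v => by
        rw [RingHom.id_apply, Finset.smul_sum]
        refine Finset.sum_congr rfl fun i _ => ?_
        have : (fun u => (r • v) (e.symm u)) = r • fun u => v (e.symm u) := rfl
        rw [this, Matrix.mulVec_smul, Pi.smul_apply, smul_assoc] }
  have hΦ : ∀ v, Φ v = ∑ i, (X *ᵥ fun u => v (e.symm u)) i • β i := fun v => rfl
  refine ⟨Φ, fun v => ?_, fun v => ?_, fun n hn => ?_⟩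
  · calc ∑ s, |Φ v s| ≤ ∑ s, ∑ i, |(X *ᵥ fun u => v (e.symm u)) i| * |β i s| := by
          refine Finset.sum_le_sum fun s _ => ?_
          rw [hΦ, Finset.sum_apply]
          refine (Finset.abs_sum_le_sum_abs _ _).trans (le_of_eq ?_)
          simp [abs_mul]
      _ = ∑ i, |(X *ᵥ fun u => v (e.symm u)) i| * ∑ s, |β i s| := by
          rw [Finset.sum_comm]
          simp [Finset.mul_sum]
      _ ≤ ∑ i, |(X *ᵥ fun u => v (e.symm u)) i| * 1 :=
          Finset.sum_le_sum fun i _ =>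
            mul_le_mul_of_nonneg_left (f.sum_abs_normBelief_le _) (abs_nonneg _)
      _ ≤ 1 / α * ∑ u, |v (e.symm u)| := by simpa using hXα fun u => v (e.symm u)
      _ = 1 / α * ∑ t, |v t| := by rw [e.symm.sum_comp (fun t => |v t|)]
  · rw [hΦ]
    refine Submodule.sum_mem _ fun i _ => Submodule.smul_mem _ _ (Submodule.smul_mem _ _ ?_)
    simpa using f.belief_mem_beliefSpan (List.ofFn (c i))
  · have key : Set.EqOn ((f.predict h n).comp (Φ.comp (f.predict h (m - 1)))) (f.predict h n)
        {b | ∃ τ : List (O × A), τ.length = h ∧ f.belief τ = b} := by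
      rintro _ ⟨τ, rfl, rfl⟩
      -- the predictive state of `τ` is `K K†` applied to itself
      set q : mStepFutures O A H τ.length m → ℝ :=
        fun u => f.predMatrix H τ.length _ u τ.get with hq
      have hKX : f.coreMatrix H τ.length _ c *ᵥ (X *ᵥ q) = q := by
        obtain ⟨v, hv⟩ := hc τ.get
        rw [← hq] at hv
        rw [hv, Matrix.mulVec_mulVec, Matrix.mulVec_mulVec, hX.mul_mul_left]
      have hqe : (fun u => f.predict τ.length (m - 1) (f.belief τ) (e.symm u)) =
          f.weight τ • q := by
        ext u
        obtain ⟨t, rfl⟩ := e.surjective u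
        have : q (e t) = f.testProb (List.ofFn τ.get) (List.ofFn t.1) t.2 := rfl
        rw [e.symm_apply_apply, Pi.smul_apply, this, f.testProb_eq_predict, List.ofFn_get,
          ← f.weight_smul_normBelief τ, map_smul]
        rfl
      ext t
      set T : Test O A H τ.length := ⟨⟨n, hn⟩, t⟩ with hT
      obtain ⟨r, hr⟩ := hU.exists_row_eq T
      have hrow : ∀ σ : Fin τ.length → O × A, f.dynMatrix H τ.length T σ =
          f.predict τ.length n (f.normBelief (List.ofFn σ)) t := by
        intro σ
        have : f.dynMatrix H τ.length T σ = f.testProb (List.ofFn σ) (List.ofFn t.1) t.2 := rfl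
        rw [this, f.testProb_eq_predict, List.length_ofFn]
      have h1 : f.predict τ.length n (f.normBelief τ) t =
          ∑ i, (X *ᵥ q) i * f.predict τ.length n (β i) t := by
        have h2 := hrow τ.get
        rw [List.ofFn_get] at h2
        rw [← h2, hr]
        calc ∑ u, r u * q u
            = ∑ u, r u * ∑ i, f.predMatrix H τ.length _ u (c i) * (X *ᵥ q) i := by
              conv_lhs => rw [← hKX]
              rfl
          _ = ∑ i, (X *ᵥ q) i * ∑ u, r u * f.predMatrix H τ.length _ u (c i) := by
              simp only [Finset.mul_sum]
              rw [Finset.sum_comm]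
              exact Finset.sum_congr rfl fun i _ => Finset.sum_congr rfl fun u _ => by ring
          _ = _ := by
              refine Finset.sum_congr rfl fun i _ => ?_
              rw [← hr, hrow]
      rw [LinearMap.comp_apply, LinearMap.comp_apply, hΦ, hqe, Matrix.mulVec_smul, map_sum,
        Finset.sum_apply]
      conv_rhs => rw [← f.weight_smul_normBelief τ, map_smul, Pi.smul_apply, h1]
      rw [smul_eq_mul, Finset.mul_sum]
      refine Finset.sum_congr rfl fun i _ => ?_
      rw [map_smul]
      simp [mul_assoc]
    intro b hb
    exact LinearMap.eqOn_span key hb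

/-! ### Decomposition of the trajectory distance -/

theorem POMDP.predict_beliefStep (f : POMDP S O A) (h n : ℕ) (x : O × A) (b : S → ℝ)
    (t : Future O A n) :
    f.predict (h + 1) n (f.beliefStep h x b) t =
      f.predict h (n + 1) b (Fin.cons x t.1, t.2) := by
  rw [POMDP.predict_apply, POMDP.predict_apply, List.ofFn_cons]
  exact (f.futureWeight_append h b [x] (List.ofFn t.1) t.2).symm

theorem POMDP.listWeight_eq_of_predict_eq (f : POMDP S O A) {h n : ℕ} {b b' : S → ℝ}
    (hb : f.predict h n b = f.predict h n b') {l : List (O × A)} (hl : l.length = n + 1) :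
    f.listWeight h l b = f.listWeight h l b' := by
  obtain ⟨p, x, rfl⟩ : ∃ p x, l = p ++ [x] :=
    ⟨l.dropLast, l.getLast (List.ne_nil_of_length_eq_add_one hl),
      (List.dropLast_append_getLast _).symm⟩
  have hp : p.length = n := by simpa using hl
  subst hp
  have := congrFun hb (p.get, x.1)
  simp only [POMDP.predict_apply, List.ofFn_get] at this
  rw [← Prod.mk.eta (p := x), f.listWeight_snoc, f.listWeight_snoc, this]

section Decomposition

variable (fstar f : POMDP S O A) {H m : ℕ}

/-- The error of one step of the predictive state update: the predictions of the true model after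
the pair `x`, minus those of the model `f` that starts from the virtual belief. -/
def transitionError (h n : ℕ) (Φ : (Future O A n → ℝ) →ₗ[ℝ] (S → ℝ)) (x : O × A) :
    (S → ℝ) →ₗ[ℝ] (Future O A n → ℝ) :=
  (fstar.predict (h + 1) n).comp (fstar.evolveLin h [x]) -
    (f.predict (h + 1) n).comp ((f.evolveLin h [x]).comp (Φ.comp (fstar.predict h n)))

/-- The total `ℓ¹` error of the predictive state update at a belief of the true model. -/
def stepError (h n : ℕ) (Φ : (Future O A n → ℝ) →ₗ[ℝ] (S → ℝ)) (b : S → ℝ) : ℝ :=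
  ∑ x, ∑ t, |transitionError fstar f h n Φ x b t|

theorem transitionError_apply (h n : ℕ) (Φ : (Future O A n → ℝ) →ₗ[ℝ] (S → ℝ)) (x : O × A)
    (b : S → ℝ) : transitionError fstar f h n Φ x b =
      fstar.predict (h + 1) n (fstar.beliefStep h x b) -
        f.predict (h + 1) n (f.beliefStep h x (Φ (fstar.predict h n b))) := rfl

theorem listSum_seqProb_mul_abs_le_sum_predict (π : Policy O A) (h n : ℕ) (τ : List (O × A))
    (b b' : S → ℝ) :
    listSum (n + 1) (fun l => π.seqProb τ l * |fstar.listWeight h l b - f.listWeight h l b'|) ≤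
      ∑ t, |fstar.predict h n b t - f.predict h n b' t| := by
  simp only [POMDP.predict_apply]
  rw [sum_future_eq (fun p o => |fstar.futureWeight h b p o - f.futureWeight h b' p o|),
    listSum_snoc]
  refine listSum_le_listSum fun p _ => ?_
  rw [Fintype.sum_prod_type]
  refine Finset.sum_le_sum fun o _ => ?_
  simp only [π.seqProb_append, π.seqProb_singleton, POMDP.listWeight_snoc]
  rw [← Finset.sum_mul, ← Finset.mul_sum, π.prob_sum, mul_one]
  refine mul_le_of_le_one_left (abs_nonneg _) ?_
  have : ∀ (l τ : List (O × A)), π.seqProb τ l ≤ 1 := by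
    intro l
    induction l with
    | nil => intro τ; exact le_rfl
    | cons x l ih =>
      intro τ
      exact mul_le_one₀ (π.prob_le_one _ _ _) (π.seqProb_nonneg _ _) (ih _)
  exact this _ _

/-- A telescoping bound: the distance of the laws of the continuations of a history is at most the
distance of the current predictions plus the expected errors of the later updates. -/
theorem listSum_abs_listWeight_sub_le {C : ℝ} (hC : 0 ≤ C) (hm : 1 ≤ m)
    (Φ : ℕ → (Future O A (m - 1) → ℝ) →ₗ[ℝ] (S → ℝ))
    (hΦ : ∀ h, h + m ≤ H → IsVirtualBelief f H m h C (Φ h)) (π : Policy O A) (k h : ℕ)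
    (hk : h + k + m = H) (τ : List (O × A)) (hτ : τ.length = h) (b : S → ℝ)
    (hb : b ∈ f.beliefSpan h) :
    listSum (k + m) (fun l => π.seqProb τ l *
        |fstar.listWeight h l (fstar.belief τ) - f.listWeight h l b|) ≤
      (1 + C) * (∑ t, |fstar.predict h (m - 1) (fstar.belief τ) t - f.predict h (m - 1) b t| +
        ∑ j ∈ Finset.range k, listSum j (fun l => π.seqProb τ l *
          stepError fstar f (h + j) (m - 1) (Φ (h + j)) (fstar.belief (τ ++ l)))) := by
  induction k generalizing h τ b with
  | zero =>
    obtain ⟨n, rfl⟩ : ∃ n, m = n + 1 := ⟨m - 1, by omega⟩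
    have h1 := listSum_seqProb_mul_abs_le_sum_predict fstar f π h n τ (fstar.belief τ) b
    have h0 : 0 ≤ ∑ t, |fstar.predict h n (fstar.belief τ) t - f.predict h n b t| :=
      Finset.sum_nonneg fun _ _ => abs_nonneg _
    simp only [zero_add, Finset.range_zero, Finset.sum_empty, add_zero]
    exact h1.trans (le_mul_of_one_le_left h0 (by linarith))
  | succ k ih =>
    -- `b` may be replaced by `Φ u`, which differs from `Φ v` by at most `C ∑ |v - u|`; from `Φ v` the
    -- update by one step is compared with the true update, and the induction hypothesis applies
    have hΦh := hΦ h (by omega)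
    set v := fstar.predict h (m - 1) (fstar.belief τ) with hv
    set u := f.predict h (m - 1) b with hu
    set d := ∑ t, |v t - u t| with hd
    have h2 : listSum (k + 1 + m) (fun l => π.seqProb τ l * |f.listWeight h l (Φ h (v - u))|) ≤
        C * d :=
      (f.listSum_seqProb_mul_abs_listWeight_le π _ h τ _).trans (hΦh.norm_le _)
    have h1 : listSum (k + 1 + m) (fun l => π.seqProb τ l *
        |fstar.listWeight h l (fstar.belief τ) - f.listWeight h l (Φ h v)|) ≤
        (1 + C) * ∑ j ∈ Finset.range (k + 1), listSum j (fun l => π.seqProb τ l *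
          stepError fstar f (h + j) (m - 1) (Φ (h + j)) (fstar.belief (τ ++ l))) := by
      rw [show k + 1 + m = k + m + 1 by omega, listSum_succ]
      have hx : ∀ x : O × A, listSum (k + m) (fun l => π.seqProb τ (x :: l) *
          |fstar.listWeight h (x :: l) (fstar.belief τ) - f.listWeight h (x :: l) (Φ h v)|) ≤
          π.prob τ x.1 x.2 * ((1 + C) *
            (∑ t, |transitionError fstar f h (m - 1) (Φ h) x (fstar.belief τ) t| +
            ∑ j ∈ Finset.range k, listSum j (fun l => π.seqProb (τ ++ [x]) l *
              stepError fstar f (h + 1 + j) (m - 1) (Φ (h + 1 + j))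
                (fstar.belief (τ ++ [x] ++ l))))) := by
        intro x
        have := ih (h + 1) (by omega) (τ ++ [x]) (by simp [hτ]) (f.beliefStep h x (Φ h v))
          (f.beliefStep_mem_beliefSpan x (hΦh.mem v))
        simp only [Policy.seqProb, mul_assoc, listSum_mul_left]
        refine mul_le_mul_of_nonneg_left ?_ (π.prob_nonneg _ _ _)
        have hbel : fstar.belief (τ ++ [x]) = fstar.beliefStep h x (fstar.belief τ) := by
          rw [fstar.belief_snoc, hτ]
        rw [hbel] at this
        exact this
      refine (Finset.sum_le_sum fun x _ => hx x).trans ?_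
      have hfirst : ∑ x : O × A, π.prob τ x.1 x.2 *
          ∑ t, |transitionError fstar f h (m - 1) (Φ h) x (fstar.belief τ) t| ≤
          listSum 0 (fun l => π.seqProb τ l *
            stepError fstar f (h + 0) (m - 1) (Φ (h + 0)) (fstar.belief (τ ++ l))) := by
        simp only [listSum_zero, Policy.seqProb, one_mul, add_zero, List.append_nil, stepError]
        exact Finset.sum_le_sum fun x _ => mul_le_of_le_one_left
          (Finset.sum_nonneg fun _ _ => abs_nonneg _) (π.prob_le_one _ _ _)
      have hrest : ∀ j, ∑ x : O × A, π.prob τ x.1 x.2 * listSum j (fun l =>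
          π.seqProb (τ ++ [x]) l * stepError fstar f (h + 1 + j) (m - 1) (Φ (h + 1 + j))
            (fstar.belief (τ ++ [x] ++ l))) =
          listSum (j + 1) (fun l => π.seqProb τ l *
            stepError fstar f (h + (j + 1)) (m - 1) (Φ (h + (j + 1)))
              (fstar.belief (τ ++ l))) := by
        intro j
        rw [listSum_succ]
        refine Finset.sum_congr rfl fun x _ => ?_
        rw [← listSum_mul_left, show h + 1 + j = h + (j + 1) by omega]
        refine listSum_congr fun l _ => ?_
        rw [Policy.seqProb, List.append_assoc, List.singleton_append, mul_assoc]
      rw [Finset.sum_range_succ']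
      calc _ = (1 + C) * (∑ x : O × A, π.prob τ x.1 x.2 *
              ∑ t, |transitionError fstar f h (m - 1) (Φ h) x (fstar.belief τ) t| +
            ∑ j ∈ Finset.range k, ∑ x : O × A, π.prob τ x.1 x.2 * listSum j (fun l =>
              π.seqProb (τ ++ [x]) l * stepError fstar f (h + 1 + j) (m - 1) (Φ (h + 1 + j))
                (fstar.belief (τ ++ [x] ++ l)))) := by
            rw [Finset.sum_comm, ← Finset.sum_add_distrib, Finset.mul_sum]
            refine Finset.sum_congr rfl fun x _ => ?_
            rw [← Finset.mul_sum]
            ring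
        _ ≤ _ := by
            rw [add_comm (∑ j ∈ Finset.range k, _)]
            refine mul_le_mul_of_nonneg_left ?_ (by linarith)
            refine add_le_add hfirst (le_of_eq ?_)
            exact Finset.sum_congr rfl fun j _ => hrest j
    have htri : listSum (k + 1 + m) (fun l => π.seqProb τ l *
        |fstar.listWeight h l (fstar.belief τ) - f.listWeight h l b|) ≤
        listSum (k + 1 + m) (fun l => π.seqProb τ l *
          |fstar.listWeight h l (fstar.belief τ) - f.listWeight h l (Φ h v)|) +
        listSum (k + 1 + m) (fun l => π.seqProb τ l * |f.listWeight h l (Φ h (v - u))|) := by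
      rw [← listSum_add]
      refine listSum_le_listSum fun l hl => ?_
      rw [← mul_add]
      refine mul_le_mul_of_nonneg_left ?_ (π.seqProb_nonneg _ _)
      have hlen : l.length = (k + m) + 1 := by omega
      have hbb := f.listWeight_eq_of_predict_eq (hΦh.predict_eq (k + m) (by omega) b hb) hlen
      rw [← hbb, map_sub, f.listWeight_sub]
      exact abs_sub_le _ _ _
    have hd0 : 0 ≤ d := Finset.sum_nonneg fun _ _ => abs_nonneg _
    calc _ ≤ _ := htri
      _ ≤ _ := add_le_add h1 h2
      _ ≤ _ := by nlinarith

theorem POMDP.trajDist_eq_listSum (π : Policy O A) :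
    f.trajDist fstar H π =
      listSum H (fun l => π.seqProb [] l * |f.weight l - fstar.weight l|) := by
  refine Finset.sum_congr rfl fun τ _ => ?_
  rw [f.trajProb_eq, fstar.trajProb_eq, ← mul_sub, abs_mul, abs_of_nonneg (π.seqProb_nonneg _ _)]

/-- The difference of the unnormalized predictive states of two models. -/
def predictDiff (n : ℕ) (τ : List (O × A)) : Future O A n → ℝ :=
  f.predict τ.length n (f.belief τ) - fstar.predict τ.length n (fstar.belief τ)

/-- The decomposition of the distance of the trajectory laws into the initial error and the update
errors, in expectation over the true dynamics. -/
theorem trajDist_le_sum_stepError {C : ℝ} (hC : 0 ≤ C) (hm : 1 ≤ m) (hmH : m ≤ H)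
    (Φ : ℕ → (Future O A (m - 1) → ℝ) →ₗ[ℝ] (S → ℝ))
    (hΦ : ∀ h, h + m ≤ H → IsVirtualBelief f H m h C (Φ h)) (π : Policy O A) :
    f.trajDist fstar H π ≤ (1 + C) * (∑ t, |predictDiff fstar f (m - 1) [] t| +
      ∑ j ∈ Finset.range (H - m), listSum j (fun l => π.seqProb [] l *
        stepError fstar f j (m - 1) (Φ j) (fstar.belief l))) := by
  have h := listSum_abs_listWeight_sub_le fstar f hC hm Φ hΦ π (H - m) 0 (by omega) [] rfl
    (f.belief []) (f.belief_mem_beliefSpan [])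
  rw [POMDP.trajDist_eq_listSum]
  have hH : H - m + m = H := by omega
  rw [hH] at h
  have h2 : ∑ t, |fstar.predict 0 (m - 1) (fstar.belief []) t -
      f.predict 0 (m - 1) (f.belief []) t| = ∑ t, |predictDiff fstar f (m - 1) [] t| :=
    Finset.sum_congr rfl fun t _ => abs_sub_comm _ _
  rw [h2] at h
  simp only [zero_add, List.nil_append] at h
  refine le_trans (le_of_eq (listSum_congr fun l _ => ?_)) h
  rw [abs_sub_comm]
  rfl

/-! ### Exploration controls the update errors -/

section Explore

variable {n : ℕ}

theorem Policy.explore_prob_of_lt (π : Policy O A) {h : ℕ} (u : Fin n → A) {τ : List (O × A)}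
    (hτ : τ.length + 1 < h) (o : O) (a : A) : (π.explore h u).prob τ o a = π.prob τ o a := by
  simp [Policy.explore, hτ]

theorem Policy.explore_prob_uniform (π : Policy O A) {h : ℕ} (u : Fin n → A) {τ : List (O × A)}
    (hτ : τ.length = h) (o : O) (a : A) :
    (π.explore (h + 1) u).prob τ o a = 1 / (Fintype.card A : ℝ) := by
  simp [Policy.explore, hτ]

open Classical in
theorem Policy.explore_prob_test (π : Policy O A) {h : ℕ} (u : Fin n → A) {τ : List (O × A)}
    (i : Fin n) (hτ : τ.length = h + i) (o : O) (a : A) :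
    (π.explore h u).prob τ o a = if a = u i then 1 else 0 := by
  have h1 : ¬ (τ.length + 1 < h) := by omega
  have h2 : h ≤ τ.length ∧ τ.length - h < n := by omega
  have h3 : (⟨τ.length - h, h2.2⟩ : Fin n) = i := by ext; simp [hτ]
  simp only [Policy.explore, if_neg h1, dif_pos h2, h3]

theorem Policy.explore_seqProb_prefix (π : Policy O A) {h : ℕ} (u : Fin n → A)
    (τ l : List (O × A)) (hl : τ.length + l.length = h) :
    (π.explore (h + 1) u).seqProb τ l = π.seqProb τ l := by
  induction l generalizing τ with
  | nil => rfl
  | cons x l ih =>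
    simp only [List.length_cons] at hl
    rw [Policy.seqProb, Policy.seqProb, ih _ (by simp; omega),
      π.explore_prob_of_lt u (by omega)]

open Classical in
theorem Policy.explore_seqProb_test (π : Policy O A) {h : ℕ} (u : Fin n → A) (τ : List (O × A))
    (hτ : τ.length = h) (p : Fin n → O × A) :
    (π.explore h u).seqProb τ (List.ofFn p) = if (fun i => (p i).2) = u then 1 else 0 := by
  rw [← Policy.prod_prob_eq_seqProb]
  have : ∀ i : Fin n, (π.explore h u).prob (τ ++ (List.ofFn p).take i) (p i).1 (p i).2 =
      if (p i).2 = u i then 1 else 0 := by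
    intro i
    exact π.explore_prob_test u i (by simp [hτ]) _ _
  simp only [this, Finset.prod_boole, Finset.mem_univ, true_imp_iff, funext_iff]

theorem weight_sub_weight_eq_predictDiff (τ : List (O × A)) (p : Fin n → O × A) (o : O) (a : A) :
    f.weight (τ ++ (List.ofFn p ++ [(o, a)])) - fstar.weight (τ ++ (List.ofFn p ++ [(o, a)])) =
      predictDiff fstar f n τ (p, o) := by
  rw [f.weight_append, fstar.weight_append, f.listWeight_snoc, fstar.listWeight_snoc]
  rfl

/-- Executing all the action sequences of the tests after `τ` reveals the whole predictive state. -/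
theorem sum_listSum_explore_eq (π : Policy O A) (τ : List (O × A)) {h : ℕ} (hτ : τ.length = h) :
    ∑ u : Fin n → A, listSum (n + 1) (fun l => (π.explore h u).seqProb τ l *
      |f.weight (τ ++ l) - fstar.weight (τ ++ l)|) = ∑ t, |predictDiff fstar f n τ t| := by
  classical
  have h1 : ∀ u : Fin n → A, listSum (n + 1) (fun l => (π.explore h u).seqProb τ l *
      |f.weight (τ ++ l) - fstar.weight (τ ++ l)|) =
      ∑ p : Fin n → O × A, (if (fun i => (p i).2) = u then 1 else 0) *
        ∑ o, |predictDiff fstar f n τ (p, o)| := by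
    intro u
    rw [listSum_snoc]
    refine Finset.sum_congr rfl fun p _ => ?_
    dsimp only
    rw [Fintype.sum_prod_type, Finset.mul_sum]
    refine Finset.sum_congr rfl fun o _ => ?_
    simp only [Policy.seqProb_append, Policy.seqProb_singleton,
      weight_sub_weight_eq_predictDiff fstar f, π.explore_seqProb_test u τ hτ]
    rw [← Finset.sum_mul, ← Finset.mul_sum, Policy.prob_sum, mul_one]
  simp only [h1]
  rw [Finset.sum_comm, Fintype.sum_prod_type]
  refine Finset.sum_congr rfl fun p _ => ?_
  rw [← Finset.sum_mul]
  simp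

/-- The sum of the distances of the trajectory laws of two models under the exploring policies that
are derived from `π`. -/
def exploreDist (H m : ℕ) (π : Policy O A) : ℝ :=
  ∑ j : ExploreIndex A H m, f.trajDist fstar H (π.explore j.1 j.2)

theorem trajDist_nonneg (π : Policy O A) : 0 ≤ f.trajDist fstar H π :=
  Finset.sum_nonneg fun _ _ => abs_nonneg _

theorem sum_trajDist_explore_le {h : ℕ} (hh : h ≤ H - m) (π : Policy O A) :
    ∑ u : Fin (m - 1) → A, f.trajDist fstar H (π.explore h u) ≤ exploreDist fstar f H m π := by
  have h1 : exploreDist fstar f H m π = ∑ i : Fin (H - m + 1), ∑ u : Fin (m - 1) → A,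
      f.trajDist fstar H (π.explore i u) := Fintype.sum_prod_type _
  have h2 : ∀ i ∈ (Finset.univ : Finset (Fin (H - m + 1))), 0 ≤ ∑ u : Fin (m - 1) → A,
      f.trajDist fstar H (π.explore i u) := fun i _ =>
    Finset.sum_nonneg fun u _ => trajDist_nonneg _ _ _
  have h3 := Finset.single_le_sum h2 (Finset.mem_univ (⟨h, by omega⟩ : Fin (H - m + 1)))
  rw [h1]
  exact h3

theorem sum_abs_predictDiff_nil_le (hm : 1 ≤ m) (hmH : m ≤ H) (π : Policy O A) :
    ∑ t, |predictDiff fstar f (m - 1) [] t| ≤ exploreDist fstar f H m π := by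
  refine le_trans ?_ (sum_trajDist_explore_le fstar f (Nat.zero_le _) π)
  rw [← sum_listSum_explore_eq fstar f π [] (h := 0) rfl]
  refine Finset.sum_le_sum fun u _ => ?_
  rw [POMDP.trajDist_eq_listSum]
  exact (f.isConsistent_weight.sub fstar.isConsistent_weight).listSum_abs_mono _ (by omega)

theorem listSum_sum_abs_predictDiff_le [Nonempty A] (hm : 1 ≤ m) {h : ℕ} (hh : h + 1 + m ≤ H)
    (π : Policy O A) :
    listSum h (fun l => π.seqProb [] l * ∑ x, ∑ t, |predictDiff fstar f (m - 1) (l ++ [x]) t|) ≤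
      Fintype.card A * exploreDist fstar f H m π := by
  have hA : (0 : ℝ) < Fintype.card A := by exact_mod_cast Fintype.card_pos
  have hD := f.isConsistent_weight.sub fstar.isConsistent_weight
  have h1 : ∀ u : Fin (m - 1) → A, 1 / (Fintype.card A : ℝ) * listSum h (fun l =>
      π.seqProb [] l * ∑ x, listSum (m - 1 + 1) (fun l' =>
        (π.explore (h + 1) u).seqProb (l ++ [x]) l' *
          |f.weight (l ++ [x] ++ l') - fstar.weight (l ++ [x] ++ l')|)) ≤
      f.trajDist fstar H (π.explore (h + 1) u) := by
    intro u
    rw [POMDP.trajDist_eq_listSum]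
    refine le_trans (le_of_eq ?_)
      (hD.listSum_abs_mono (π.explore (h + 1) u) (n := h + 1 + (m - 1 + 1)) (by omega))
    rw [listSum_add_len, listSum_snoc, ← listSum_mul_left]
    refine listSum_congr fun l hl => ?_
    rw [Finset.mul_sum, Finset.mul_sum]
    refine Finset.sum_congr rfl fun x _ => ?_
    simp only [Policy.seqProb_append, Policy.seqProb_singleton, List.nil_append,
      π.explore_seqProb_prefix u [] l (by simpa using hl), π.explore_prob_uniform u hl, mul_assoc,
      listSum_mul_left]
    ring
  have h2 := Finset.sum_le_sum fun u (_ : u ∈ (Finset.univ : Finset (Fin (m - 1) → A))) => h1 u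
  rw [← Finset.mul_sum, ← listSum_sum] at h2
  have h3 := h2.trans (sum_trajDist_explore_le fstar f (by omega) π)
  rw [one_div, inv_mul_le_iff₀ hA] at h3
  refine le_trans (le_of_eq (listSum_congr fun l hl => ?_)) h3
  have h4 : ∀ x, ∑ t, |predictDiff fstar f (m - 1) (l ++ [x]) t| =
      ∑ u : Fin (m - 1) → A, listSum (m - 1 + 1) (fun l' =>
        (π.explore (h + 1) u).seqProb (l ++ [x]) l' *
          |f.weight (l ++ [x] ++ l') - fstar.weight (l ++ [x] ++ l')|) := fun x =>
    (sum_listSum_explore_eq fstar f π (l ++ [x]) (by simp [hl])).symm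
  simp only [h4]
  rw [← Finset.mul_sum, Finset.sum_comm]

theorem listSum_abs_predictDiff_le [Nonempty A] (hm : 1 ≤ m) {h : ℕ} (hh : h + m ≤ H)
    (π : Policy O A) :
    listSum h (fun l => π.seqProb [] l * ∑ t, |predictDiff fstar f (m - 1) l t|) ≤
      Fintype.card A * exploreDist fstar f H m π := by
  cases h with
  | zero =>
    have h1 := sum_abs_predictDiff_nil_le fstar f hm (by omega : m ≤ H) π
    have h0 : 0 ≤ ∑ t, |predictDiff fstar f (m - 1) [] t| :=
      Finset.sum_nonneg fun _ _ => abs_nonneg _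
    have hA : (1 : ℝ) ≤ Fintype.card A := by exact_mod_cast Fintype.card_pos
    simp only [listSum_zero, Policy.seqProb, one_mul]
    nlinarith
  | succ h =>
    refine le_trans ?_ (listSum_sum_abs_predictDiff_le fstar f hm hh π)
    rw [listSum_snoc]
    refine listSum_le_listSum fun l _ => ?_
    rw [Finset.mul_sum]
    refine Finset.sum_le_sum fun x _ => ?_
    refine mul_le_mul_of_nonneg_right ?_ (Finset.sum_nonneg fun _ _ => abs_nonneg _)
    rw [π.seqProb_append, π.seqProb_singleton]
    exact mul_le_of_le_one_right (π.seqProb_nonneg _ _) (π.prob_le_one _ _ _)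

theorem stepError_belief_le {C : ℝ} (hm : 1 ≤ m) {h : ℕ} (hh : h + 1 + m ≤ H)
    {Φ : (Future O A (m - 1) → ℝ) →ₗ[ℝ] (S → ℝ)} (hΦ : IsVirtualBelief f H m h C Φ)
    (l : List (O × A)) (hl : l.length = h) :
    stepError fstar f h (m - 1) Φ (fstar.belief l) ≤
      ∑ x, ∑ t, |predictDiff fstar f (m - 1) (l ++ [x]) t| +
        (Fintype.card A : ℝ) ^ m * C * ∑ t, |predictDiff fstar f (m - 1) l t| := by
  subst hl
  have hm' : m - 1 + 1 = m := by omega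
  have herr : ∀ x, transitionError fstar f l.length (m - 1) Φ x (fstar.belief l) =
      f.predict (l.length + 1) (m - 1)
        (f.beliefStep l.length x (Φ (predictDiff fstar f (m - 1) l))) -
      predictDiff fstar f (m - 1) (l ++ [x]) := by
    intro x
    have h1 : f.predict (l.length + 1) (m - 1) (f.beliefStep l.length x (f.belief l)) =
        f.predict (l.length + 1) (m - 1) (f.beliefStep l.length x
          (Φ (f.predict l.length (m - 1) (f.belief l)))) := by
      ext t
      rw [f.predict_beliefStep, f.predict_beliefStep,
        hΦ.predict_eq _ (by omega) _ (f.belief_mem_beliefSpan l)]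
    have h2 : f.beliefStep l.length x (Φ (predictDiff fstar f (m - 1) l)) =
        f.beliefStep l.length x (Φ (f.predict l.length (m - 1) (f.belief l))) -
        f.beliefStep l.length x (Φ (fstar.predict l.length (m - 1) (fstar.belief l))) := by
      rw [predictDiff, map_sub]
      exact (f.evolveLin l.length [x]).map_sub _ _
    rw [transitionError_apply, h2, map_sub, ← h1, predictDiff, f.belief_snoc, fstar.belief_snoc,
      List.length_append, List.length_singleton]
    abel
  unfold stepError
  calc _ ≤ ∑ x, ∑ t, (|predictDiff fstar f (m - 1) (l ++ [x]) t| +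
        |f.predict (l.length + 1) (m - 1)
          (f.beliefStep l.length x (Φ (predictDiff fstar f (m - 1) l))) t|) := by
        refine Finset.sum_le_sum fun x _ => Finset.sum_le_sum fun t _ => ?_
        rw [herr, Pi.sub_apply]
        exact (abs_sub _ _).trans_eq (add_comm _ _)
    _ ≤ _ := by
        simp only [Finset.sum_add_distrib]
        refine add_le_add le_rfl ?_
        refine (f.sum_sum_abs_predict_beliefStep_le _ _ _).trans ?_
        rw [hm', mul_assoc]
        exact mul_le_mul_of_nonneg_left (hΦ.norm_le _) (by positivity)

/-- The expected update error under `π` is controlled by the distances under the exploring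
policies derived from `π`. -/
theorem listSum_stepError_le [Nonempty A] {C : ℝ} (hC : 0 ≤ C) (hm : 1 ≤ m) {h : ℕ}
    (hh : h + 1 + m ≤ H) {Φ : (Future O A (m - 1) → ℝ) →ₗ[ℝ] (S → ℝ)}
    (hΦ : IsVirtualBelief f H m h C Φ) (π : Policy O A) :
    listSum h (fun l => π.seqProb [] l * stepError fstar f h (m - 1) Φ (fstar.belief l)) ≤
      (Fintype.card A + (Fintype.card A : ℝ) ^ m * C * Fintype.card A) *
        exploreDist fstar f H m π := by
  calc _ ≤ listSum h (fun l => π.seqProb [] l *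
          ∑ x, ∑ t, |predictDiff fstar f (m - 1) (l ++ [x]) t| +
        (Fintype.card A : ℝ) ^ m * C *
          (π.seqProb [] l * ∑ t, |predictDiff fstar f (m - 1) l t|)) := by
        refine listSum_le_listSum fun l hl => ?_
        refine (mul_le_mul_of_nonneg_left (stepError_belief_le fstar f hm hh hΦ l hl)
          (π.seqProb_nonneg _ _)).trans (le_of_eq ?_)
        ring
    _ ≤ Fintype.card A * exploreDist fstar f H m π + (Fintype.card A : ℝ) ^ m * C *
          (Fintype.card A * exploreDist fstar f H m π) := by
        rw [listSum_add, listSum_mul_left]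
        exact add_le_add (listSum_sum_abs_predictDiff_le fstar f hm hh π)
          (mul_le_mul_of_nonneg_left (listSum_abs_predictDiff_le fstar f hm (by omega) π)
            (by positivity))
    _ = _ := by ring

/-- An a priori bound of the update error. -/
theorem stepError_le {C : ℝ} (hm : 1 ≤ m) (hC : 0 ≤ C) {h : ℕ}
    {Φ : (Future O A (m - 1) → ℝ) →ₗ[ℝ] (S → ℝ)} (hΦ : IsVirtualBelief f H m h C Φ)
    (b : S → ℝ) : stepError fstar f h (m - 1) Φ b ≤
      ((Fintype.card A : ℝ) ^ m + (Fintype.card A : ℝ) ^ m * C * (Fintype.card A : ℝ) ^ (m - 1)) *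
        ∑ s, |b s| := by
  have hm' : m - 1 + 1 = m := by omega
  unfold stepError
  calc _ ≤ ∑ x, ∑ t, (|fstar.predict (h + 1) (m - 1) (fstar.beliefStep h x b) t| +
        |f.predict (h + 1) (m - 1)
          (f.beliefStep h x (Φ (fstar.predict h (m - 1) b))) t|) := by
        refine Finset.sum_le_sum fun x _ => Finset.sum_le_sum fun t _ => ?_
        rw [transitionError_apply, Pi.sub_apply]
        exact abs_sub _ _
    _ ≤ (Fintype.card A : ℝ) ^ m * ∑ s, |b s| + (Fintype.card A : ℝ) ^ m *
          (C * ((Fintype.card A : ℝ) ^ (m - 1) * ∑ s, |b s|)) := by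
        simp only [Finset.sum_add_distrib]
        refine add_le_add ?_ ?_
        · refine (fstar.sum_sum_abs_predict_beliefStep_le _ _ _).trans (le_of_eq ?_)
          rw [hm']
        · refine (f.sum_sum_abs_predict_beliefStep_le _ _ _).trans ?_
          rw [hm']
          refine mul_le_mul_of_nonneg_left ?_ (by positivity)
          exact (hΦ.norm_le _).trans
            (mul_le_mul_of_nonneg_left (fstar.sum_abs_predict_le _ _ _) hC)
    _ = _ := by ring

end Explore

end Decomposition

/-! ### The regret of optimistic planning -/

section Regret

variable {H m : ℕ}

theorem POMDP.listSum_seqProb_mul_sum_abs_belief (f : POMDP S O A) (π : Policy O A) (n : ℕ) :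
    listSum n (fun l => π.seqProb [] l * ∑ s, |f.belief l s|) = 1 := by
  rw [← f.weight_nil, ← f.isConsistent_weight.listSum_eq π n]
  refine listSum_congr fun l _ => ?_
  rw [f.weight_eq_sum_belief]
  simp only [abs_of_nonneg (f.belief_nonneg _ _)]

theorem dotProduct_transitionError_single [DecidableEq S] (fstar f : POMDP S O A) (h n : ℕ)
    (Φ : (Future O A n → ℝ) →ₗ[ℝ] (S → ℝ)) (x : O × A) (t : Future O A n) (b : S → ℝ) :
    (fun s => transitionError fstar f h n Φ x (Pi.single s 1) t) ⬝ᵥ b =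
      transitionError fstar f h n Φ x b t := by
  rw [(transitionError fstar f h n Φ x).pi_apply_eq_sum_univ b, Finset.sum_apply, dotProduct]
  refine Finset.sum_congr rfl fun s _ => ?_
  have e : (fun j => if s = j then (1 : ℝ) else 0) = Pi.single s 1 := by
    ext s'
    simp [Pi.single_apply, eq_comm]
  rw [Pi.smul_apply, smul_eq_mul, mul_comm, e]

/-- Models whose past exploration errors are bounded have a small total error on the policies
that are selected at the same time. -/
theorem sum_trajDist_le [Nonempty A] [Nonempty S] (fstar : POMDP S O A) (f : ℕ → POMDP S O A)
    (π : ℕ → Policy O A) {C Z : ℝ} (hC : 0 ≤ C) (hm : 1 ≤ m) (hmH : m ≤ H) {K : ℕ} (hK : 0 < K)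
    (hΦ : ∀ k < K, ∀ h, h + m ≤ H → ∃ Φ, IsVirtualBelief (f k) H m h C Φ)
    (hZ : ∀ k < K, ∑ l ∈ Finset.range k, exploreDist fstar (f k) H m (π l) ≤ Z) :
    ∑ k ∈ Finset.range K, (f k).trajDist fstar H (π k) ≤
      (1 + C) * (H * (4 * Fintype.card S * Real.log (Fintype.card S + K) *
        (((Fintype.card A : ℝ) ^ m + (Fintype.card A : ℝ) ^ m * C * (Fintype.card A : ℝ) ^ m) *
          (4 * Fintype.card S + Z)))) := by
  classical
  choose! Φ hΦ using hΦ
  have hA : (1 : ℝ) ≤ Fintype.card A := by exact_mod_cast Fintype.card_pos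
  have hS : (1 : ℝ) ≤ Fintype.card S := by exact_mod_cast Fintype.card_pos
  have hK1 : (1 : ℝ) ≤ K := by exact_mod_cast hK
  set a := (Fintype.card A : ℝ) ^ m with ha
  have hAa : (Fintype.card A : ℝ) ≤ a := le_self_pow₀ hA (by omega)
  have hAa' : (Fintype.card A : ℝ) ^ (m - 1) ≤ a := pow_le_pow_right₀ hA (by omega)
  have ha1 : 1 ≤ a := hA.trans hAa
  set G := a + a * C * a with hG
  have haCa : 0 ≤ a * C * a := by positivity
  have hG1 : 1 ≤ G := by linarith
  have haG : a ≤ G := by linarith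
  have hE0 : ∀ k l, 0 ≤ exploreDist fstar (f k) H m (π l) := fun k l =>
    Finset.sum_nonneg fun j _ => trajDist_nonneg _ _ _
  have hZ0 : 0 ≤ Z := (Finset.sum_nonneg fun l _ => hE0 0 l).trans (hZ 0 hK)
  have hlogS : 0 ≤ Real.log (Fintype.card S + K) := Real.log_nonneg (by linarith)
  set B := 4 * Fintype.card S * Real.log (Fintype.card S + K) *
    (G * (4 * Fintype.card S + Z)) with hB
  -- the error at the beginning of the episode
  have h0 : ∑ k ∈ Finset.range K, ∑ t, |predictDiff fstar (f k) (m - 1) [] t| ≤ B := by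
    have := sum_error_le_of_past_error_le (ι := Unit) (I := Unit) (p := fun _ _ => 1)
      (fun _ _ => zero_le_one) (fun _ _ => 1) (fun k => by simp)
      (fun k (t : Future O A (m - 1)) _ => predictDiff fstar (f k) (m - 1) [] t) hK
      (W := 2 * a) (ζ := Z)
      (fun k hk => by
        simp only [Finset.univ_unique, Finset.sum_singleton, predictDiff]
        calc _ ≤ ∑ t, (|(f k).predict 0 (m - 1) ((f k).belief []) t| +
              |fstar.predict 0 (m - 1) (fstar.belief []) t|) :=
              Finset.sum_le_sum fun t _ => abs_sub _ _
          _ ≤ (Fintype.card A : ℝ) ^ (m - 1) * 1 + (Fintype.card A : ℝ) ^ (m - 1) * 1 := by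
              have hb : ∀ g : POMDP S O A, ∑ s, |g.belief [] s| = 1 := fun g => by
                simp only [abs_of_nonneg (g.belief_nonneg _ _)]; exact g.init_sum
              rw [Finset.sum_add_distrib]
              refine add_le_add ?_ ?_
              · rw [← hb (f k)]; exact (f k).sum_abs_predict_le _ _ _
              · rw [← hb fstar]; exact fstar.sum_abs_predict_le _ _ _
          _ ≤ 2 * a := by linarith)
      (fun k hk => by
        refine le_trans (Finset.sum_le_sum fun l _ => ?_) (hZ k hk)
        simpa [dotProduct] using sum_abs_predictDiff_nil_le fstar (f k) hm hmH (π l))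
    simp only [dotProduct, Finset.univ_unique, Finset.sum_singleton, mul_one, one_mul,
      Fintype.card_unit, Nat.cast_one] at this
    refine this.trans ?_
    rw [hB]
    have hlog1 : 0 ≤ Real.log (1 + K) := Real.log_nonneg (by linarith)
    have hlog : Real.log (1 + K) ≤ Real.log (Fintype.card S + K) :=
      Real.log_le_log (by linarith) (by linarith)
    have h1 : 4 * Real.log (1 + K) ≤ 4 * Fintype.card S * Real.log (Fintype.card S + K) := by
      nlinarith
    have h2 : 2 * (2 * a) + Z ≤ G * (4 * Fintype.card S + Z) := by nlinarith
    exact mul_le_mul h1 h2 (by linarith) (by positivity)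
  -- the errors of the updates
  have hstep : ∀ h ∈ Finset.range (H - m), ∑ k ∈ Finset.range K,
      listSum h (fun l => (π k).seqProb [] l *
        stepError fstar (f k) h (m - 1) (Φ k h) (fstar.belief l)) ≤ B := by
    intro h hh
    have hh' : h + 1 + m ≤ H := by have := Finset.mem_range.mp hh; omega
    have := sum_error_le_of_past_error_le (ι := S) (I := Fin h → O × A)
      (p := fun k i => (π k).seqProb [] (List.ofFn i))
      (fun k i => (π k).seqProb_nonneg _ _) (fun i => fstar.belief (List.ofFn i))
      (fun k => (fstar.listSum_seqProb_mul_sum_abs_belief (π k) h).le)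
      (fun k (j : (O × A) × Future O A (m - 1)) s =>
        transitionError fstar (f k) h (m - 1) (Φ k h) j.1 (Pi.single s 1) j.2) hK
      (W := G * Fintype.card S) (ζ := G * Z)
      (fun k hk => by
        rw [Finset.sum_comm]
        calc _ = ∑ s, stepError fstar (f k) h (m - 1) (Φ k h) (Pi.single s 1) := by
              refine Finset.sum_congr rfl fun s _ => ?_
              rw [Fintype.sum_prod_type]; rfl
          _ ≤ ∑ _s : S, G := by
              refine Finset.sum_le_sum fun s _ => ?_
              refine (stepError_le fstar (f k) hm hC (hΦ k hk h (by omega)) _).trans ?_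
              have : ∑ s', |(Pi.single s 1 : S → ℝ) s'| = 1 := by
                simp [Pi.single_apply, apply_ite abs]
              rw [this, mul_one, hG]
              have : 0 ≤ a * C := by positivity
              nlinarith
          _ = G * Fintype.card S := by simp [mul_comm])
      (fun k hk => by
        simp only [dotProduct_transitionError_single]
        calc _ ≤ ∑ l ∈ Finset.range k, G * exploreDist fstar (f k) H m (π l) := by
              refine Finset.sum_le_sum fun l _ => ?_
              have h1 := listSum_stepError_le fstar (f k) hC hm hh' (hΦ k hk h (by omega)) (π l)
              have h2 : (Fintype.card A : ℝ) + a * C * Fintype.card A ≤ G := by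
                have : 0 ≤ a * C := by positivity
                rw [hG]; nlinarith
              refine le_trans (le_of_eq ?_)
                (h1.trans (mul_le_mul_of_nonneg_right h2 (hE0 k l)))
              refine Finset.sum_congr rfl fun i _ => ?_
              rw [Fintype.sum_prod_type]; rfl
          _ ≤ G * Z := by
              rw [← Finset.mul_sum]
              exact mul_le_mul_of_nonneg_left (hZ k hk) (by linarith))
    simp only [dotProduct_transitionError_single] at this
    refine le_trans (le_of_eq ?_) (this.trans ?_)
    · refine Finset.sum_congr rfl fun k _ => Finset.sum_congr rfl fun i _ => ?_
      rw [Fintype.sum_prod_type]; rfl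
    rw [hB]
    refine mul_le_mul_of_nonneg_left ?_ (by positivity)
    nlinarith
  calc _ ≤ ∑ k ∈ Finset.range K, (1 + C) * (∑ t, |predictDiff fstar (f k) (m - 1) [] t| +
        ∑ h ∈ Finset.range (H - m), listSum h (fun l => (π k).seqProb [] l *
          stepError fstar (f k) h (m - 1) (Φ k h) (fstar.belief l))) :=
        Finset.sum_le_sum fun k hk => trajDist_le_sum_stepError fstar (f k) hC hm hmH (Φ k)
          (hΦ k (Finset.mem_range.mp hk)) (π k)
    _ ≤ (1 + C) * (B + ∑ h ∈ Finset.range (H - m), B) := by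
        rw [← Finset.mul_sum, Finset.sum_add_distrib,
          Finset.sum_comm (s := Finset.range K) (t := Finset.range (H - m))]
        refine mul_le_mul_of_nonneg_left ?_ (by linarith)
        exact add_le_add h0 (Finset.sum_le_sum hstep)
    _ ≤ (1 + C) * (H * B) := by
        refine mul_le_mul_of_nonneg_left ?_ (by linarith)
        have hB0 : 0 ≤ B := by positivity
        have : ((H - m : ℕ) : ℝ) + 1 ≤ H := by exact_mod_cast (by omega : H - m + 1 ≤ H)
        rw [Finset.sum_const, Finset.card_range, nsmul_eq_mul]
        nlinarith

theorem abs_sum_reward_le {r : Fin H → O → A → ℝ} (hr : ∀ h o a, 0 ≤ r h o a ∧ r h o a ≤ 1)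
    (τ : Traj O A H) : |∑ t, r t (τ t).1 (τ t).2| ≤ H := by
  rw [abs_of_nonneg (Finset.sum_nonneg fun t _ => (hr _ _ _).1)]
  calc _ ≤ ∑ _t : Fin H, (1 : ℝ) := Finset.sum_le_sum fun t _ => (hr _ _ _).2
    _ = H := by simp

theorem POMDP.value_sub_le (f fstar : POMDP S O A) {r : Fin H → O → A → ℝ}
    (hr : ∀ h o a, 0 ≤ r h o a ∧ r h o a ≤ 1) (π : Policy O A) :
    f.value r π - fstar.value r π ≤ H * f.trajDist fstar H π := by
  unfold POMDP.value expectedReward POMDP.trajDist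
  rw [← Finset.sum_sub_distrib, Finset.mul_sum]
  refine Finset.sum_le_sum fun τ _ => ?_
  rw [← sub_mul]
  calc _ ≤ |(f.trajProb π τ - fstar.trajProb π τ) * ∑ t, r t (τ t).1 (τ t).2| := le_abs_self _
    _ ≤ |f.trajProb π τ - fstar.trajProb π τ| * H := by
        rw [abs_mul]
        exact mul_le_mul_of_nonneg_left (abs_sum_reward_le hr τ) (abs_nonneg _)
    _ = _ := mul_comm _ _

theorem POMDP.value_nonneg (f : POMDP S O A) {r : Fin H → O → A → ℝ}
    (hr : ∀ h o a, 0 ≤ r h o a ∧ r h o a ≤ 1) (π : Policy O A) : 0 ≤ f.value r π :=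
  Finset.sum_nonneg fun _ _ => mul_nonneg (f.trajProb_nonneg _ _)
    (Finset.sum_nonneg fun _ _ => (hr _ _ _).1)

theorem POMDP.value_le (f : POMDP S O A) {r : Fin H → O → A → ℝ}
    (hr : ∀ h o a, 0 ≤ r h o a ∧ r h o a ≤ 1) (π : Policy O A) : f.value r π ≤ H := by
  calc f.value r π ≤ ∑ τ : Traj O A H, f.trajProb π τ * H :=
        Finset.sum_le_sum fun τ _ => mul_le_mul_of_nonneg_left
          ((le_abs_self _).trans (abs_sum_reward_le hr τ)) (f.trajProb_nonneg _ _)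
    _ = H := by rw [← Finset.sum_mul, f.sum_trajProb, one_mul]

theorem nonempty_policy [Nonempty A] : Nonempty (Policy O A) :=
  ⟨{ prob := fun _ _ _ => 1 / (Fintype.card A : ℝ)
     prob_nonneg := fun _ _ _ => by positivity
     prob_sum := fun _ _ => by simp }⟩

theorem POMDP.nonempty_state (f : POMDP S O A) : Nonempty S := by
  by_contra h
  rw [not_nonempty_iff] at h
  have := f.init_sum
  simp at this

theorem POMDP.mixtureValue_eq (f : POMDP S O A) {K : ℕ} (r : Fin H → O → A → ℝ)
    (π : Fin K → Policy O A) : f.mixtureValue r π = (1 / (K : ℝ)) * ∑ k, f.value r (π k) := by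
  unfold POMDP.mixtureValue POMDP.value expectedReward
  rw [Finset.sum_comm, Finset.mul_sum]
  refine Finset.sum_congr rfl fun τ _ => ?_
  rw [← Finset.sum_mul, mul_assoc]

/-- On the event that the confidence sets are valid, optimism and the bound on the total model
error give a bound on the suboptimality of the output. -/
theorem mul_optValue_sub_mixtureValue_le [Nonempty A] {fstar : POMDP S O A}
    {F : Set (POMDP S O A)} {α : ℝ} (hα : 0 < α) (hm : 1 ≤ m) (hmH : m ≤ H)
    (hF : IsAdmissibleClass F fstar H m α) {r : Fin H → O → A → ℝ}
    (hr : ∀ h o a, 0 ≤ r h o a ∧ r h o a ≤ 1) {K : ℕ} (hK : 0 < K) {β : ℝ}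
    (plan : Planner S O A H m) (hplan : IsCrane K plan F r β) (ω : Outcome O A H m K)
    (hω : ∀ k, fstar ∈ confidenceSet plan F β ω k ∧
      ∀ f ∈ confidenceSet plan F β ω k, ∑ i ∈ Finset.Iio k, ∑ j,
        (f.trajDist fstar H (plan.executed ω i j)) ^ 2 ≤ 48 * β + 14) :
    K * (fstar.optValue r - fstar.mixtureValue r (fun k => (plan.select ω k).2)) ≤
      H * ((1 + 1 / α) * (H * (4 * Fintype.card S * Real.log (Fintype.card S + K) *
        (((Fintype.card A : ℝ) ^ m + (Fintype.card A : ℝ) ^ m * (1 / α) *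
          (Fintype.card A : ℝ) ^ m) *
          (4 * Fintype.card S +
            √(K * Fintype.card (ExploreIndex A H m) * (48 * β + 14))))))) := by
  have := fstar.nonempty_state
  have := nonempty_policy (O := O) (A := A)
  have hK0 : (K : ℝ) ≠ 0 := by exact_mod_cast hK.ne'
  set s : ℕ → POMDP S O A × Policy O A := fun k =>
    plan.select ω ⟨min k (K - 1), by omega⟩ with hs
  have hsk : ∀ k (hk : k < K), s k = plan.select ω ⟨k, hk⟩ := by
    intro k hk
    have : min k (K - 1) = k := by omega
    simp only [hs, this]
  have hexec : ∀ l (hl : l < K) j, (s l).2.explore j.1 j.2 = plan.executed ω ⟨l, hl⟩ j := by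
    intro l hl j
    rw [hsk l hl]; rfl
  have hreg := sum_trajDist_le fstar (fun k => (s k).1) (fun k => (s k).2)
    (C := 1 / α) (Z := √(K * Fintype.card (ExploreIndex A H m) * (48 * β + 14)))
    (by positivity) hm hmH hK
    (fun k hk h hh => by
      have hmem : (s k).1 ∈ F := by rw [hsk k hk]; exact (hplan ω ⟨k, hk⟩).1.1
      exact (s k).1.exists_virtualBelief hm hmH (by omega) (hF.valid _ hmem h (by omega))
        (hF.regular _ hmem h (by omega)))
    (fun k hk => by
      apply Real.le_sqrt_of_sq_le
      have h1 := (hω ⟨k, hk⟩).2 (s k).1 (by rw [hsk k hk]; exact (hplan ω ⟨k, hk⟩).1)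
      have h2 : ∑ l ∈ Finset.range k, exploreDist fstar (s k).1 H m (s l).2 =
          ∑ i ∈ Finset.Iio (⟨k, hk⟩ : Fin K), ∑ j,
            (s k).1.trajDist fstar H (plan.executed ω i j) := by
        symm
        refine Finset.sum_bij (fun i _ => (i : ℕ)) (fun i hi => ?_) (fun i _ i' _ h => Fin.ext h)
          (fun l hl => ?_) (fun i hi => ?_)
        · have hi' := Finset.mem_Iio.mp hi
          exact Finset.mem_range.mpr hi'
        · have hl' := Finset.mem_range.mp hl
          exact ⟨⟨l, by omega⟩, Finset.mem_Iio.mpr hl', rfl⟩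
        · refine Finset.sum_congr rfl fun j _ => ?_
          rw [← hexec i i.2 j]
      rw [h2, ← Finset.sum_product']
      refine sq_sum_le_card_mul_sum_sq.trans ?_
      rw [Finset.sum_product, Finset.card_product, Fin.card_Iio, Finset.card_univ]
      push_cast
      refine mul_le_mul ?_ h1 (Finset.sum_nonneg fun i _ => Finset.sum_nonneg fun j _ =>
        sq_nonneg _) (by positivity)
      refine mul_le_mul_of_nonneg_right ?_ (Nat.cast_nonneg _)
      exact_mod_cast hk.le)
  have hopt : ∀ k : Fin K, fstar.optValue r ≤
      fstar.value r (plan.select ω k).2 + H * (s k).1.trajDist fstar H (s k).2 := by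
    intro k
    have h1 : fstar.optValue r ≤ (plan.select ω k).1.value r (plan.select ω k).2 :=
      ciSup_le fun π => (hplan ω k).2 fstar (hω k).1 π
    have h2 := (plan.select ω k).1.value_sub_le fstar hr (plan.select ω k).2
    rw [hsk k k.2]
    linarith
  have hsum := Finset.sum_le_sum fun k (_ : k ∈ (Finset.univ : Finset (Fin K))) => hopt k
  rw [Finset.sum_const, Finset.card_univ, Fintype.card_fin, nsmul_eq_mul,
    Finset.sum_add_distrib, ← Finset.mul_sum,
    Fin.sum_univ_eq_sum_range (fun k => (s k).1.trajDist fstar H (s k).2)] at hsum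
  rw [POMDP.mixtureValue_eq, mul_sub, ← mul_assoc, mul_one_div_cancel hK0, one_mul]
  have := mul_le_mul_of_nonneg_left hreg (Nat.cast_nonneg (α := ℝ) H)
  linarith

end Regret

/-! ### Brackets for tabular models -/

section Bracket

/-- The belief evolution for parameters that need not be normalized. -/
def rawEvolve (tr : ℕ → A → S → S → ℝ) (em : ℕ → S → O → ℝ) :
    ℕ → List (O × A) → (S → ℝ) → (S → ℝ)
  | _, [], b => b
  | h, x :: l, b => rawEvolve tr em (h + 1) l
      (fun s' => ∑ s, b s * em h s x.1 * tr h x.2 s s')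

theorem POMDP.evolve_eq_rawEvolve (f : POMDP S O A) (h : ℕ) (l : List (O × A)) (b : S → ℝ) :
    f.evolve h l b = rawEvolve f.trans f.emit h l b := by
  induction l generalizing h b with
  | nil => rfl
  | cons x l ih => exact ih _ _

variable {H : ℕ} {tr tr' : ℕ → A → S → S → ℝ} {em em' : ℕ → S → O → ℝ}

theorem rawEvolve_le_rawEvolve (htr0 : ∀ h < H, ∀ a s s', 0 ≤ tr h a s s')
    (htr : ∀ h < H, ∀ a s s', tr h a s s' ≤ tr' h a s s')
    (hem0 : ∀ h < H, ∀ s o, 0 ≤ em h s o) (hem : ∀ h < H, ∀ s o, em h s o ≤ em' h s o)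
    (h : ℕ) (l : List (O × A)) (hl : h + l.length ≤ H) {b b' : S → ℝ} (hb0 : ∀ s, 0 ≤ b s)
    (hb : ∀ s, b s ≤ b' s) (s : S) : rawEvolve tr em h l b s ≤ rawEvolve tr' em' h l b' s := by
  induction l generalizing h b b' with
  | nil => exact hb s
  | cons x l ih =>
    simp only [List.length_cons] at hl
    have hh : h < H := by omega
    refine ih (h + 1) (by omega) (fun s' => Finset.sum_nonneg fun s _ => ?_)
      (fun s' => Finset.sum_le_sum fun s _ => ?_)
    · exact mul_nonneg (mul_nonneg (hb0 s) (hem0 h hh _ _)) (htr0 h hh _ _ _)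
    · exact mul_le_mul (mul_le_mul (hb s) (hem h hh _ _) (hem0 h hh _ _) ((hb0 s).trans (hb s)))
        (htr h hh _ _ _) (htr0 h hh _ _ _)
        (mul_nonneg ((hb0 s).trans (hb s)) ((hem0 h hh _ _).trans (hem h hh _ _)))

theorem sum_prob_mul_rawStep (π : Policy O A) (τ : List (O × A)) (h : ℕ) (b : S → ℝ) :
    ∑ x : O × A, π.prob τ x.1 x.2 * ∑ s', ∑ s, b s * em h s x.1 * tr h x.2 s s' =
      ∑ s, b s * ∑ o, em h s o * ∑ a, π.prob τ o a * ∑ s', tr h a s s' := by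
  rw [Fintype.sum_prod_type]
  simp only [Finset.mul_sum]
  rw [Finset.sum_congr rfl fun o _ => Finset.sum_congr rfl fun a _ => Finset.sum_comm]
  rw [Finset.sum_congr rfl fun o _ => Finset.sum_comm]
  rw [Finset.sum_comm]
  refine Finset.sum_congr rfl fun s _ => Finset.sum_congr rfl fun o _ =>
    Finset.sum_congr rfl fun a _ => Finset.sum_congr rfl fun s' _ => ?_
  ring

theorem listSum_seqProb_mul_rawEvolve_le {c : ℝ} (hc : 0 ≤ c)
    (hem0 : ∀ h < H, ∀ s o, 0 ≤ em h s o) (htr0 : ∀ h < H, ∀ a s s', 0 ≤ tr h a s s')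
    (htr : ∀ h < H, ∀ a s, ∑ s', tr h a s s' ≤ c) (hem : ∀ h < H, ∀ s, ∑ o, em h s o ≤ c)
    (π : Policy O A) (n h : ℕ) (hn : h + n ≤ H) (τ : List (O × A)) {b : S → ℝ}
    (hb : ∀ s, 0 ≤ b s) :
    listSum n (fun l => π.seqProb τ l * ∑ s, rawEvolve tr em h l b s) ≤
      c ^ (2 * n) * ∑ s, b s := by
  induction n generalizing h τ b with
  | zero => simp [Policy.seqProb, rawEvolve]
  | succ n ih =>
    have hh : h < H := by omega
    rw [listSum_succ]
    simp only [Policy.seqProb, rawEvolve, mul_assoc, listSum_mul_left]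
    calc _ ≤ ∑ x : O × A, π.prob τ x.1 x.2 * (c ^ (2 * n) *
          ∑ s', ∑ s, b s * em h s x.1 * tr h x.2 s s') := by
          refine Finset.sum_le_sum fun x _ => mul_le_mul_of_nonneg_left ?_ (π.prob_nonneg _ _ _)
          simp only [mul_assoc]
          refine ih (h + 1) (by omega) _ fun s' => Finset.sum_nonneg fun s _ => ?_
          exact mul_nonneg (hb s) (mul_nonneg (hem0 h hh _ _) (htr0 h hh _ _ _))
      _ = c ^ (2 * n) * ∑ s, b s * ∑ o, em h s o * ∑ a, π.prob τ o a * ∑ s', tr h a s s' := by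
          rw [← sum_prob_mul_rawStep, Finset.mul_sum]
          exact Finset.sum_congr rfl fun x _ => by ring
      _ ≤ c ^ (2 * n) * ∑ s, b s * (c * c) := by
          refine mul_le_mul_of_nonneg_left (Finset.sum_le_sum fun s _ =>
            mul_le_mul_of_nonneg_left ?_ (hb s)) (by positivity)
          calc _ ≤ ∑ o, em h s o * c := by
                refine Finset.sum_le_sum fun o _ => mul_le_mul_of_nonneg_left ?_ (hem0 h hh _ _)
                calc _ ≤ ∑ a, π.prob τ o a * c := Finset.sum_le_sum fun a _ =>
                      mul_le_mul_of_nonneg_left (htr h hh a s) (π.prob_nonneg _ _ _)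
                  _ = c := by rw [← Finset.sum_mul, π.prob_sum, one_mul]
            _ ≤ c * c := by
                rw [← Finset.sum_mul]
                exact mul_le_mul_of_nonneg_right (hem h hh s) hc
      _ = _ := by rw [← Finset.sum_mul]; ring

theorem le_listSum_seqProb_mul_rawEvolve {c : ℝ} (hc : 0 ≤ c)
    (hem0 : ∀ h < H, ∀ s o, 0 ≤ em h s o) (htr0 : ∀ h < H, ∀ a s s', 0 ≤ tr h a s s')
    (htr : ∀ h < H, ∀ a s, c ≤ ∑ s', tr h a s s') (hem : ∀ h < H, ∀ s, c ≤ ∑ o, em h s o)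
    (π : Policy O A) (n h : ℕ) (hn : h + n ≤ H) (τ : List (O × A)) {b : S → ℝ}
    (hb : ∀ s, 0 ≤ b s) :
    c ^ (2 * n) * ∑ s, b s ≤
      listSum n (fun l => π.seqProb τ l * ∑ s, rawEvolve tr em h l b s) := by
  induction n generalizing h τ b with
  | zero => simp [Policy.seqProb, rawEvolve]
  | succ n ih =>
    have hh : h < H := by omega
    rw [listSum_succ]
    simp only [Policy.seqProb, rawEvolve, mul_assoc, listSum_mul_left]
    calc _ = c ^ (2 * n) * ∑ s, b s * (c * c) := by rw [← Finset.sum_mul]; ring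
      _ ≤ c ^ (2 * n) * ∑ s, b s * ∑ o, em h s o * ∑ a, π.prob τ o a * ∑ s', tr h a s s' := by
          refine mul_le_mul_of_nonneg_left (Finset.sum_le_sum fun s _ =>
            mul_le_mul_of_nonneg_left ?_ (hb s)) (by positivity)
          calc c * c ≤ ∑ o, em h s o * c := by
                rw [← Finset.sum_mul]
                exact mul_le_mul_of_nonneg_right (hem h hh s) hc
            _ ≤ _ := by
                refine Finset.sum_le_sum fun o _ => mul_le_mul_of_nonneg_left ?_ (hem0 h hh _ _)
                calc c = ∑ a, π.prob τ o a * c := by rw [← Finset.sum_mul, π.prob_sum, one_mul]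
                  _ ≤ _ := Finset.sum_le_sum fun a _ =>
                      mul_le_mul_of_nonneg_left (htr h hh a s) (π.prob_nonneg _ _ _)
      _ = ∑ x : O × A, π.prob τ x.1 x.2 * (c ^ (2 * n) *
          ∑ s', ∑ s, b s * em h s x.1 * tr h x.2 s s') := by
          rw [← sum_prob_mul_rawStep, Finset.mul_sum]
          exact Finset.sum_congr rfl fun x _ => by ring
      _ ≤ _ := by
          refine Finset.sum_le_sum fun x _ => mul_le_mul_of_nonneg_left ?_ (π.prob_nonneg _ _ _)
          simp only [mul_assoc]
          refine ih (h + 1) (by omega) _ fun s' => Finset.sum_nonneg fun s _ => ?_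
          exact mul_nonneg (hb s) (mul_nonneg (hem0 h hh _ _) (htr0 h hh _ _ _))

/-- The discretized parameters: the multiples of `1 / M` in `[0, 1]` for all the parameters at the
steps of an episode. -/
abbrev Grid (S O A : Type*) (H M : ℕ) :=
  (S → Fin (M + 1)) × (Fin H × A × S × S → Fin (M + 1)) × (Fin H × S × O → Fin (M + 1))

variable {M : ℕ}

/-- The initial weights of a grid point, shifted by `e / M`; the lower and the upper model belong to
`e = 0` and `e = 1`. -/
def Grid.init (γ : Grid S O A H M) (e : ℝ) (s : S) : ℝ := ((γ.1 s : ℕ) + e) / M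

/-- The transition weights of a grid point, shifted by `e / M`; only the steps `h < H` matter. -/
def Grid.trans (γ : Grid S O A H M) (e : ℝ) (h : ℕ) (a : A) (s s' : S) : ℝ :=
  if hh : h < H then ((γ.2.1 (⟨h, hh⟩, a, s, s') : ℕ) + e) / M else 0

/-- The emission weights of a grid point, shifted by `e / M`; only the steps `h < H` matter. -/
def Grid.emit (γ : Grid S O A H M) (e : ℝ) (h : ℕ) (s : S) (o : O) : ℝ :=
  if hh : h < H then ((γ.2.2 (⟨h, hh⟩, s, o) : ℕ) + e) / M else 0

/-- The parameters of `f` lie in the cell of the grid point. -/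
structure Grid.Contains (γ : Grid S O A H M) (f : POMDP S O A) : Prop where
  lower_init : ∀ s, γ.init 0 s ≤ f.init s
  upper_init : ∀ s, f.init s ≤ γ.init 1 s
  lower_trans : ∀ h < H, ∀ a s s', γ.trans 0 h a s s' ≤ f.trans h a s s'
  upper_trans : ∀ h < H, ∀ a s s', f.trans h a s s' ≤ γ.trans 1 h a s s'
  lower_emit : ∀ h < H, ∀ s o, γ.emit 0 h s o ≤ f.emit h s o
  upper_emit : ∀ h < H, ∀ s o, f.emit h s o ≤ γ.emit 1 h s o

/-- The unnormalized trajectory weight of a grid point. -/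
def Grid.weight (γ : Grid S O A H M) (e : ℝ) (π : Policy O A) (τ : Traj O A H) : ℝ :=
  π.seqProb [] (List.ofFn τ) *
    ∑ s, rawEvolve (γ.trans e) (γ.emit e) 0 (List.ofFn τ) (γ.init e) s

theorem exists_grid_index (hM : 0 < M) {x : ℝ} (h0 : 0 ≤ x) (h1 : x ≤ 1) :
    ∃ i : Fin (M + 1), ((i : ℕ) + (0 : ℝ)) / M ≤ x ∧ x ≤ ((i : ℕ) + (1 : ℝ)) / M := by
  have hM' : (0 : ℝ) < M := by exact_mod_cast hM
  have hx : 0 ≤ x * M := by positivity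
  refine ⟨⟨⌊x * M⌋₊, ?_⟩, ?_, ?_⟩
  · rw [Nat.lt_succ_iff]
    refine Nat.floor_le_of_le ?_
    nlinarith
  · rw [div_le_iff₀ hM', add_zero]
    exact Nat.floor_le hx
  · rw [le_div_iff₀ hM']
    exact (Nat.lt_floor_add_one _).le

theorem le_one_of_sum_eq_one {ι : Type*} [Fintype ι] {p : ι → ℝ} (h0 : ∀ i, 0 ≤ p i)
    (h1 : ∑ i, p i = 1) (i : ι) : p i ≤ 1 := by
  rw [← h1]
  exact Finset.single_le_sum (fun i _ => h0 i) (Finset.mem_univ i)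

theorem exists_grid_contains (hM : 0 < M) (f : POMDP S O A) :
    ∃ γ : Grid S O A H M, γ.Contains f := by
  choose gi hi hi' using fun s => exists_grid_index hM (f.init_nonneg s)
    (le_one_of_sum_eq_one f.init_nonneg f.init_sum s)
  choose gt ht ht' using fun (x : Fin H × A × S × S) => exists_grid_index hM
    (f.trans_nonneg x.1 x.2.1 x.2.2.1 x.2.2.2)
    (le_one_of_sum_eq_one (f.trans_nonneg _ _ _) (f.trans_sum x.1 x.2.1 x.2.2.1) x.2.2.2)
  choose ge he he' using fun (x : Fin H × S × O) => exists_grid_index hM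
    (f.emit_nonneg x.1 x.2.1 x.2.2)
    (le_one_of_sum_eq_one (f.emit_nonneg _ _) (f.emit_sum x.1 x.2.1) x.2.2)
  refine ⟨(gi, gt, ge), hi, hi', fun h hh a s s' => ?_, fun h hh a s s' => ?_,
    fun h hh s o => ?_, fun h hh s o => ?_⟩
  · simpa only [Grid.trans, dif_pos hh] using ht (⟨h, hh⟩, a, s, s')
  · simpa only [Grid.trans, dif_pos hh] using ht' (⟨h, hh⟩, a, s, s')
  · simpa only [Grid.emit, dif_pos hh] using he (⟨h, hh⟩, s, o)
  · simpa only [Grid.emit, dif_pos hh] using he' (⟨h, hh⟩, s, o)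

theorem Grid.init_nonneg (γ : Grid S O A H M) {e : ℝ} (he : 0 ≤ e) (s : S) :
    0 ≤ γ.init e s := by
  unfold Grid.init; positivity

theorem Grid.trans_nonneg (γ : Grid S O A H M) {e : ℝ} (he : 0 ≤ e) (h : ℕ) (a : A) (s s' : S) :
    0 ≤ γ.trans e h a s s' := by
  unfold Grid.trans
  split_ifs
  · positivity
  · exact le_rfl

theorem Grid.emit_nonneg (γ : Grid S O A H M) {e : ℝ} (he : 0 ≤ e) (h : ℕ) (s : S) (o : O) :
    0 ≤ γ.emit e h s o := by
  unfold Grid.emit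
  split_ifs
  · positivity
  · exact le_rfl

theorem Grid.Contains.weight_le {γ : Grid S O A H M} {f : POMDP S O A} (hf : γ.Contains f)
    (π : Policy O A) (τ : Traj O A H) :
    γ.weight 0 π τ ≤ f.trajProb π τ ∧ f.trajProb π τ ≤ γ.weight 1 π τ := by
  rw [f.trajProb_eq, POMDP.weight]
  simp only [f.evolve_eq_rawEvolve]
  have hl : 0 + (List.ofFn τ).length ≤ H := by simp
  constructor
  · refine mul_le_mul_of_nonneg_left (Finset.sum_le_sum fun s _ => ?_) (π.seqProb_nonneg _ _)
    exact rawEvolve_le_rawEvolve (H := H) (fun h _ => γ.trans_nonneg le_rfl h) hf.lower_trans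
      (fun h _ => γ.emit_nonneg le_rfl h) hf.lower_emit 0 _ hl (γ.init_nonneg le_rfl) hf.lower_init s
  · refine mul_le_mul_of_nonneg_left (Finset.sum_le_sum fun s _ => ?_) (π.seqProb_nonneg _ _)
    exact rawEvolve_le_rawEvolve (H := H) (fun h _ => f.trans_nonneg h) hf.upper_trans
      (fun h _ => f.emit_nonneg h) hf.upper_emit 0 _ hl f.init_nonneg hf.upper_init s

theorem abs_sub_one_le_of_grid {ι : Type*} [Fintype ι] {p l u : ι → ℝ} (hp : ∑ i, p i = 1)
    (hl : ∀ i, l i ≤ p i) (hu : ∀ i, p i ≤ u i) {η : ℝ} (hlu : ∀ i, u i = l i + η) {x : ℝ}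
    (hx : Fintype.card ι * η ≤ x) : 1 - x ≤ ∑ i, l i ∧ ∑ i, u i ≤ 1 + x := by
  have h1 : ∑ i, u i = ∑ i, l i + Fintype.card ι * η := by
    simp [hlu, Finset.sum_add_distrib]
  have h2 : ∑ i, l i ≤ 1 := by rw [← hp]; exact Finset.sum_le_sum fun i _ => hl i
  have h3 : 1 ≤ ∑ i, u i := by rw [← hp]; exact Finset.sum_le_sum fun i _ => hu i
  constructor <;> linarith

theorem pow_sub_pow_le {x : ℝ} (hx : 0 ≤ x) {n : ℕ} (hn : n * x ≤ 1 / 2) (hx1 : x ≤ 1) :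
    (1 + x) ^ n - (1 - x) ^ n ≤ 3 * (n * x) := by
  have h1 : 1 - n * x ≤ (1 - x) ^ n := by
    have := one_add_mul_le_pow (a := -x) (by linarith) n
    calc 1 - n * x = 1 + n * (-x) := by ring
      _ ≤ (1 + -x) ^ n := this
      _ = (1 - x) ^ n := by ring
  have h2 : (1 + x) ^ n ≤ Real.exp (n * x) := by
    rw [Real.exp_nat_mul]
    exact pow_le_pow_left₀ (by linarith) (by linarith [Real.add_one_le_exp x]) _
  have h3 : Real.exp (n * x) ≤ 1 + 2 * (n * x) := by
    set y := (n : ℝ) * x with hy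
    have hy0 : 0 ≤ y := by positivity
    have h4 := Real.add_one_le_exp (-y)
    have h5 : Real.exp y * Real.exp (-y) = 1 := by rw [← Real.exp_add]; simp
    have h6 := Real.exp_pos y
    have h7 : Real.exp y * (1 - y) ≤ 1 := by nlinarith
    nlinarith
  linarith

theorem Grid.Contains.sum_abs_weight_sub_le {γ : Grid S O A H M} {f : POMDP S O A}
    (hf : γ.Contains f) {x : ℝ}
    (hx : ((Fintype.card S : ℝ) + Fintype.card O) / M ≤ x) (hx1 : x ≤ 1)
    (hxH : ((2 * H + 1 : ℕ) : ℝ) * x ≤ 1 / 2) (π : Policy O A) :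
    ∑ τ, |γ.weight 0 π τ - γ.weight 1 π τ| ≤ 3 * (((2 * H + 1 : ℕ) : ℝ) * x) := by
  have hx0 : 0 ≤ x := le_trans (by positivity) hx
  have hS : Fintype.card S * (1 / (M : ℝ)) ≤ x := by
    refine le_trans ?_ hx
    rw [add_div, mul_one_div]
    have : 0 ≤ (Fintype.card O : ℝ) / M := by positivity
    linarith
  have hO : Fintype.card O * (1 / (M : ℝ)) ≤ x := by
    refine le_trans ?_ hx
    rw [add_div, mul_one_div]
    have : 0 ≤ (Fintype.card S : ℝ) / M := by positivity
    linarith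
  have hinit := abs_sub_one_le_of_grid f.init_sum hf.lower_init hf.upper_init (η := 1 / (M : ℝ))
    (fun s => by simp only [Grid.init]; ring) hS
  have htrans := fun h (hh : h < H) a s => abs_sub_one_le_of_grid (f.trans_sum h a s)
    (hf.lower_trans h hh a s) (hf.upper_trans h hh a s) (η := 1 / (M : ℝ))
    (fun s' => by simp only [Grid.trans, dif_pos hh]; ring) hS
  have hemit := fun h (hh : h < H) s => abs_sub_one_le_of_grid (f.emit_sum h s)
    (hf.lower_emit h hh s) (hf.upper_emit h hh s) (η := 1 / (M : ℝ))
    (fun o => by simp only [Grid.emit, dif_pos hh]; ring) hO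
  have hup : ∑ τ, γ.weight 1 π τ ≤ (1 + x) ^ (2 * H + 1) := by
    have := listSum_seqProb_mul_rawEvolve_le (H := H) (c := 1 + x) (by linarith)
      (fun h _ => γ.emit_nonneg zero_le_one h) (fun h _ => γ.trans_nonneg zero_le_one h)
      (fun h hh a s => (htrans h hh a s).2) (fun h hh s => (hemit h hh s).2) π H 0 (by omega) []
      (γ.init_nonneg zero_le_one)
    refine le_trans this ?_
    rw [pow_succ]
    exact mul_le_mul_of_nonneg_left hinit.2 (pow_nonneg (by linarith) _)
  have hlow : (1 - x) ^ (2 * H + 1) ≤ ∑ τ, γ.weight 0 π τ := by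
    have := le_listSum_seqProb_mul_rawEvolve (H := H) (c := 1 - x) (by linarith)
      (fun h _ => γ.emit_nonneg le_rfl h) (fun h _ => γ.trans_nonneg le_rfl h)
      (fun h hh a s => (htrans h hh a s).1) (fun h hh s => (hemit h hh s).1) π H 0 (by omega) []
      (γ.init_nonneg le_rfl)
    refine le_trans ?_ this
    rw [pow_succ]
    exact mul_le_mul_of_nonneg_left hinit.1 (pow_nonneg (by linarith) _)
  have habs : ∑ τ, |γ.weight 0 π τ - γ.weight 1 π τ| =
      ∑ τ, γ.weight 1 π τ - ∑ τ, γ.weight 0 π τ := by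
    rw [← Finset.sum_sub_distrib]
    refine Finset.sum_congr rfl fun τ _ => ?_
    have := hf.weight_le π τ
    rw [abs_sub_comm, abs_of_nonneg (by linarith)]
  rw [habs]
  have := pow_sub_pow_le hx0 hxH hx1
  linarith

/-- The exponent of the bracket number: the number of parameters of a model. -/
def numParams (S O A : Type*) [Fintype S] [Fintype O] [Fintype A] (H : ℕ) : ℕ :=
  Fintype.card S + H * (Fintype.card A * (Fintype.card S * Fintype.card S)) +
    H * (Fintype.card S * Fintype.card O)

/-- The brackets are the boxes of a grid on the space of parameters, of mesh `1 / M` with `M` of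
the order `H (|S| + |O|) / ε`. -/
theorem exists_hasBracket (F : Set (POMDP S O A)) (H : ℕ) {ε : ℝ} (hε : 0 < ε) (hε1 : ε ≤ 1) :
    ∃ n, HasBracket F H ε n ∧ Real.log n ≤ numParams S O A H *
      (8 * (2 * H + 1) * (Fintype.card S + Fintype.card O) + Real.log (1 / ε)) := by
  classical
  have hlogε : 0 ≤ Real.log (1 / ε) := Real.log_nonneg (by rw [le_div_iff₀ hε]; linarith)
  by_cases hne : Nonempty (POMDP S O A)
  swap
  · refine ⟨0, ⟨fun i => i.elim0, fun i => i.elim0, fun i => i.elim0,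
      fun f _ => absurd ⟨f⟩ hne⟩, ?_⟩
    simp only [Nat.cast_zero, Real.log_zero]
    positivity
  obtain ⟨f₀⟩ := hne
  have := f₀.nonempty_state
  have hS : (1 : ℝ) ≤ Fintype.card S := by exact_mod_cast Fintype.card_pos
  set D : ℝ := Fintype.card S + Fintype.card O with hD
  have hD1 : 1 ≤ D := by
    have : (0 : ℝ) ≤ Fintype.card O := by positivity
    linarith
  set N : ℝ := ((2 * H + 1 : ℕ) : ℝ) with hN
  have hN1 : 1 ≤ N := by rw [hN]; exact_mod_cast (by omega : 1 ≤ 2 * H + 1)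
  set M : ℕ := ⌈6 * N * D / ε⌉₊ with hM
  have hy : 6 ≤ 6 * N * D / ε := by
    rw [le_div_iff₀ hε]; nlinarith
  have hMy : 6 * N * D / ε ≤ M := Nat.le_ceil _
  have hMpos : 0 < M := by
    have : (0 : ℝ) < M := by linarith
    exact_mod_cast this
  have hMR : (0 : ℝ) < M := by exact_mod_cast hMpos
  have hNx : N * (D / M) ≤ ε / 6 := by
    rw [div_le_iff₀ hε] at hMy
    rw [← mul_div_assoc, div_le_iff₀ hMR]
    linarith
  have hx1 : D / M ≤ 1 := by
    have : 0 ≤ D / M := by positivity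
    nlinarith
  -- only boxes that contain a model: for these the upper and lower weights are nearly normalized
  let Γ := {γ : Grid S O A H M // ∃ f : POMDP S O A, γ.Contains f}
  let e : Fin (Fintype.card Γ) ≃ Γ := (Fintype.equivFin Γ).symm
  refine ⟨Fintype.card Γ, ⟨fun i => (e i).1.weight 0, fun i => (e i).1.weight 1, fun i π => ?_,
    fun f _ => ?_⟩, ?_⟩
  · obtain ⟨f, hf⟩ := (e i).2
    refine (hf.sum_abs_weight_sub_le (x := D / M) le_rfl hx1 (by linarith) π).trans ?_
    linarith
  · obtain ⟨γ, hγ⟩ := exists_grid_contains (H := H) hMpos f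
    refine ⟨e.symm ⟨γ, f, hγ⟩, fun π τ => ?_⟩
    simp only [Equiv.apply_symm_apply]
    exact hγ.weight_le π τ
  · have hcard : Fintype.card Γ ≤ (M + 1) ^ numParams S O A H := by
      refine (Fintype.card_subtype_le _).trans (le_of_eq ?_)
      simp only [Fintype.card_prod, Fintype.card_fun, Fintype.card_fin, numParams, pow_add]
      ring
    have hΓ : 0 < Fintype.card Γ := by
      obtain ⟨γ, hγ⟩ := exists_grid_contains (H := H) hMpos f₀
      exact Fintype.card_pos_iff.mpr ⟨⟨γ, f₀, hγ⟩⟩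
    have h1 : Real.log (Fintype.card Γ) ≤ numParams S O A H * Real.log (M + 1) := by
      rw [← Real.log_pow]
      refine Real.log_le_log (by exact_mod_cast hΓ) ?_
      exact_mod_cast hcard
    refine h1.trans (mul_le_mul_of_nonneg_left ?_ (Nat.cast_nonneg _))
    have hM2 : (M : ℝ) + 1 ≤ 8 * N * D * (1 / ε) := by
      have h2 : (M : ℝ) < 6 * N * D / ε + 1 := Nat.ceil_lt_add_one (by linarith)
      have h3 : 8 * N * D * (1 / ε) = 6 * N * D / ε + 2 * N * D / ε := by ring
      have h4 : 2 ≤ 2 * N * D / ε := by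
        rw [le_div_iff₀ hε]; nlinarith
      linarith
    have hpos : 0 < 8 * N * D := by positivity
    calc Real.log (M + 1) ≤ Real.log (8 * N * D * (1 / ε)) :=
          Real.log_le_log (by positivity) hM2
      _ = Real.log (8 * N * D) + Real.log (1 / ε) :=
          Real.log_mul hpos.ne' (by positivity)
      _ ≤ 8 * N * D + Real.log (1 / ε) := by
          have := Real.log_le_sub_one_of_pos hpos
          linarith
      _ = _ := by rw [hN]; push_cast; ring

theorem log_bracketNumber_le (F : Set (POMDP S O A)) (H : ℕ) {ε : ℝ} (hε : 0 < ε) (hε1 : ε ≤ 1) :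
    Real.log (bracketNumber F H ε) ≤ numParams S O A H *
      (8 * (2 * H + 1) * (Fintype.card S + Fintype.card O) + Real.log (1 / ε)) := by
  obtain ⟨n, hn, hlog⟩ := exists_hasBracket F H hε hε1
  refine le_trans ?_ hlog
  have hle : bracketNumber F H ε ≤ n := Nat.sInf_le hn
  rcases Nat.eq_zero_or_pos (bracketNumber F H ε) with h | h
  · rw [h, Nat.cast_zero, Real.log_zero]
    exact Real.log_natCast_nonneg n
  · exact Real.log_le_log (by exact_mod_cast h) (by exact_mod_cast hle)

theorem hasBracket_bracketNumber (F : Set (POMDP S O A)) (H : ℕ) {ε : ℝ} (hε : 0 < ε)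
    (hε1 : ε ≤ 1) : HasBracket F H ε (bracketNumber F H ε) :=
  Nat.sInf_mem (s := {n | HasBracket F H ε n})
    (let ⟨n, hn, _⟩ := exists_hasBracket F H hε hε1; ⟨n, hn⟩)

theorem HasBracket.pos {F : Set (POMDP S O A)} {ε : ℝ} {n : ℕ} (h : HasBracket F H ε n)
    {f : POMDP S O A} (hf : f ∈ F) : 0 < n := by
  obtain ⟨_, _, _, h2⟩ := h
  obtain ⟨i, _⟩ := h2 f hf
  exact i.pos

end Bracket

/-! ### The sample complexity -/

section SampleComplexity

/-- A polynomial bound of the logarithm in `craneBeta`, up to the factor `1 + log K`. The variables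
are `|A|^m`, `|O|`, `|S|`, `H` and `log (1 / δ)`. -/
def logSizeBound {R : Type*} [CommRing R] (a o s H d : R) : R :=
  (s + H * (a * (s * s)) + H * (s * o)) * (8 * (2 * H + 1) * (s + o) + 1 + H + a) +
    1 + H + a + d

/-- A polynomial bound of the regret, up to the factor `√K (1 + log K)²`. -/
def regretBound {R : Type*} [CommRing R] (a g o s H d : R) : R :=
  H * ((1 + g) * (H * (4 * s * s * ((a + a * g * a) *
    (4 * s + 158 * H * a * logSizeBound a o s H d)))))

/-- The polynomial of the sample complexity; `l` stands for `log (1 + 1 / ε)`. -/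
def sampleBound {R : Type*} [CommRing R] (a g o s H d l : R) : R :=
  (65536 * regretBound a g o s H d ^ 2 + 4 * regretBound a g o s H d * (1 + 2 * l) ^ 2) ^ 2

/-- The logarithmic factors `1 + log K` are absorbed: with `y = √K ε`, the bound
`log K ≤ 2 log y + 2 log (1 + 1 / ε)` holds, and `(log y)²` is at most `16 √y`. -/
theorem mul_one_add_log_sq_le {C ε K : ℝ} (hC : 1 ≤ C) (hε : 0 < ε) (hK1 : 1 ≤ K)
    (hK : 1 / ε ^ 2 * (65536 * C ^ 2 + 4 * C * (1 + 2 * Real.log (1 + 1 / ε)) ^ 2) ^ 2 ≤ K) :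
    C * (1 + Real.log K) ^ 2 ≤ √K * ε := by
  set l := Real.log (1 + 1 / ε) with hl
  have hε' : 0 < 1 / ε := by positivity
  have hl0 : 0 ≤ l := Real.log_nonneg (by linarith)
  set Y := 65536 * C ^ 2 + 4 * C * (1 + 2 * l) ^ 2 with hY
  have hY0 : 0 ≤ Y := by positivity
  set y := √K * ε with hy
  have hYy : Y ≤ y := by
    have h1 : Y ^ 2 ≤ K * ε ^ 2 := by
      have h2 := mul_le_mul_of_nonneg_right hK (sq_nonneg ε)
      have h3 : 1 / ε ^ 2 * Y ^ 2 * ε ^ 2 = Y ^ 2 := by field_simp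
      rwa [h3] at h2
    have h4 : y ^ 2 = K * ε ^ 2 := by
      rw [hy, mul_pow, Real.sq_sqrt (by linarith)]
    exact le_of_sq_le_sq (by rw [h4]; exact h1) (by positivity)
  have hterm : 0 ≤ 4 * C * (1 + 2 * l) ^ 2 := by positivity
  have hy1 : 1 ≤ y := by nlinarith
  have hy0 : 0 < y := by linarith
  have hK0 : 0 < K := by linarith
  have hlogK : Real.log K ≤ 2 * Real.log y + 2 * l := by
    have h1 : √K = y * (1 / ε) := by rw [hy]; field_simp
    have h2 : Real.log K = 2 * Real.log √K := by rw [Real.log_sqrt hK0.le]; ring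
    rw [h2, h1, Real.log_mul hy0.ne' hε'.ne']
    have h3 : Real.log (1 / ε) ≤ l := Real.log_le_log hε' (by linarith)
    linarith
  have hlogy0 : 0 ≤ Real.log y := Real.log_nonneg hy1
  have hlogy : Real.log y ^ 2 ≤ 16 * √y := by
    have h1 : Real.log y = 4 * Real.log √(√y) := by
      rw [Real.log_sqrt (Real.sqrt_nonneg _), Real.log_sqrt hy0.le]; ring
    have h2 : Real.log √(√y) ≤ √(√y) := by
      have := Real.log_le_sub_one_of_pos (Real.sqrt_pos.mpr (Real.sqrt_pos.mpr hy0))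
      linarith
    have h3 : Real.log y ≤ 4 * √(√y) := by linarith
    calc Real.log y ^ 2 ≤ (4 * √(√y)) ^ 2 := pow_le_pow_left₀ hlogy0 h3 2
      _ = 16 * √y := by rw [mul_pow, Real.sq_sqrt (Real.sqrt_nonneg _)]; norm_num
  have hlogK0 : 0 ≤ Real.log K := Real.log_nonneg hK1
  have h5 : (1 + Real.log K) ^ 2 ≤ 2 * (1 + 2 * l) ^ 2 + 8 * Real.log y ^ 2 := by
    have h6 : (1 + Real.log K) ^ 2 ≤ ((1 + 2 * l) + 2 * Real.log y) ^ 2 :=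
      pow_le_pow_left₀ (by linarith) (by linarith) 2
    nlinarith [sq_nonneg ((1 + 2 * l) - 2 * Real.log y)]
  have hsy : 256 * C ≤ √y := by
    apply Real.le_sqrt_of_sq_le
    nlinarith
  have hsy2 : √y * √y = y := Real.mul_self_sqrt hy0.le
  have h7 : 128 * C * √y ≤ y / 2 := by nlinarith [Real.sqrt_nonneg y]
  have h8 : 2 * C * (1 + 2 * l) ^ 2 ≤ y / 2 := by nlinarith
  calc C * (1 + Real.log K) ^ 2 ≤ C * (2 * (1 + 2 * l) ^ 2 + 8 * (16 * √y)) := by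
        refine mul_le_mul_of_nonneg_left (h5.trans ?_) (by linarith)
        linarith
    _ = 2 * C * (1 + 2 * l) ^ 2 + 128 * C * √y := by ring
    _ ≤ y := by linarith

theorem le_regretBound {a g o s H d : ℝ} (ha : 1 ≤ a) (hg : 0 ≤ g) (ho : 0 ≤ o) (hs : 1 ≤ s)
    (hH : 1 ≤ H) (hd : 0 ≤ d) : H ≤ regretBound a g o s H d := by
  have hB : 0 ≤ logSizeBound a o s H d := by unfold logSizeBound; positivity
  have h1 : 1 ≤ 4 * s + 158 * H * a * logSizeBound a o s H d := by
    have : 0 ≤ 158 * H * a * logSizeBound a o s H d := by positivity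
    linarith
  have h2 : 1 ≤ a + a * g * a := by
    have : 0 ≤ a * g * a := by positivity
    linarith
  have h3 : 1 ≤ 4 * s * s := by nlinarith
  unfold regretBound
  refine le_mul_of_one_le_right (by linarith) ?_
  exact one_le_mul_of_one_le_of_one_le (by linarith) (one_le_mul_of_one_le_of_one_le hH
    (one_le_mul_of_one_le_of_one_le h3 (one_le_mul_of_one_le_of_one_le h2 h1)))

/-- The logarithm and the square root in the bound of the regret are replaced by polynomials,
`√K`, and factors `1 + log K`; `J` is the number of trajectories of an iteration, and `L` is the
radius of the confidence sets, up to the constant. -/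
theorem regret_le_regretBound {K H s a g o d J L : ℝ} (hK : 1 ≤ K) (hH : 1 ≤ H) (hs : 1 ≤ s)
    (ha : 1 ≤ a) (hg : 0 ≤ g) (ho : 0 ≤ o) (hd : 0 ≤ d) (hJ0 : 0 ≤ J) (hJ : J ≤ H * a)
    (hL0 : 0 ≤ L) (hL : L ≤ logSizeBound a o s H d * (1 + Real.log K)) :
    H * ((1 + g) * (H * (4 * s * Real.log (s + K) * ((a + a * g * a) *
      (4 * s + √(K * J * (48 * (3 * L) + 14))))))) ≤
      √K * (regretBound a g o s H d * (1 + Real.log K) ^ 2) := by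
  set B := logSizeBound a o s H d with hB
  set l := Real.log K with hl
  have hl0 : 0 ≤ l := Real.log_nonneg hK
  have hB1 : 1 ≤ B := by
    have : 0 ≤ (s + H * (a * (s * s)) + H * (s * o)) *
      (8 * (2 * H + 1) * (s + o) + 1 + H + a) := by positivity
    rw [hB, logSizeBound]; linarith
  have hsK : 1 ≤ √K := Real.one_le_sqrt.mpr hK
  have hlogS : Real.log (s + K) ≤ s * (1 + l) := by
    have h1 : s + K ≤ (1 + s) * K := by nlinarith
    have h2 := Real.log_le_log (by linarith) h1
    rw [Real.log_mul (by linarith) (by linarith)] at h2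
    have h3 := Real.log_le_sub_one_of_pos (show 0 < 1 + s by linarith)
    nlinarith
  have hlogS0 : 0 ≤ Real.log (s + K) := Real.log_nonneg (by linarith)
  have hZ : √(K * J * (48 * (3 * L) + 14)) ≤ √K * (158 * H * a * B * (1 + l)) := by
    have h1 : 48 * (3 * L) + 14 ≤ 158 * (B * (1 + l)) := by nlinarith
    set y := 158 * H * a * B * (1 + l) with hy
    have hy1 : 1 ≤ y := one_le_mul_of_one_le_of_one_le (one_le_mul_of_one_le_of_one_le
      (one_le_mul_of_one_le_of_one_le (by linarith) ha) hB1) (by linarith)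
    have h3 : J * (48 * (3 * L) + 14) ≤ y := by
      calc _ ≤ H * a * (158 * (B * (1 + l))) :=
            mul_le_mul hJ h1 (by linarith) (by positivity)
        _ = y := by rw [hy]; ring
    rw [mul_assoc, Real.sqrt_mul (by linarith)]
    refine mul_le_mul_of_nonneg_left ?_ (by linarith)
    rw [Real.sqrt_le_left (by linarith)]
    nlinarith
  have hfac : 4 * s + √(K * J * (48 * (3 * L) + 14)) ≤
      √K * ((4 * s + 158 * H * a * B) * (1 + l)) := by
    have h1 : 4 * s ≤ √K * (4 * s * (1 + l)) := by
      have h2 : 4 * s ≤ 4 * s * (1 + l) := le_mul_of_one_le_right (by linarith) (by linarith)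
      exact h2.trans (le_mul_of_one_le_left (by positivity) hsK)
    refine (add_le_add h1 hZ).trans_eq ?_
    ring
  set Z := √(K * J * (48 * (3 * L) + 14))
  have hZ0 : 0 ≤ Z := Real.sqrt_nonneg _
  have h1 : 4 * s * Real.log (s + K) ≤ 4 * s * (s * (1 + l)) :=
    mul_le_mul_of_nonneg_left hlogS (by linarith)
  have h2 : (a + a * g * a) * (4 * s + Z) ≤
      (a + a * g * a) * (√K * ((4 * s + 158 * H * a * B) * (1 + l))) :=
    mul_le_mul_of_nonneg_left hfac (by positivity)
  have h3 := mul_le_mul h1 h2 (by positivity) (by positivity)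
  calc _ ≤ H * ((1 + g) * (H * (4 * s * (s * (1 + l)) * ((a + a * g * a) *
          (√K * ((4 * s + 158 * H * a * B) * (1 + l))))))) :=
        mul_le_mul_of_nonneg_left (mul_le_mul_of_nonneg_left
          (mul_le_mul_of_nonneg_left h3 (by linarith)) (by linarith)) (by linarith)
    _ = √K * (regretBound a g o s H d * (1 + l) ^ 2) := by
        rw [regretBound, ← hB]; ring

theorem numActionSeqs_eq (A : Type*) [Fintype A] (m : ℕ) :
    numActionSeqs A m = Fintype.card A ^ (m - 1) := by
  simp [numActionSeqs]

/-- The radius `β` is at most a polynomial times `1 + log K`. -/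
theorem log_craneSize_le [Nonempty A] [Nonempty S] (F : Set (POMDP S O A)) {H m K : ℕ}
    (hm : 1 ≤ m) (hmH : m ≤ H) (hK : 0 < K) {δ : ℝ} (hδ : 0 < δ) (hδ1 : δ ≤ 1)
    (hN : 0 < bracketNumber F H (1 / (K * H * numActionSeqs A m))) :
    Real.log ((bracketNumber F H (1 / (K * H * numActionSeqs A m)) : ℝ) *
      K * H * numActionSeqs A m / δ) ≤
      logSizeBound ((Fintype.card A : ℝ) ^ m) (Fintype.card O) (Fintype.card S) H
        (Real.log (1 / δ)) * (1 + Real.log K) := by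
  set a := (Fintype.card A : ℝ) ^ m with ha
  set o := (Fintype.card O : ℝ)
  set s := (Fintype.card S : ℝ)
  set d := Real.log (1 / δ) with hd
  set U := (numActionSeqs A m : ℝ) with hU
  have hA : (1 : ℝ) ≤ Fintype.card A := by exact_mod_cast Fintype.card_pos
  have hAa : (Fintype.card A : ℝ) ≤ a := le_self_pow₀ hA (by omega)
  have ha1 : 1 ≤ a := hA.trans hAa
  have hU' : U = (Fintype.card A : ℝ) ^ (m - 1) := by
    rw [hU, numActionSeqs_eq]; push_cast; rfl
  have hU1 : 1 ≤ U := by rw [hU']; exact one_le_pow₀ hA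
  have hUa : U ≤ a := by rw [hU']; exact pow_le_pow_right₀ hA (by omega)
  have hK1 : (1 : ℝ) ≤ K := by exact_mod_cast hK
  have hH1 : (1 : ℝ) ≤ H := by exact_mod_cast (by omega : 1 ≤ H)
  have ho : 0 ≤ o := Nat.cast_nonneg _
  have hs : 0 ≤ s := Nat.cast_nonneg _
  have hd0 : 0 ≤ d := Real.log_nonneg (by rw [le_div_iff₀ hδ]; linarith)
  set l := Real.log K with hl
  have hl0 : 0 ≤ l := Real.log_nonneg hK1
  have hlogU : Real.log U ≤ a := by
    have := Real.log_le_sub_one_of_pos (by linarith : 0 < U)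
    linarith
  have hlogH : Real.log H ≤ H := by
    have := Real.log_le_sub_one_of_pos (by linarith : (0 : ℝ) < H)
    linarith
  set N := bracketNumber F H (1 / (K * H * U)) with hNdef
  have hN0 : (0 : ℝ) < N := by exact_mod_cast hN
  have hKHU : 1 ≤ K * H * U :=
    one_le_mul_of_one_le_of_one_le (one_le_mul_of_one_le_of_one_le hK1 hH1) hU1
  have hlogKHU : Real.log (K * H * U) ≤ l + H + a := by
    rw [Real.log_mul (by positivity) (by positivity), Real.log_mul (by positivity) (by positivity)]
    linarith
  have hlogN := log_bracketNumber_le F H (ε := 1 / (K * H * U)) (by positivity)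
    (by rw [div_le_one (by positivity)]; exact hKHU)
  rw [← hNdef, one_div_one_div] at hlogN
  set np := (numParams S O A H : ℝ) with hnp
  have hnp0 : 0 ≤ np := Nat.cast_nonneg _
  set np' := s + H * (a * (s * s)) + H * (s * o) with hnp'
  have hnp_le : np ≤ np' := by
    have h1 : np = s + H * (Fintype.card A * (s * s)) + H * (s * o) := by
      rw [hnp, numParams]; push_cast; rfl
    have h2 : (Fintype.card A : ℝ) * (s * s) ≤ a * (s * s) :=
      mul_le_mul_of_nonneg_right hAa (by positivity)
    have h3 := mul_le_mul_of_nonneg_left h2 (by linarith : (0 : ℝ) ≤ H)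
    rw [h1, hnp']; linarith
  have hlogX : Real.log (N * K * H * U / δ) = Real.log N + Real.log (K * H * U) + d := by
    rw [hd, ← Real.log_mul (by positivity) (by positivity),
      ← Real.log_mul (by positivity) (by positivity)]
    congr 1
    ring
  rw [hlogX]
  have h4 : Real.log N ≤ np' * (8 * (2 * H + 1) * (s + o) + (l + H + a)) := by
    refine hlogN.trans (mul_le_mul hnp_le (by linarith) ?_ (hnp0.trans hnp_le))
    have := Real.log_nonneg hKHU
    positivity
  have hnp'0 := hnp0.trans hnp_le
  have hB : logSizeBound a o s H d =
      np' * (8 * (2 * H + 1) * (s + o) + 1 + H + a) + 1 + H + a + d := rfl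
  have h5 : 0 ≤ np' * (8 * (2 * H + 1) * (s + o) + H + a) * l := by positivity
  have h6 : 0 ≤ (H + a + d) * l := by positivity
  rw [hB]
  nlinarith

/-- The failure probability of the confidence sets is at most `δ`, since `exp (-β)` is the third
power of `δ / (N K H |U_A|)`. -/
theorem mul_exp_add_exp_le {K N X δ : ℝ} (hX : 2 ≤ X) (hKN0 : 0 ≤ K * N) (hKN : K * N ≤ X * δ) :
    K * N * (Real.exp (1 - 3 * Real.log X) + Real.exp (-(3 * (3 * Real.log X) / 2))) ≤ δ := by
  have hX0 : 0 < X := by linarith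
  have hlog : 0 ≤ Real.log X := Real.log_nonneg (by linarith)
  have h1 : Real.exp (-(3 * Real.log X)) = (X ^ 3)⁻¹ := by
    rw [Real.exp_neg, ← Real.exp_log (show 0 < X ^ 3 by positivity), Real.log_pow]
    push_cast; rfl
  have h2 : Real.exp (1 - 3 * Real.log X) ≤ 3 * (X ^ 3)⁻¹ := by
    rw [sub_eq_add_neg, Real.exp_add, h1]
    refine mul_le_mul_of_nonneg_right ?_ (by positivity)
    linarith [Real.exp_one_lt_d9]
  have h3 : Real.exp (-(3 * (3 * Real.log X) / 2)) ≤ (X ^ 3)⁻¹ := by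
    rw [← h1, Real.exp_le_exp]; linarith
  have hδ : 0 ≤ δ := by
    by_contra h
    push Not at h
    nlinarith
  calc _ ≤ X * δ * (4 * (X ^ 3)⁻¹) :=
        mul_le_mul hKN (by linarith) (by positivity) (by positivity)
    _ = δ * (4 / X ^ 2) := by field_simp
    _ ≤ δ * 1 := by
        refine mul_le_mul_of_nonneg_left ?_ hδ
        rw [div_le_one (by positivity)]
        nlinarith
    _ = δ := mul_one δ

/-- The guarantee of the algorithm, with an explicit polynomial. -/
theorem one_sub_le_runEventProb_optValue [Nonempty A] {fstar : POMDP S O A} {H m : ℕ}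
    (hm : 1 ≤ m) (hmH : m ≤ H) {r : Fin H → O → A → ℝ}
    (hr : ∀ h o a, 0 ≤ r h o a ∧ r h o a ≤ 1) {α : ℝ} (hα : 0 < α) {F : Set (POMDP S O A)}
    (hF : IsAdmissibleClass F fstar H m α) {δ ε : ℝ} (hδ : 0 < δ) (hδ1 : δ ≤ 1) (hε : 0 < ε)
    {K : ℕ}
    (hK : 1 / ε ^ 2 * sampleBound ((Fintype.card A : ℝ) ^ m) (1 / α) (Fintype.card O : ℝ)
      (Fintype.card S) H (Real.log (1 / δ)) (Real.log (1 + 1 / ε)) ≤ K)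
    (plan : Planner S O A H m) (hplan : IsCrane K plan F r (craneBeta F H m K 3 δ)) :
    1 - δ ≤ runEventProb plan fstar (fun ω : Outcome O A H m K =>
      fstar.optValue r - ε ≤ fstar.mixtureValue r (fun k => (plan.select ω k).2)) := by
  have := fstar.nonempty_state
  have := nonempty_policy (O := O) (A := A)
  rcases le_or_gt (H : ℝ) ε with hHε | hHε
  · -- if `ε ≥ H`, then every policy is `ε`-optimal
    refine one_sub_le_runEventProb _ _ ?_
    refine (runEventProb_eq_zero _ _ fun ω hω => hω ?_).trans_le hδ.le
    have h1 : fstar.optValue r ≤ H := ciSup_le fun π => fstar.value_le hr π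
    have h2 : 0 ≤ fstar.mixtureValue r (fun k => (plan.select ω k).2) := by
      rw [POMDP.mixtureValue_eq]
      exact mul_nonneg (by positivity) (Finset.sum_nonneg fun k _ => fstar.value_nonneg hr _)
    linarith
  set a := (Fintype.card A : ℝ) ^ m
  set o := (Fintype.card O : ℝ)
  set s := (Fintype.card S : ℝ) with hs
  set d := Real.log (1 / δ) with hd
  set g := 1 / α
  have hA : (1 : ℝ) ≤ Fintype.card A := by exact_mod_cast Fintype.card_pos
  have ha1 : 1 ≤ a := one_le_pow₀ hA
  have hg0 : 0 ≤ g := by positivity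
  have ho0 : 0 ≤ o := Nat.cast_nonneg _
  have hs1 : 1 ≤ s := by rw [hs]; exact_mod_cast Fintype.card_pos
  have hH1 : (1 : ℝ) ≤ H := by exact_mod_cast (by omega : 1 ≤ H)
  have hd0 : 0 ≤ d := Real.log_nonneg (by rw [le_div_iff₀ hδ]; linarith)
  set C := regretBound a g o s H d
  have hCH : (H : ℝ) ≤ C := le_regretBound ha1 hg0 ho0 hs1 hH1 hd0
  have hC1 : 1 ≤ C := hH1.trans hCH
  have hK2 : (2 : ℝ) ≤ K := by
    refine le_trans ?_ hK
    have hl0 : 0 ≤ 4 * C * (1 + 2 * Real.log (1 + 1 / ε)) ^ 2 := by positivity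
    have h1 : 2 * ε ≤ 65536 * C ^ 2 + 4 * C * (1 + 2 * Real.log (1 + 1 / ε)) ^ 2 := by
      nlinarith
    have h2 : (2 * ε) ^ 2 ≤ sampleBound a g o s H d (Real.log (1 + 1 / ε)) :=
      pow_le_pow_left₀ (by positivity) h1 2
    have h3 : 1 / ε ^ 2 * (2 * ε) ^ 2 = 4 := by field_simp; norm_num
    have h4 := mul_le_mul_of_nonneg_left h2 (show 0 ≤ 1 / ε ^ 2 by positivity)
    linarith
  have hK0 : 0 < K := by
    have : (0 : ℝ) < K := by linarith
    exact_mod_cast this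
  set U := (numActionSeqs A m : ℝ) with hU
  have hU' : U = (Fintype.card A : ℝ) ^ (m - 1) := by
    rw [hU, numActionSeqs_eq]; push_cast; rfl
  have hU1 : 1 ≤ U := by rw [hU']; exact one_le_pow₀ hA
  have hUa : U ≤ a := by rw [hU']; exact pow_le_pow_right₀ hA (by omega)
  have hKHU : 1 ≤ K * H * U :=
    one_le_mul_of_one_le_of_one_le (one_le_mul_of_one_le_of_one_le (by linarith) hH1) hU1
  have hεb0 : 0 < 1 / (K * H * U) := by positivity
  have hεb1 : 1 / (K * H * U) ≤ 1 := by rw [div_le_one (by positivity)]; exact hKHU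
  have hbr := hasBracket_bracketNumber F H hεb0 hεb1
  set N := bracketNumber F H (1 / (K * H * U))
  have hNpos : 0 < N := hbr.pos hF.realizable
  have hN1 : (1 : ℝ) ≤ N := by exact_mod_cast hNpos
  have hJ : (Fintype.card (ExploreIndex A H m) : ℝ) ≤ H * U := by
    have h1 : Fintype.card (ExploreIndex A H m) = (H - m + 1) * numActionSeqs A m := by
      simp [ExploreIndex, numActionSeqs]
    rw [h1]
    push_cast
    refine mul_le_mul_of_nonneg_right ?_ (by linarith)
    exact_mod_cast (by omega : H - m + 1 ≤ H)
  set X := (N : ℝ) * K * H * U / δ with hX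
  have hβ : craneBeta F H m K 3 δ = 3 * Real.log X := rfl
  have hKNX : (K : ℝ) * N ≤ X * δ := by
    rw [hX, div_mul_cancel₀ _ hδ.ne']
    have h1 : 1 ≤ (H : ℝ) * U := one_le_mul_of_one_le_of_one_le hH1 hU1
    have h2 : 0 ≤ (K : ℝ) * N := by positivity
    nlinarith
  have hX2 : 2 ≤ X := by
    have h1 : X * δ ≤ X := mul_le_of_le_one_right (by positivity) hδ1
    have h2 : (K : ℝ) ≤ K * N := le_mul_of_one_le_right (by linarith) hN1
    linarith
  have hlogX0 : 0 ≤ Real.log X := Real.log_nonneg (by linarith)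
  have hlogX := log_craneSize_le F hm hmH hK0 hδ hδ1 hNpos
  rw [hβ] at hplan
  have hεK : 1 / (K * H * U) * (K * Fintype.card (ExploreIndex A H m)) ≤ 1 := by
    rw [one_div_mul_eq_div, div_le_one (by positivity), mul_assoc]
    exact mul_le_mul_of_nonneg_left hJ (by linarith)
  refine (one_sub_le_runEventProb_confidence plan hF.realizable hεb0.le hεb1 hεK hbr
    (mul_exp_add_exp_le hX2 (by positivity) hKNX)).trans (runEventProb_mono _ _ fun ω hω => ?_)
  have hreg := mul_optValue_sub_mixtureValue_le hα hm hmH hF hr hK0 plan hplan ω hω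
  set gap := fstar.optValue r - fstar.mixtureValue r (fun k => (plan.select ω k).2)
  suffices gap ≤ ε by linarith
  have hkey := mul_one_add_log_sq_le hC1 hε (by linarith : (1 : ℝ) ≤ K) hK
  have hsK0 : 0 < √(K : ℝ) := Real.sqrt_pos.mpr (by linarith)
  have hsK2 : √(K : ℝ) * √(K : ℝ) = K := Real.mul_self_sqrt (by linarith)
  have hfinal : K * gap ≤ √K * (C * (1 + Real.log K) ^ 2) :=
    hreg.trans (regret_le_regretBound (by linarith) hH1 hs1 ha1 hg0 ho0 hd0 (Nat.cast_nonneg _)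
      (hJ.trans (mul_le_mul_of_nonneg_left hUa (by linarith))) hlogX0 hlogX)
  have h9 : √K * (√K * gap) ≤ √K * (√K * ε) := by
    rw [← mul_assoc, hsK2]
    exact hfinal.trans (mul_le_mul_of_nonneg_left hkey hsK0.le)
  exact le_of_mul_le_mul_left (le_of_mul_le_mul_left h9 hsK0) hsK0

end SampleComplexity

end CranePSR

end

theorem corollary3 :
    -- the m-step futures are core test sets, and the PSR rank is at most |S|
    (∀ (S O A : Type*) [Fintype S] [Fintype O] [Fintype A] [Nonempty A]
      (H m : ℕ), 1 ≤ m → m ≤ H →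
      ∀ fstar : CranePSR.POMDP S O A, fstar.IsWeaklyRevealing H m →
        (∀ h, h ≤ H - m →
          fstar.IsCoreTestSet H h (CranePSR.mStepFutures O A H h m)) ∧
        fstar.psrRank H ≤ Fintype.card S) ∧
    -- the log bracket number of a class of tabular POMDPs is polynomial
    (∃ Q : MvPolynomial (Fin 5) ℝ,
      ∀ (S O A : Type*) [Fintype S] [Fintype O] [Fintype A] [Nonempty A]
        (H : ℕ) (F : Set (CranePSR.POMDP S O A)) (ε : ℝ), 0 < ε → ε ≤ 1 →
        (∃ n, CranePSR.HasBracket F H ε n) ∧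
        Real.log (CranePSR.bracketNumber F H ε) ≤
          MvPolynomial.eval ![(Fintype.card O : ℝ), (Fintype.card A : ℝ), (Fintype.card S : ℝ),
            (H : ℝ), Real.log (1 / ε)] Q) ∧
    -- the sample complexity of CRANE
    (∃ c : ℝ, 0 < c ∧ ∃ P : MvPolynomial (Fin 8) ℝ,
      ∀ (S O A : Type*) [Fintype S] [Fintype O] [Fintype A] [Nonempty A]
        (H m : ℕ), 1 ≤ m → m ≤ H →
        ∀ (fstar : CranePSR.POMDP S O A), fstar.IsWeaklyRevealing H m →
        ∀ (r : Fin H → O → A → ℝ), (∀ h o a, 0 ≤ r h o a ∧ r h o a ≤ 1) →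
        ∀ (α : ℝ), 0 < α →
        ∀ (F : Set (CranePSR.POMDP S O A)), CranePSR.IsAdmissibleClass F fstar H m α →
        ∀ (δ ε : ℝ), 0 < δ → δ ≤ 1 → 0 < ε →
        ∀ (K : ℕ),
          1 / ε ^ 2 * MvPolynomial.eval ![(fstar.psrRank H : ℝ), (Fintype.card A : ℝ) ^ m, 1 / α,
            (Fintype.card O : ℝ), (Fintype.card S : ℝ), (H : ℝ), Real.log (1 / δ),
            Real.log (1 + 1 / ε)] P ≤ K →
        ∀ (plan : CranePSR.Planner S O A H m),
          CranePSR.IsCrane K plan F r (CranePSR.craneBeta F H m K c δ) →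
          1 - δ ≤ CranePSR.runEventProb plan fstar
            (fun ω : CranePSR.Outcome O A H m K =>
              fstar.optValue r - ε ≤
                fstar.mixtureValue r (fun k => (plan.select ω k).2))) := by
  refine ⟨?_, ?_, 3, by norm_num, ?_⟩
  · intro S O A _ _ _ _ H m hm hmH fstar hf
    exact ⟨fun h hh => hf.isCoreTestSet hm hmH hh, CranePSR.POMDP.psrRank_le_card fstar H⟩
  · refine ⟨(.X 2 + .X 3 * (.X 1 * (.X 2 * .X 2)) + .X 3 * (.X 2 * .X 0)) *
      (8 * (2 * .X 3 + 1) * (.X 2 + .X 0) + .X 4), ?_⟩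
    intro S O A _ _ _ _ H F ε hε hε1
    obtain ⟨n, hn, -⟩ := CranePSR.exists_hasBracket F H hε hε1
    refine ⟨⟨n, hn⟩, (CranePSR.log_bracketNumber_le F H hε hε1).trans_eq ?_⟩
    simp [CranePSR.numParams]
  · -- the dimension enters the bound through `|S|`, which is at least the rank
    refine ⟨CranePSR.sampleBound (.X 1) (.X 2) (.X 3) (.X 4) (.X 5) (.X 6) (.X 7), ?_⟩
    intro S O A _ _ _ _ H m hm hmH fstar _ r hr α hα F hF δ ε hδ hδ1 hε K hK plan hplan
    refine CranePSR.one_sub_le_runEventProb_optValue hm hmH hr hα hF hδ hδ1 hε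
      (le_of_eq_of_le ?_ hK) plan hplan
    simp [CranePSR.sampleBound, CranePSR.regretBound, CranePSR.logSizeBound]
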